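/- Let $K$ be an algebraically closed field of characteristic zero, let $r\ge 1$, and let $\mathbb{P}^N$, $N=\binom{2r+1}{2}-1$, be the projective space of nonzero symmetric $2r\times 2r$ matrices $Z=(z_{i,j})_{0\le i,j\le 2r-1}$ over $K$ modulo scalars, with the Zariski topology. Let $\Omega=\begin{pmatrix}0&I_r\\-I_r&0\end{pmatrix}$, let $Sp(2r)=\{M : M^t\Omega M=\Omega\}$ act on $\mathbb{P}^N$ by $(M,Z)\mapsto MZM^t$, and for $1\le k\le 2r$ let $O_k$ be the $Sp(2r)$-orbit of $I_k=\mathrm{diag}(1,\dots,1,0,\dots,0)$ ($k$ ones) and $Y_k=\overline{O_k}$; put $Y_0=\emptyset$. Let $X_{2r}$ be the closure of the $Sp(2r)$-orbit of the identity matrix. Let $\mathcal{V}_2^{2r-1}=\{[xx^t] : x\in K^{2r}\setminus\{0\}\}\subset\mathbb{P}^N$ be the Veronese variety, and let $\mathrm{sec}_h(\mathcal{V}_2^{2r-1})$ be the closure of the union of the $(h-1)$-planes spanned by $h$ linearly independent points of $\mathcal{V}_2^{2r-1}$. Let $N_{i,j}$ be the entries of $Z^t\Omega Z$. Then: (1)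 The polynomials $N_{l,r+l}-N_{l+1,r+l+1}$ for $0\le l\le r-2$, together with $N_{i,j}$ for $0\le i<j\le 2r-1$, $j\ne r+i$, are $(2r+1)(r-1)$ distinct nonzero quadratic forms in the coordinates of $\mathbb{P}^N$, and $X_{2r}$ is the set of their common zeros. (2) For $i=1,\dots,r$ we have $Y_i=\mathrm{sec}_i(\mathcal{V}_2^{2r-1})\cap X_{2r}$ as sets. (3) There is a stratification $$Y_1\subset Y_2\subset\dots\subset Y_{r-1}\subset Y_r\subset Y_{2r}=X_{2r},$$ in which all the inclusions are strict, $Y_i\setminus Y_{i-1}=O_i$ for $i=1,\dots,r$, and $X_{2r}\setminus Y_r=O_{2r}$. (4) For $i=1,\dots,r$ we have $\dim\big(\mathrm{sec}_i(\mathcal{V}_2^{2r-1})\cap X_{2r}\big)=2ri+i-i^2-1$. (5) $Y_r$ is a divisor in $X_{2r}$: both are irreducible and closed, and $Y_r$ has codimension one in $X_{2r}$. -/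

import Mathlib

open scoped LinearAlgebra.Projectivization Matrix

noncomputable section

namespace SympQuad

/-! ### The projective space of symmetric matrices and its Zariski topology -/

section Ambient

/-- The vector space of symmetric matrices with entries in `K`. -/
def symMat (n K : Type*) [Field K] : Submodule K (Matrix n n K) where
  carrier := {Z | Zᵀ = Z}
  add_mem' := by
    intro a b ha hb
    simp only [Set.mem_ofPred_eq, Matrix.transpose_add] at *
    rw [ha, hb]
  zero_mem' := by simp
  smul_mem' := by
    intro c a ha
    simp only [Set.mem_ofPred_eq, Matrix.transpose_smul] at *
    rw [ha]

variable {n K : Type*} [Field K]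

theorem mem_symMat {Z : Matrix n n K} : Z ∈ symMat n K ↔ Zᵀ = Z := Iff.rfl

/-- The projective space `ℙ^N` of nonzero symmetric matrices modulo scalars. -/
abbrev PSym (n K : Type*) [Field K] : Type _ := ℙ K (symMat n K)

/-- The coordinates of a symmetric matrix: the coordinate `z_{i,j} = z_{j,i}`, labelled by the
unordered pair `{i, j}`, is the `(i, j)` entry. -/
def coord (Z : symMat n K) : Sym2 n → K :=
  Sym2.lift ⟨fun i j => (Z : Matrix n n K) i j,
    fun i j => congrFun (congrFun (mem_symMat.1 Z.2) j) i⟩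

/-- The common zeros in `ℙ^N` of a set of (homogeneous) polynomials in the coordinates
`z_{i,j}`. For homogeneous polynomials the choice of the representative is irrelevant. -/
def zeroLocus (S : Set (MvPolynomial (Sym2 n) K)) : Set (PSym n K) :=
  {p | ∀ f ∈ S, MvPolynomial.eval (coord p.rep) f = 0}

/-- The Zariski topology on `ℙ^N`: the closed sets are the zero loci of sets of homogeneous
polynomials. -/
instance zariskiTopology : TopologicalSpace (PSym n K) :=
  TopologicalSpace.ofClosed
    {C | ∃ S : Set (MvPolynomial (Sym2 n) K),
      (∀ f ∈ S, ∃ d : ℕ, f.IsHomogeneous d) ∧ C = zeroLocus S}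
    ⟨{1}, by
      intro f hf
      rw [Set.mem_singleton_iff.1 hf]
      exact ⟨0, MvPolynomial.isHomogeneous_one _ _⟩, by
      ext p
      simp [zeroLocus]⟩
    (by
      intro A hA
      refine ⟨{f | (∃ d : ℕ, f.IsHomogeneous d) ∧ ∃ C ∈ A, ∀ p ∈ C,
        MvPolynomial.eval (coord p.rep) f = 0}, fun f hf => hf.1, ?_⟩
      ext p
      constructor
      · rintro hp f ⟨-, C, hC, h⟩
        exact h p (Set.mem_sInter.1 hp C hC)
      · intro hp
        refine Set.mem_sInter.2 fun C hC => ?_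
        obtain ⟨S, hS, rfl⟩ := hA hC
        intro f hf
        exact hp f ⟨hS f hf, _, hC, fun q hq => hq f hf⟩)
    (by
      rintro C ⟨S, hS, rfl⟩ D ⟨T, hT, rfl⟩
      refine ⟨{f | ∃ g ∈ S, ∃ h ∈ T, f = g * h}, ?_, ?_⟩
      · rintro f ⟨g, hg, h, hh, rfl⟩
        obtain ⟨d, hd⟩ := hS g hg
        obtain ⟨e, he⟩ := hT h hh
        exact ⟨d + e, hd.mul he⟩
      · ext p
        constructor
        · rintro (hp | hp) f ⟨g, hg, h, hh, rfl⟩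
          · rw [map_mul, hp g hg, zero_mul]
          · rw [map_mul, hp h hh, mul_zero]
        · intro hp
          by_contra hcon
          rw [Set.mem_union, not_or] at hcon
          obtain ⟨h1, h2⟩ := hcon
          simp only [zeroLocus, Set.mem_ofPred_eq, not_forall] at h1 h2
          obtain ⟨g, hg, hg0⟩ := h1
          obtain ⟨h, hh, hh0⟩ := h2
          have := hp (g * h) ⟨g, hg, h, hh, rfl⟩
          rw [map_mul] at this
          exact (mul_ne_zero hg0 hh0) this)

theorem isClosed_iff {C : Set (PSym n K)} :
    IsClosed C ↔ ∃ S : Set (MvPolynomial (Sym2 n) K),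
      (∀ f ∈ S, ∃ d : ℕ, f.IsHomogeneous d) ∧ C = zeroLocus S := by
  rw [← isOpen_compl_iff]
  change Cᶜᶜ ∈ _ ↔ _
  rw [compl_compl]
  rfl

/-! ### The Veronese variety and its secant varieties -/

/-- The degree two Veronese embedding `[x] ↦ [x xᵗ]`, that is `z_{i,j} = x_i x_j`. -/
def veronese : ℙ K (n → K) → PSym n K :=
  Projectivization.lift
    (fun x => Projectivization.mk K
      (⟨Matrix.vecMulVec x.1 x.1, mem_symMat.2 (Matrix.transpose_vecMulVec x.1 x.1)⟩ : symMat n K)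
      (by
        intro h
        apply x.2
        funext i
        have h1 := congrFun (congrFun (congrArg Subtype.val h) i) i
        simpa [Matrix.vecMulVec_apply] using h1))
    (by
      rintro ⟨v, hv⟩ ⟨w, hw⟩ t h
      rw [Projectivization.mk_eq_mk_iff']
      refine ⟨t * t, Subtype.ext ?_⟩
      ext i j
      have h' : v = t • w := h
      simp only [h', Submodule.coe_smul, Matrix.smul_apply, Matrix.vecMulVec_apply, Pi.smul_apply,
        smul_eq_mul]
      ring)

/-- The Veronese variety of degree two. -/
def veroneseVariety (n K : Type*) [Field K] : Set (PSym n K) :=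
  Set.range (veronese (n := n) (K := K))

/-- The `h`-secant variety of `X`: the closure of the union of the `(h - 1)`-planes spanned by
`h` linearly independent points of `X`. -/
def secantVariety (h : ℕ) (X : Set (PSym n K)) : Set (PSym n K) :=
  closure {p | ∃ x : Fin h → PSym n K, (∀ i, x i ∈ X) ∧ Projectivization.Independent x ∧
    p.submodule ≤ ⨆ i, (x i).submodule}

end Ambient

/-- In a topological space, `D` is a prime divisor of the irreducible closed set `X`: it is an
irreducible closed subset of codimension one. -/
def IsPrimeDivisor {T : Type*} [TopologicalSpace T] (D X : Set T) : Prop :=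
  IsClosed X ∧ IsIrreducible X ∧ IsClosed D ∧ IsIrreducible D ∧ D ⊂ X ∧
    ∀ W : Set T, IsClosed W → IsIrreducible W → D ⊆ W → W ⊆ X → W = D ∨ W = X

/-! ### The symplectic group and its action -/

section Symplectic

variable (r : ℕ) (K : Type*) [Field K]

/-- The standard symplectic form `(0, I; -I, 0)`. Rows and columns are indexed by
`Fin r ⊕ Fin r`. -/
def Omega (R : Type*) [CommRing R] : Matrix (Fin r ⊕ Fin r) (Fin r ⊕ Fin r) R :=
  Matrix.fromBlocks 0 1 (-1) 0

/-- The position in `0, …, 2r - 1` of an index in `Fin r ⊕ Fin r`. -/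
def pos {r : ℕ} : Fin r ⊕ Fin r → ℕ := Sum.elim (fun i => (i : ℕ)) (fun i => r + (i : ℕ))

/-- The symplectic group of Mathlib is the group of matrices with `Mᵗ Ω M = Ω`. -/
theorem mem_symplecticGroup_iff {r : ℕ} {K : Type*} [Field K]
    {M : Matrix (Fin r ⊕ Fin r) (Fin r ⊕ Fin r) K} :
    M ∈ Matrix.symplecticGroup (Fin r) K ↔ Mᵀ * Omega r K * M = Omega r K := by
  have hJ : Omega r K = -Matrix.J (Fin r) K := by
    simp [Omega, Matrix.J, Matrix.fromBlocks_neg]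
  rw [SymplecticGroup.mem_iff', hJ]
  simp

/-- The symplectic group acts on symmetric matrices by `(M, Z) ↦ M Z Mᵗ`. -/
instance sympAction {r : ℕ} {K : Type*} [Field K] :
    DistribMulAction (Matrix.symplecticGroup (Fin r) K) (symMat (Fin r ⊕ Fin r) K) where
  smul M Z := ⟨M.1 * Z.1 * M.1ᵀ, mem_symMat.2 (by
    rw [Matrix.transpose_mul, Matrix.transpose_mul, Matrix.transpose_transpose,
      mem_symMat.1 Z.2, Matrix.mul_assoc])⟩
  one_smul Z := Subtype.ext (by
    change (1 : Matrix (Fin r ⊕ Fin r) (Fin r ⊕ Fin r) K) * Z.1 * (1 : Matrix _ _ K)ᵀ = Z.1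
    simp)
  mul_smul M N Z := Subtype.ext (by
    change (M.1 * N.1) * Z.1 * (M.1 * N.1)ᵀ = M.1 * (N.1 * Z.1 * N.1ᵀ) * M.1ᵀ
    simp only [Matrix.transpose_mul, Matrix.mul_assoc])
  smul_zero M := Subtype.ext (by
    change M.1 * (0 : Matrix (Fin r ⊕ Fin r) (Fin r ⊕ Fin r) K) * M.1ᵀ = 0
    simp)
  smul_add M Y Z := Subtype.ext (by
    change M.1 * (Y.1 + Z.1) * M.1ᵀ = M.1 * Y.1 * M.1ᵀ + M.1 * Z.1 * M.1ᵀ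
    rw [Matrix.mul_add, Matrix.add_mul])

theorem coe_smul {r : ℕ} {K : Type*} [Field K] (M : Matrix.symplecticGroup (Fin r) K)
    (Z : symMat (Fin r ⊕ Fin r) K) :
    ((M • Z : symMat (Fin r ⊕ Fin r) K) : Matrix (Fin r ⊕ Fin r) (Fin r ⊕ Fin r) K)
      = M.1 * Z.1 * M.1ᵀ := rfl

instance sympAction_smulComm {r : ℕ} {K : Type*} [Field K] :
    SMulCommClass (Matrix.symplecticGroup (Fin r) K) K (symMat (Fin r ⊕ Fin r) K) where
  smul_comm M c Z := Subtype.ext (by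
    change M.1 * (c • Z.1) * M.1ᵀ = c • (M.1 * Z.1 * M.1ᵀ)
    rw [Matrix.mul_smul, Matrix.smul_mul])

/-- The matrix `I_k`, diagonal with `k` ones followed by zeros. In particular `I_{2r}` is the
identity. -/
def stdMat (k : ℕ) : symMat (Fin r ⊕ Fin r) K :=
  ⟨Matrix.diagonal (fun a => if pos a < k then 1 else 0),
    mem_symMat.2 (Matrix.diagonal_transpose _)⟩

theorem stdMat_two_mul : (stdMat r K (2 * r)).1 = 1 := by
  rw [← Matrix.diagonal_one]
  refine congrArg Matrix.diagonal (funext fun a => if_pos ?_)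
  rcases a with i | i <;> simp only [pos, Sum.elim_inl, Sum.elim_inr] <;> have := i.2 <;> omega

/-- The orbit `O_k` in `ℙ^N` of the point `[I_k]` under the symplectic group (empty if the matrix
`I_k` is zero, that is if `k = 0` or `r = 0`). -/
def O (k : ℕ) : Set (PSym (Fin r ⊕ Fin r) K) :=
  {p | ∃ h : stdMat r K k ≠ 0, p ∈ MulAction.orbit (Matrix.symplecticGroup (Fin r) K)
    (Projectivization.mk K (stdMat r K k) h)}

/-- `Y_k` is the closure of the orbit `O_k`. -/
def Y (k : ℕ) : Set (PSym (Fin r ⊕ Fin r) K) := closure (O r K k)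

/-- The identity matrix as a symmetric matrix. -/
def idMat : symMat (Fin r ⊕ Fin r) K := ⟨1, mem_symMat.2 Matrix.transpose_one⟩

/-- `X_{2r}` is the closure of the orbit of the identity. -/
def X : Set (PSym (Fin r ⊕ Fin r) K) :=
  closure {p | ∃ h : idMat r K ≠ 0, p ∈ MulAction.orbit (Matrix.symplecticGroup (Fin r) K)
    (Projectivization.mk K (idMat r K) h)}

/-! ### The quadrics -/

/-- The generic symmetric matrix `Z = (z_{i,j})`. -/
def genMat : Matrix (Fin r ⊕ Fin r) (Fin r ⊕ Fin r) (MvPolynomial (Sym2 (Fin r ⊕ Fin r)) K) :=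
  Matrix.of fun a b => MvPolynomial.X s(a, b)

/-- The matrix of quadratic forms `N = Zᵗ Ω Z`. -/
def N : Matrix (Fin r ⊕ Fin r) (Fin r ⊕ Fin r) (MvPolynomial (Sym2 (Fin r ⊕ Fin r)) K) :=
  (genMat r K)ᵀ * Omega r (MvPolynomial (Sym2 (Fin r ⊕ Fin r)) K) * genMat r K

/-- The quadrics `N_{l,r+l} - N_{l+1,r+l+1}` for `0 ≤ l ≤ r - 2` and `N_{i,j}` for `j > i`,
`j ≠ r + i`. -/
def quadrics : Set (MvPolynomial (Sym2 (Fin r ⊕ Fin r)) K) :=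
  {f | ∃ l l' : Fin r, (l' : ℕ) = l + 1 ∧
      f = N r K (Sum.inl l) (Sum.inr l) - N r K (Sum.inl l') (Sum.inr l')} ∪
  {f | ∃ a b : Fin r ⊕ Fin r, pos a < pos b ∧ pos b ≠ r + pos a ∧ f = N r K a b}

end Symplectic

end SympQuad

end

/-!
The proof replaces each closure by equations for the matrix `Z` of a point.

A symmetric matrix of rank `k` is `B Bᵗ` with independent columns, because `K` is algebraically
closed. If `Z Ω Z = 0`, the columns of `B` span an isotropic subspace and form part of a symplectic
basis, so `Z` is equivalent to `I_k` (`exists_symplectic_eq_stdMat`). If `Z Ω Z = c Ω` with `c ≠ 0`,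
an eigenspace of `Z Ω` is Lagrangian, and in a symplectic basis adapted to it `Z` becomes a fixed
matrix, up to a scalar (`exists_symplectic_eq_smul_one`). Hence, for `1 ≤ k ≤ r`, `O_k` is the set
of `Z` with `Z Ω Z = 0` and rank `k`, and `O_{2r}` is the set of `Z` with `Z Ω Z` a nonzero multiple
of `Ω`. Explicit curves show that `Y_k` is given by `Z Ω Z = 0` and rank at most `k`
(`mk_mem_Y_iff`), and that `X_{2r}` is given by `Z Ω Z ∈ K Ω`, that is, by the quadrics
(`zeroLocus_quadrics_eq_X`). Because the matrices of `sec_k` have rank at most `k`, while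
`Z Ω Z = c Ω ≠ 0` forces `Z` to be invertible, the statements on secant varieties and on the
stratification follow.

For the dimensions, `Sp(2r)` is parametrized by shears and invertible matrices, so that orbits are
irreducible (`isIrreducible_orbit`) and it is enough to study one chart of each. The chart
`Z = B S Bᵗ` of `O_k`, where `B` is a reduced isotropic frame, has `2rk + k - k²` affine parameters,
and the transcendence degree bounds the dimension from above (`height_add_one_le`). Setting the
parameters to zero one after the other gives a chain of irreducible closed subsets of `Y_k` that
bounds it from below (`card_le_height`). A chart of `O_{2r}` with `r² + r + 1` affine parameters
bounds the dimension of `X_{2r}` by `dim Y_r + 1`, which leaves no room for an irreducible closed set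
strictly between `Y_r` and `X_{2r}`.

The quadrics are distinct and nonzero because every elementary skew matrix is proportional to some
`Z Ω Z` with `Z` symmetric (`exists_mul_omega_mul_eq_single`).
-/

noncomputable section

namespace SympQuad

open MvPolynomial TopologicalSpace

/-! ### Closures and vanishing ideals in the Zariski topology -/

section Zariski

variable {n K : Type*} [Field K]

theorem coord_mk (Z : symMat n K) (a b : n) : coord Z s(a, b) = (Z : Matrix n n K) a b := rfl

theorem coord_smul (c : K) (v : symMat n K) : coord (c • v) = c • coord v := by
  funext s
  induction s with
  | _ a b => simp [coord_mk]

theorem coord_injective : Function.Injective (coord : symMat n K → Sym2 n → K) := by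
  intro v w h
  refine Subtype.ext (Matrix.ext fun a b => ?_)
  simpa [coord_mk] using congrFun h s(a, b)

theorem eval_smul_of_isHomogeneous {σ : Type*} {f : MvPolynomial σ K} {d : ℕ}
    (hf : f.IsHomogeneous d) (c : K) (x : σ → K) : eval (c • x) f = c ^ d * eval x f := by
  rw [eval_eq, eval_eq, Finset.mul_sum]
  refine Finset.sum_congr rfl fun m hm => ?_
  have h1 : m.degree = d := by
    rw [← hf (mem_support_iff.1 hm), Finsupp.degree_eq_weight_one]
    rfl
  simp only [Pi.smul_apply, smul_eq_mul, mul_pow, Finset.prod_mul_distrib, Finset.prod_pow_eq_pow_sum]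
  rw [← h1, Finsupp.degree_apply]
  ring

theorem eval_aeval {σ τ : Type*} (g : σ → MvPolynomial τ K) (f : MvPolynomial σ K) (t : τ → K) :
    eval t (aeval g f) = eval (fun s => eval t (g s)) f := by
  induction f using MvPolynomial.induction_on with
  | C a => simp
  | add p q hp hq => simp only [map_add, hp, hq]
  | mul_X p i hp => simp only [map_mul, hp, aeval_X, eval_X]

theorem polynomial_eval_aeval {σ : Type*} (g : σ → Polynomial K) (f : MvPolynomial σ K) (t : K) :
    (aeval g f).eval t = eval (fun s => (g s).eval t) f := by
  induction f using MvPolynomial.induction_on with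
  | C a => simp
  | add p q hp hq => simp only [map_add, hp, hq, Polynomial.eval_add]
  | mul_X p i hp => simp only [map_mul, hp, aeval_X, eval_X, Polynomial.eval_mul]

theorem mk_mem_zeroLocus {S : Set (MvPolynomial (Sym2 n) K)}
    (hS : ∀ f ∈ S, ∃ d : ℕ, f.IsHomogeneous d) (v : symMat n K) (hv : v ≠ 0) :
    Projectivization.mk K v hv ∈ zeroLocus S ↔ ∀ f ∈ S, eval (coord v) f = 0 := by
  obtain ⟨c, hc⟩ := Projectivization.exists_smul_eq_mk_rep K v hv
  refine forall₂_congr fun f hf => ?_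
  obtain ⟨d, hd⟩ := hS f hf
  rw [← hc, Units.smul_def, coord_smul, eval_smul_of_isHomogeneous hd]
  simp

/-- The ideal of all polynomials that vanish on the punctured cone over a subset `W` of `ℙ^N`. No
homogeneity is required: over an infinite field it follows for the components. -/
def vanishingIdeal (W : Set (PSym n K)) : Ideal (MvPolynomial (Sym2 n) K) where
  carrier := {f | ∀ (v : symMat n K) (hv : v ≠ 0), Projectivization.mk K v hv ∈ W →
    eval (coord v) f = 0}
  add_mem' := by
    intro f g hf hg v hv h
    rw [map_add, hf v hv h, hg v hv h, add_zero]
  zero_mem' := by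
    intro v hv h
    exact map_zero _
  smul_mem' := by
    intro c f hf v hv h
    rw [smul_eq_mul, map_mul, hf v hv h, mul_zero]

theorem mem_vanishingIdeal {W : Set (PSym n K)} {f : MvPolynomial (Sym2 n) K} :
    f ∈ vanishingIdeal W ↔ ∀ (v : symMat n K) (hv : v ≠ 0),
      Projectivization.mk K v hv ∈ W → eval (coord v) f = 0 := Iff.rfl

theorem vanishingIdeal_anti {W W' : Set (PSym n K)} (h : W ⊆ W') :
    vanishingIdeal W' ≤ vanishingIdeal W := fun _ hf v hv hm => hf v hv (h hm)

/-- The restriction of a polynomial to the line through `v`. -/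
def lineRestriction (v : symMat n K) (f : MvPolynomial (Sym2 n) K) : Polynomial K :=
  aeval (fun s => Polynomial.C (coord v s) * Polynomial.X) f

theorem eval_lineRestriction (v : symMat n K) (f : MvPolynomial (Sym2 n) K) (c : K) :
    (lineRestriction v f).eval c = eval (coord (c • v)) f := by
  rw [lineRestriction, polynomial_eval_aeval]
  congr 2
  funext s
  rw [Polynomial.eval_C_mul, Polynomial.eval_X, coord_smul]
  exact mul_comm _ _

theorem lineRestriction_eq_sum (v : symMat n K) (f : MvPolynomial (Sym2 n) K) [Infinite K] :
    lineRestriction v f = ∑ d ∈ Finset.range (f.totalDegree + 1),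
      Polynomial.C (eval (coord v) (homogeneousComponent d f)) * Polynomial.X ^ d := by
  refine Polynomial.funext fun c => ?_
  rw [eval_lineRestriction, Polynomial.eval_finsetSum]
  conv_lhs => rw [← sum_homogeneousComponent f, map_sum]
  refine Finset.sum_congr rfl fun d _ => ?_
  rw [coord_smul, eval_smul_of_isHomogeneous (homogeneousComponent_isHomogeneous d f)]
  rw [Polynomial.eval_C_mul, Polynomial.eval_pow, Polynomial.eval_X, mul_comm]

theorem coeff_lineRestriction [Infinite K] (v : symMat n K) (f : MvPolynomial (Sym2 n) K) (d : ℕ) :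
    (lineRestriction v f).coeff d = eval (coord v) (homogeneousComponent d f) := by
  rw [lineRestriction_eq_sum, Polynomial.finsetSum_coeff]
  simp only [Polynomial.coeff_C_mul_X_pow]
  rw [Finset.sum_ite_eq]
  split_ifs with h
  · rfl
  · rw [homogeneousComponent_eq_zero _ _ (by simpa using h), map_zero]

/-- A polynomial vanishing at all nonzero multiples of `v` has homogeneous components that vanish
at `v`. -/
theorem eval_homogeneousComponent_eq_zero [Infinite K] {v : symMat n K}
    {f : MvPolynomial (Sym2 n) K} (h : ∀ c : K, c ≠ 0 → eval (coord (c • v)) f = 0) (d : ℕ) :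
    eval (coord v) (homogeneousComponent d f) = 0 := by
  rw [← coeff_lineRestriction]
  have h0 : lineRestriction v f * Polynomial.X = 0 := by
    refine Polynomial.funext fun c => ?_
    rw [Polynomial.eval_mul, Polynomial.eval_X, Polynomial.eval_zero]
    rcases eq_or_ne c 0 with rfl | hc
    · simp
    · rw [eval_lineRestriction, h c hc, zero_mul]
  rw [(mul_eq_zero.1 h0).resolve_right Polynomial.X_ne_zero, Polynomial.coeff_zero]

theorem mk_smul_eq {c : K} (hc : c ≠ 0) {v : symMat n K} (hv : v ≠ 0) :
    Projectivization.mk K (c • v) (smul_ne_zero hc hv) = Projectivization.mk K v hv :=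
  (Projectivization.mk_eq_mk_iff' K _ _ _ _).2 ⟨c, rfl⟩

/-- The homogeneous components of a polynomial cut out the lines on which it vanishes. -/
theorem isClosed_vanishing [Infinite K] (f : MvPolynomial (Sym2 n) K) :
    IsClosed {p : PSym n K | ∀ (v : symMat n K) (hv : v ≠ 0), Projectivization.mk K v hv = p →
      eval (coord v) f = 0} := by
  have hS : ∀ g ∈ Set.range (fun d => homogeneousComponent d f), ∃ d : ℕ, g.IsHomogeneous d := by
    rintro g ⟨d, rfl⟩
    exact ⟨d, homogeneousComponent_isHomogeneous d f⟩
  refine isClosed_iff.2 ⟨Set.range (fun d => homogeneousComponent d f), hS, ?_⟩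
  ext p
  induction p using Projectivization.ind with
  | h v hv =>
    rw [mk_mem_zeroLocus hS]
    constructor
    · rintro h g ⟨d, rfl⟩
      exact eval_homogeneousComponent_eq_zero
        (fun c hc => h _ (smul_ne_zero hc hv) (mk_smul_eq hc hv)) d
    · intro h w hw hwv
      obtain ⟨c, rfl⟩ := (Projectivization.mk_eq_mk_iff' K _ _ _ _).1 hwv
      rw [← sum_homogeneousComponent f, map_sum]
      refine Finset.sum_eq_zero fun d _ => ?_
      rw [coord_smul, eval_smul_of_isHomogeneous (homogeneousComponent_isHomogeneous d f)]
      rw [h _ ⟨d, rfl⟩, mul_zero]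

/-- The closure of a subset of `ℙ^N` is cut out by its vanishing ideal. -/
theorem mk_mem_closure_iff [Infinite K] {W : Set (PSym n K)} {v : symMat n K} {hv : v ≠ 0} :
    Projectivization.mk K v hv ∈ closure W ↔ ∀ f ∈ vanishingIdeal W, eval (coord v) f = 0 := by
  constructor
  · intro h f hf
    refine closure_minimal ?_ (isClosed_vanishing f) h v hv rfl
    intro p hp w hw hwp
    exact hf w hw (hwp ▸ hp)
  · intro h
    obtain ⟨S, hS, hC⟩ := isClosed_iff.1 (isClosed_closure (s := W))
    rw [hC, mk_mem_zeroLocus hS]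
    intro f hf
    refine h f fun w hw hm => ?_
    have h1 := subset_closure hm
    rw [hC, mk_mem_zeroLocus hS] at h1
    exact h1 f hf

theorem vanishingIdeal_closure [Infinite K] (W : Set (PSym n K)) :
    vanishingIdeal (closure W) = vanishingIdeal W :=
  le_antisymm (vanishingIdeal_anti subset_closure)
    fun _ hf _ _ hm => mk_mem_closure_iff.1 hm _ hf

theorem vanishingIdeal_lt_of_ssubset [Infinite K] {W W' : Set (PSym n K)} (hW : IsClosed W)
    (h : W ⊂ W') : vanishingIdeal W' < vanishingIdeal W := by
  refine lt_of_le_of_ne (vanishingIdeal_anti h.1) fun heq => h.2 fun p hp => ?_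
  induction p using Projectivization.ind with
  | h v hv =>
    rw [← hW.closure_eq, mk_mem_closure_iff, ← heq]
    exact fun f hf => hf v hv hp

/-- An open set is, near each of its points, the nonvanishing locus of a homogeneous form. -/
theorem exists_homogeneous_of_mem_isOpen {U : Set (PSym n K)} (hU : IsOpen U)
    {v : symMat n K} {hv : v ≠ 0} (h : Projectivization.mk K v hv ∈ U) :
    ∃ f : MvPolynomial (Sym2 n) K, eval (coord v) f ≠ 0 ∧
      ∀ (w : symMat n K) (hw : w ≠ 0), eval (coord w) f ≠ 0 → Projectivization.mk K w hw ∈ U := by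
  obtain ⟨S, hS, hC⟩ := isClosed_iff.1 hU.isClosed_compl
  have h1 : Projectivization.mk K v hv ∉ zeroLocus S := by
    rw [← hC]
    exact fun h' => h' h
  rw [mk_mem_zeroLocus hS] at h1
  push Not at h1
  obtain ⟨f, hf, hf0⟩ := h1
  refine ⟨f, hf0, fun w hw hw0 => ?_⟩
  by_contra hcon
  have h2 : Projectivization.mk K w hw ∈ zeroLocus S := by
    rw [← hC]
    exact hcon
  rw [mk_mem_zeroLocus hS] at h2
  exact hw0 (h2 f hf)

/-- Polynomials outside the ideal are nonzero on the line through some common point of `W`, and so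
is their product, because a line has infinitely many points. -/
theorem isPrime_vanishingIdeal [Infinite K] {W : Set (PSym n K)} (hW : IsIrreducible W) :
    (vanishingIdeal W).IsPrime := by
  refine Ideal.isPrime_iff.2 ⟨?_, ?_⟩
  · intro h
    obtain ⟨p, hp⟩ := hW.nonempty
    induction p using Projectivization.ind with
    | h v hv =>
      have := (Ideal.eq_top_iff_one _).1 h v hv hp
      simp at this
  · intro f g hfg
    by_contra! hcon
    obtain ⟨hf, hg⟩ := hcon
    have key : ∀ f : MvPolynomial (Sym2 n) K, f ∉ vanishingIdeal W → (W ∩ {p : PSym n K |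
        ∀ (v : symMat n K) (hv : v ≠ 0), Projectivization.mk K v hv = p →
          eval (coord v) f = 0}ᶜ).Nonempty := by
      intro f hf
      simp only [mem_vanishingIdeal, not_forall] at hf
      obtain ⟨v, hv, hm, h0⟩ := hf
      exact ⟨_, hm, fun h => h0 (h v hv rfl)⟩
    obtain ⟨p, hp, hpf, hpg⟩ := hW.2 _ _ (isClosed_vanishing f).isOpen_compl
      (isClosed_vanishing g).isOpen_compl (key f hf) (key g hg)
    induction p using Projectivization.ind with
    | h v hv =>
      have key2 : ∀ f : MvPolynomial (Sym2 n) K, Projectivization.mk K v hv ∈ {p : PSym n K |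
          ∀ (v : symMat n K) (hv : v ≠ 0), Projectivization.mk K v hv = p →
          eval (coord v) f = 0}ᶜ → lineRestriction v f ≠ 0 := by
        intro f hf h0
        refine hf fun w hw hwv => ?_
        obtain ⟨c, rfl⟩ := (Projectivization.mk_eq_mk_iff' K _ _ _ _).1 hwv
        rw [← eval_lineRestriction, h0, Polynomial.eval_zero]
      have hne := mul_ne_zero (mul_ne_zero (key2 f hpf) (key2 g hpg)) Polynomial.X_ne_zero
      refine hne (Polynomial.funext fun c => ?_)
      rcases eq_or_ne c 0 with rfl | hc
      · simp
      · have := hfg (c • v) (smul_ne_zero hc hv) (by rwa [mk_smul_eq hc hv])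
        rw [map_mul] at this
        rw [Polynomial.eval_mul, Polynomial.eval_mul, eval_lineRestriction, eval_lineRestriction,
          this, zero_mul, Polynomial.eval_zero]

/-- A subset of `ℙ^N` parametrized by a Zariski open subset of an affine space is irreducible. -/
theorem isIrreducible_of_parametrization [Infinite K] {σ : Type*} {W : Set (PSym n K)}
    (hne : W.Nonempty) (ψ : (σ → K) → symMat n K) (g : Sym2 n → MvPolynomial σ K)
    (hψ : ∀ t, coord (ψ t) = fun s => eval t (g s)) (h : MvPolynomial σ K) (hh : h ≠ 0)
    (hsurj : ∀ p ∈ W, ∃ (t : σ → K) (ht : ψ t ≠ 0), Projectivization.mk K (ψ t) ht = p)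
    (hmaps : ∀ t, eval t h ≠ 0 → ∃ ht : ψ t ≠ 0, Projectivization.mk K (ψ t) ht ∈ W) :
    IsIrreducible W := by
  refine ⟨hne, ?_⟩
  have key : ∀ U : Set (PSym n K), IsOpen U → (W ∩ U).Nonempty → ∃ f : MvPolynomial σ K, f ≠ 0 ∧
      ∀ t (ht : ψ t ≠ 0), eval t f ≠ 0 → Projectivization.mk K (ψ t) ht ∈ U := by
    rintro U hU ⟨p, hpW, hpU⟩
    obtain ⟨t, ht, rfl⟩ := hsurj p hpW
    obtain ⟨f, hf, hfU⟩ := exists_homogeneous_of_mem_isOpen hU hpU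
    have heq : ∀ t, eval t (aeval g f) = eval (coord (ψ t)) f := by
      intro t
      rw [hψ, eval_aeval]
    refine ⟨aeval g f, fun h0 => hf ?_, fun t ht h1 => hfU _ _ ?_⟩
    · rw [← heq, h0, map_zero]
    · rwa [← heq]
  intro U V hU hV hUn hVn
  obtain ⟨f, hf, hfU⟩ := key U hU hUn
  obtain ⟨f', hf', hfV⟩ := key V hV hVn
  have hprod := mul_ne_zero (mul_ne_zero hf hf') hh
  obtain ⟨t, ht⟩ : ∃ t, eval t (f * f' * h) ≠ 0 := by
    by_contra! hcon
    exact hprod (MvPolynomial.funext fun t => by rw [hcon, map_zero])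
  rw [map_mul, map_mul] at ht
  obtain ⟨h0, hm⟩ := hmaps t (right_ne_zero_of_mul ht)
  exact ⟨_, hm, hfU t h0 (left_ne_zero_of_mul (left_ne_zero_of_mul ht)),
    hfV t h0 (right_ne_zero_of_mul (left_ne_zero_of_mul ht))⟩

/-- A polynomial that vanishes along a curve away from one parameter vanishes at that parameter:
the limit of a polynomial curve in `W` lies in the closure of `W`. -/
theorem mk_mem_closure_of_curve [Infinite K] {W : Set (PSym n K)} (γ : K → symMat n K)
    (g : Sym2 n → Polynomial K) (hγ : ∀ t s, coord (γ t) s = (g s).eval t)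
    (hW : ∀ t, t ≠ 0 → ∃ ht : γ t ≠ 0, Projectivization.mk K (γ t) ht ∈ W) (h0 : γ 0 ≠ 0) :
    Projectivization.mk K (γ 0) h0 ∈ closure W := by
  rw [mk_mem_closure_iff]
  intro f hf
  have heq : ∀ t, (aeval g f).eval t = eval (coord (γ t)) f := by
    intro t
    have : coord (γ t) = fun s => (g s).eval t := funext (hγ t)
    rw [this, polynomial_eval_aeval]
  have h1 : aeval g f * Polynomial.X = 0 := by
    refine Polynomial.funext fun t => ?_
    rw [Polynomial.eval_mul, Polynomial.eval_X, Polynomial.eval_zero]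
    rcases eq_or_ne t 0 with rfl | ht
    · simp
    · obtain ⟨h2, h3⟩ := hW t ht
      rw [heq, hf _ h2 h3, zero_mul]
  rw [← heq, (mul_eq_zero.1 h1).resolve_right Polynomial.X_ne_zero, Polynomial.eval_zero]

end Zariski

/-! ### Dimension bounds for parametrized subvarieties -/

section Dimension

/-- The dimension of an irreducible closed subset is its height among all of them. -/
theorem topologicalKrullDim_coe {T : Type*} [TopologicalSpace T] (Y : IrreducibleCloseds T) :
    topologicalKrullDim ↥(Y : Set T) = Order.height Y := by
  rw [Order.height_eq_krullDim_Iic]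
  have hind : Topology.IsInducing (Subtype.val : ↥(Y : Set T) → T) := .subtypeVal
  refine le_antisymm ?_ ?_
  · refine Order.krullDim_le_of_strictMono
      (fun W => ⟨IrreducibleCloseds.map _ hind.continuous W, ?_⟩) ?_
    · change closure (Subtype.val '' (W : Set ↥(Y : Set T))) ⊆ (Y : Set T)
      refine closure_minimal ?_ Y.isClosed
      rintro _ ⟨x, -, rfl⟩
      exact x.2
    · intro W W' h
      exact IrreducibleCloseds.map_strictMono_of_isInducing hind h
  · refine Order.krullDim_le_of_strictMono (fun W => ⟨Subtype.val ⁻¹' (W.1 : Set T), ⟨?_, ?_⟩,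
      W.1.isClosed.preimage hind.continuous⟩) ?_
    · obtain ⟨x, hx⟩ := W.1.isIrreducible.nonempty
      exact ⟨⟨x, W.2 hx⟩, hx⟩
    · rintro _ _ ⟨U, hU, rfl⟩ ⟨V, hV, rfl⟩ ⟨x, hx, hxU⟩ ⟨y, hy, hyV⟩
      obtain ⟨z, hz, hzU, hzV⟩ := W.1.isIrreducible.2 U V hU hV ⟨x, hx, hxU⟩ ⟨y, hy, hyV⟩
      exact ⟨⟨z, W.2 hz⟩, hz, hzU, hzV⟩
    · intro W W' h
      obtain ⟨h1, x, hx, hx'⟩ := SetLike.lt_iff_le_and_exists.1 (Subtype.coe_lt_coe.2 h)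
      refine SetLike.lt_iff_le_and_exists.2 ⟨fun z hz => h1 hz, ⟨⟨x, W'.2 hx⟩, hx, hx'⟩⟩

variable {n K : Type*} [Field K]

/-- The affine dimension of the closure of the image of a polynomial map is at most the number of
its parameters. -/
theorem ringKrullDim_quotient_ker_le {σ τ : Type*} [Finite σ] [Finite τ]
    (φ : MvPolynomial τ K →ₐ[K] MvPolynomial σ K) :
    ringKrullDim (MvPolynomial τ K ⧸ RingHom.ker φ) ≤ (Nat.card σ : ℕ∞) := by
  have : Nontrivial (MvPolynomial τ K ⧸ RingHom.ker φ) :=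
    Ideal.Quotient.nontrivial_iff.2 (RingHom.ker_ne_top φ)
  obtain ⟨s, g, hg, hfin⟩ := exists_finite_inj_algHom_of_fg K (MvPolynomial τ K ⧸ RingHom.ker φ)
  have hs : s ≤ Nat.card σ := by
    have h1 := lift_trdeg_le_of_injective ((Ideal.kerLiftAlg φ).comp g)
      ((Ideal.kerLiftAlg_injective φ).comp hg)
    rw [MvPolynomial.trdeg_of_isDomain, MvPolynomial.trdeg_of_isDomain] at h1
    have := Fintype.ofFinite σ
    simpa using h1
  let _ : Algebra (MvPolynomial (Fin s) K) (MvPolynomial τ K ⧸ RingHom.ker φ) :=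
    g.toRingHom.toAlgebra
  have : Algebra.IsIntegral (MvPolynomial (Fin s) K) (MvPolynomial τ K ⧸ RingHom.ker φ) :=
    ⟨hfin.to_isIntegral⟩
  calc ringKrullDim (MvPolynomial τ K ⧸ RingHom.ker φ)
      ≤ ringKrullDim (MvPolynomial (Fin s) K) :=
        Order.krullDim_le_of_strictMono
          (PrimeSpectrum.comap (algebraMap (MvPolynomial (Fin s) K) _)) fun I J h =>
            Ideal.IsIntegral.comap_lt_comap (I := I.asIdeal) (J := J.asIdeal) h
    _ ≤ (Nat.card σ : ℕ∞) := by
        rw [MvPolynomial.ringKrullDim_of_isNoetherianRing, ringKrullDim_eq_zero_of_field, zero_add,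
          Nat.card_fin]
        exact_mod_cast hs

/-- If the polynomials vanishing along a parametrized cone vanish on the cone over `Y`, then the
projective dimension of `Y` is less than the number of parameters. A chain of irreducible closed
subsets of `Y` gives a chain of primes in the coordinate ring of the cone, which the irrelevant
ideal prolongs by one step. -/
theorem height_add_one_le [Infinite K] [Finite n] {σ : Type*} [Finite σ]
    (g : Sym2 n → MvPolynomial σ K) (Y : IrreducibleCloseds (PSym n K))
    (hg : ∀ f, aeval g f = 0 → f ∈ vanishingIdeal (Y : Set (PSym n K))) :
    Order.height Y + 1 ≤ (Nat.card σ : ℕ∞) := by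
  have hfin : Finite (Sym2 n) := Quot.finite _
  set J := RingHom.ker (aeval g : MvPolynomial (Sym2 n) K →ₐ[K] MvPolynomial σ K) with hJ
  -- the primes above `J`
  have hJm : ∀ W : Set.Iic Y, J ≤ vanishingIdeal (W.1 : Set (PSym n K)) := fun W f hf =>
    vanishingIdeal_anti (W' := (Y : Set (PSym n K))) W.2 (hg f hf)
  let m : Ideal (MvPolynomial (Sym2 n) K) := RingHom.ker (eval (0 : Sym2 n → K))
  have hm : ∀ W : Set.Iic Y, vanishingIdeal (W.1 : Set (PSym n K)) < m := by
    intro W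
    obtain ⟨p, hp⟩ := W.1.isIrreducible.nonempty
    induction p using Projectivization.ind with
    | h v hv =>
      refine lt_of_le_of_ne ?_ ?_
      · intro f hf
        have h1 : lineRestriction v f * Polynomial.X = 0 := by
          refine Polynomial.funext fun c => ?_
          rw [Polynomial.eval_mul, Polynomial.eval_X, Polynomial.eval_zero]
          rcases eq_or_ne c 0 with rfl | hc
          · simp
          · rw [eval_lineRestriction, hf _ (smul_ne_zero hc hv) (by rwa [mk_smul_eq hc hv]),
              zero_mul]
        have h2 := eval_lineRestriction v f 0
        rw [(mul_eq_zero.1 h1).resolve_right Polynomial.X_ne_zero, zero_smul] at h2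
        have h3 : coord (0 : symMat n K) = 0 := by
          rw [← zero_smul K (0 : symMat n K), coord_smul, zero_smul]
        rw [h3, Polynomial.eval_zero] at h2
        exact h2.symm
      · intro heq
        refine hv (coord_injective (funext fun s => ?_))
        have h1 : (MvPolynomial.X s : MvPolynomial (Sym2 n) K) ∈ m := by
          rw [RingHom.mem_ker, eval_X, Pi.zero_apply]
        rw [← heq] at h1
        have h2 := h1 v hv hp
        rw [eval_X] at h2
        rw [h2, ← zero_smul K (0 : symMat n K), coord_smul, zero_smul, Pi.zero_apply]
  have hmp : m.IsPrime := RingHom.ker_isPrime _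
  have hprime : ∀ W : Set.Iic Y, (vanishingIdeal (W.1 : Set (PSym n K))).IsPrime := fun W =>
    isPrime_vanishingIdeal W.1.isIrreducible
  let P : WithBot (Set.Iic Y) → Ideal (MvPolynomial (Sym2 n) K) := fun W =>
    WithBot.recBotCoe m (fun W => vanishingIdeal (W.1 : Set (PSym n K))) W
  have hPp : ∀ W, (P W).IsPrime := by
    intro W
    induction W using WithBot.recBotCoe with
    | bot => exact hmp
    | coe W => exact hprime W
  have hPJ : ∀ W, J ≤ P W := by
    intro W
    induction W using WithBot.recBotCoe with
    | bot => exact (hJm ⟨Y, Set.mem_Iic.2 le_rfl⟩).trans (hm _).le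
    | coe W => exact hJm W
  have hPlt : ∀ W W', W < W' → P W' < P W := by
    intro W W' h
    induction W' using WithBot.recBotCoe with
    | bot => exact absurd h not_lt_bot
    | coe W' =>
      induction W using WithBot.recBotCoe with
      | bot => exact hm W'
      | coe W =>
        exact vanishingIdeal_lt_of_ssubset W.1.isClosed
          (SetLike.coe_ssubset_coe.2 (Subtype.coe_lt_coe.2 (WithBot.coe_lt_coe.1 h)))
  have hker : ∀ W, RingHom.ker (Ideal.Quotient.mk J) ≤ P W := fun W => by
    rw [Ideal.mk_ker]
    exact hPJ W
  let F : WithBot (Set.Iic Y) → (PrimeSpectrum (MvPolynomial (Sym2 n) K ⧸ J))ᵒᵈ := fun W =>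
    OrderDual.toDual ⟨(P W).map (Ideal.Quotient.mk J),
      have := hPp W
      Ideal.map_isPrime_of_surjective Ideal.Quotient.mk_surjective (hker W)⟩
  have hF : StrictMono F := by
    intro W W' h
    change (P W').map (Ideal.Quotient.mk J) < (P W).map (Ideal.Quotient.mk J)
    refine lt_of_le_of_ne (Ideal.map_mono (hPlt _ _ h).le) fun heq => (hPlt _ _ h).ne ?_
    have h1 := congrArg (Ideal.comap (Ideal.Quotient.mk J)) heq
    rwa [Ideal.comap_map_of_surjective _ Ideal.Quotient.mk_surjective,
      Ideal.comap_map_of_surjective _ Ideal.Quotient.mk_surjective,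
      ← RingHom.ker_eq_comap_bot, sup_eq_left.2 (hker _), sup_eq_left.2 (hker _)] at h1
  have h1 := Order.krullDim_le_of_strictMono F hF
  have : Nonempty (Set.Iic Y) := ⟨⟨Y, Set.mem_Iic.2 le_rfl⟩⟩
  rw [Order.krullDim_withBot, Order.krullDim_orderDual, ← Order.height_eq_krullDim_Iic] at h1
  have h2 := h1.trans (ringKrullDim_quotient_ker_le (aeval g))
  exact_mod_cast h2

/-- A finite type with a level function can be enumerated by nondecreasing level. -/
theorem exists_equiv_monotone {σ : Type*} [Finite σ] (lev : σ → ℕ) :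
    ∃ e : Fin (Nat.card σ) ≃ σ, Monotone (lev ∘ e) := by
  let e₀ : Fin (Nat.card σ) ≃ σ := (Finite.equivFin σ).symm
  exact ⟨(Tuple.sort (lev ∘ e₀)).trans e₀, Tuple.monotone_sort (lev ∘ e₀)⟩

/-- A lower bound for the projective dimension of `Y`. If `Y` contains the image of a polynomial
map `ψ` on an affine space, and the parameters `t j` can be enumerated so that for each `j` some
form `L j` vanishes along `ψ` when `t j` and all later parameters are zero, but not when `t j` alone
is set to one, then the images of the coordinate subspaces have closures that form a chain. -/
theorem card_le_height [Infinite K] {σ : Type*} [Finite σ] (Y : IrreducibleCloseds (PSym n K))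
    (ψ : (σ → K) → symMat n K) (g : Sym2 n → MvPolynomial σ K)
    (hψ : ∀ t, coord (ψ t) = fun s => eval t (g s)) (hne : ∀ t, ψ t ≠ 0)
    (hY : ∀ t, Projectivization.mk K (ψ t) (hne t) ∈ Y) (lev : σ → ℕ)
    (L : σ → MvPolynomial (Sym2 n) K) (hhom : ∀ j, (L j).IsHomogeneous 1)
    (h0 : ∀ j t, t j = 0 → (∀ k, lev j < lev k → t k = 0) → eval (coord (ψ t)) (L j) = 0)
    (h1 : ∀ j, ∃ t, (∀ k, k ≠ j → t k = 0) ∧ eval (coord (ψ t)) (L j) ≠ 0) :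
    (Nat.card σ : ℕ∞) ≤ Order.height Y := by
  classical
  obtain ⟨e, he⟩ := exists_equiv_monotone lev
  -- the image of the subspace of the first `k` coordinates
  let V : ℕ → Set (PSym n K) := fun k => {p | ∃ t : σ → K, (∀ j, k ≤ (e.symm j : ℕ) → t j = 0) ∧
    Projectivization.mk K (ψ t) (hne t) = p}
  have hV : ∀ k, IsIrreducible (V k) := by
    intro k
    let π : (σ → K) → σ → K := fun t j => if k ≤ (e.symm j : ℕ) then 0 else t j
    have hπ : ∀ t : σ → K, (∀ j, k ≤ (e.symm j : ℕ) → t j = 0) → π t = t := by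
      intro t ht
      funext j
      by_cases hj : k ≤ (e.symm j : ℕ)
      · simp [π, hj, ht j hj]
      · simp [π, hj]
    refine isIrreducible_of_parametrization ⟨_, 0, fun _ _ => rfl, rfl⟩ (fun t => ψ (π t))
      (fun s => aeval (fun j => if k ≤ (e.symm j : ℕ) then 0 else MvPolynomial.X j) (g s)) ?_
      1 one_ne_zero ?_ ?_
    · intro t
      rw [hψ]
      funext s
      rw [eval_aeval]
      congr 2
      funext j
      by_cases hj : k ≤ (e.symm j : ℕ)
      · simp [π, hj]
      · simp [π, hj]
    · rintro p ⟨t, ht, rfl⟩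
      refine ⟨t, hne _, ?_⟩
      simp only [hπ t ht]
    · intro t _
      refine ⟨hne _, π t, fun j hj => ?_, rfl⟩
      simp [π, hj]
  let W : ℕ → IrreducibleCloseds (PSym n K) := fun k =>
    ⟨closure (V k), (hV k).closure, isClosed_closure⟩
  have hlt : ∀ k, k < Nat.card σ → W k < W (k + 1) := by
    intro k hk
    refine SetLike.lt_iff_le_and_exists.2 ⟨?_, ?_⟩
    · refine closure_mono ?_
      rintro p ⟨t, ht, rfl⟩
      exact ⟨t, fun j hj => ht j (by omega), rfl⟩
    · set j := e ⟨k, hk⟩ with hj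
      obtain ⟨t, ht, htL⟩ := h1 j
      refine ⟨Projectivization.mk K (ψ t) (hne t), subset_closure ⟨t, fun i hi => ht i ?_, rfl⟩, ?_⟩
      · rintro rfl
        rw [hj, Equiv.symm_apply_apply] at hi
        simp at hi
      · intro hmem
        refine htL (mk_mem_closure_iff.1 hmem (L j) ?_)
        rintro v hv ⟨t', ht', hvt⟩
        obtain ⟨c, rfl⟩ := (Projectivization.mk_eq_mk_iff' K _ _ _ _).1 hvt.symm
        rw [coord_smul, eval_smul_of_isHomogeneous (hhom j), h0 j t', mul_zero]
        · exact ht' j (by rw [hj, Equiv.symm_apply_apply])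
        · intro i hi
          refine ht' i ?_
          by_contra! hcon
          have h2 : e.symm i ≤ ⟨k, hk⟩ := Fin.le_def.2 hcon.le
          have h3 := he h2
          simp only [Function.comp_apply, Equiv.apply_symm_apply] at h3
          exact absurd hi (not_lt.2 h3)
  have hh : ∀ k, k ≤ Nat.card σ → (k : ℕ∞) ≤ Order.height (W k) := by
    intro k
    induction k with
    | zero => intro _; simp
    | succ k ih =>
      intro hk
      have := Order.height_add_one_le (hlt k (by omega))
      refine le_trans ?_ this
      push_cast
      gcongr
      exact ih (by omega)
  refine (hh _ le_rfl).trans (Order.height_mono ?_)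
  refine closure_minimal ?_ Y.isClosed
  rintro p ⟨t, -, rfl⟩
  exact hY t

end Dimension

/-! ### Normal forms under the symplectic group -/

section LinearAlgebra

variable {r : ℕ} {K : Type*} [Field K]

theorem omega_transpose : (Omega r K)ᵀ = -Omega r K := by
  simp [Omega, Matrix.fromBlocks_transpose, Matrix.fromBlocks_neg]

theorem omega_mul_omega : Omega r K * Omega r K = -1 := by
  rw [Omega, Matrix.fromBlocks_multiply, ← Matrix.fromBlocks_one, Matrix.fromBlocks_neg]
  simp

theorem symplectic_of_fromBlocks {A B C D : Matrix (Fin r) (Fin r) K} (h1 : Aᵀ * C = Cᵀ * A)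
    (h2 : Bᵀ * D = Dᵀ * B) (h3 : Aᵀ * D - Cᵀ * B = 1) :
    Matrix.fromBlocks A B C D ∈ Matrix.symplecticGroup (Fin r) K :=
  SymplecticGroup.fromBlocks_mem_iff.2 ⟨h1, h2, h3⟩

theorem upper_mem {H : Matrix (Fin r) (Fin r) K} (hH : Hᵀ = H) :
    Matrix.fromBlocks 1 H 0 1 ∈ Matrix.symplecticGroup (Fin r) K :=
  symplectic_of_fromBlocks (by simp) (by simp [hH]) (by simp)

theorem lower_mem {T : Matrix (Fin r) (Fin r) K} (hT : Tᵀ = T) :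
    Matrix.fromBlocks 1 0 T 1 ∈ Matrix.symplecticGroup (Fin r) K :=
  symplectic_of_fromBlocks (by simp [hT]) (by simp) (by simp)

/-- A Lagrangian pair `(A, C)` can be moved by a symmetric shear `A + H C` to one whose first
component is invertible: as long as `A + H C` is singular with kernel vector `x`, the vector
`y = C x` annihilates the image of `A + H C`, and adding to `H` the square of a coordinate form
on which `y` is nonzero makes the kernel smaller. -/
theorem exists_symm_add_mul_isUnit {l : Type*} [Fintype l] [DecidableEq l] (A C : Matrix l l K)
    (hAC : Aᵀ * C = Cᵀ * A) (hker : ∀ x, A *ᵥ x = 0 → C *ᵥ x = 0 → x = 0) :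
    ∃ H : Matrix l l K, Hᵀ = H ∧ IsUnit (A + H * C).det := by
  induction hd : Module.finrank K (LinearMap.ker A.mulVecLin) using Nat.strong_induction_on
    generalizing A with
  | _ d ih =>
    by_cases hinj : LinearMap.ker A.mulVecLin = ⊥
    · refine ⟨0, by simp, ?_⟩
      rw [zero_mul, add_zero, ← Matrix.isUnit_iff_isUnit_det, ← Matrix.mulVec_injective_iff_isUnit]
      exact LinearMap.ker_eq_bot.1 hinj
    · obtain ⟨x, hx, hx0⟩ := (Submodule.ne_bot_iff _).1 hinj
      have hAx : A *ᵥ x = 0 := hx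
      have hy0 : C *ᵥ x ≠ 0 := fun h => hx0 (hker x hAx h)
      obtain ⟨j, hj⟩ := Function.ne_iff.1 hy0
      set y := C *ᵥ x with hy
      -- `y` annihilates the image of `A`
      have hyA : ∀ z, y ⬝ᵥ A *ᵥ z = 0 := by
        intro z
        have h1 : Aᵀ *ᵥ y = 0 := by
          rw [hy, Matrix.mulVec_mulVec, hAC, ← Matrix.mulVec_mulVec, hAx, Matrix.mulVec_zero]
        rw [Matrix.dotProduct_mulVec, ← Matrix.mulVec_transpose, h1, zero_dotProduct]
      let e : l → K := Pi.single j 1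
      let E : Matrix l l K := Matrix.vecMulVec e e
      have hE : Eᵀ = E := Matrix.transpose_vecMulVec e e
      have hmul : ∀ z, (A + E * C) *ᵥ z = A *ᵥ z + (C *ᵥ z) j • e := by
        intro z
        rw [Matrix.add_mulVec, ← Matrix.mulVec_mulVec, Matrix.vecMulVec_mulVec]
        congr 1
        ext i
        simp [e, mul_comm]
      have hkeq : ∀ z, (A + E * C) *ᵥ z = 0 → A *ᵥ z = 0 ∧ (C *ᵥ z) j = 0 := by
        intro z hz
        rw [hmul] at hz
        have h1 : y ⬝ᵥ (A *ᵥ z + (C *ᵥ z) j • e) = 0 := by rw [hz, dotProduct_zero]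
        have h2 : (C *ᵥ z) j = 0 := by
          rw [dotProduct_add, hyA, zero_add, dotProduct_smul] at h1
          have h3 : y j ≠ 0 := hj
          simpa [e, h3] using h1
        rw [h2, zero_smul, add_zero] at hz
        exact ⟨hz, h2⟩
      obtain ⟨H, hH, hu⟩ := ih _ (by
        rw [← hd]
        refine Submodule.finrank_lt_finrank_of_lt (SetLike.lt_iff_le_and_exists.2 ⟨?_, x, hx, ?_⟩)
        · intro z hz
          exact (hkeq z hz).1
        · intro hx'
          exact hj (hkeq x hx').2) (A + E * C) (by
            rw [Matrix.transpose_add, Matrix.add_mul, Matrix.mul_add, hAC, Matrix.transpose_mul,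
              hE, Matrix.mul_assoc]) (by
            intro z h1 h2
            exact hker z (hkeq z h1).1 h2) rfl
      refine ⟨E + H, by rw [Matrix.transpose_add, hE, hH], ?_⟩
      rwa [Matrix.add_mul, ← add_assoc]

theorem omega_skew (x y : Fin r ⊕ Fin r → K) :
    x ⬝ᵥ Omega r K *ᵥ y = -(y ⬝ᵥ Omega r K *ᵥ x) := by
  rw [Matrix.dotProduct_mulVec, ← Matrix.mulVec_transpose, omega_transpose, Matrix.neg_mulVec,
    neg_dotProduct, dotProduct_comm]

theorem omega_self [CharZero K] (x : Fin r ⊕ Fin r → K) : x ⬝ᵥ Omega r K *ᵥ x = 0 :=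
  self_eq_neg.1 (omega_skew x x)

theorem transpose_mul_omega_mul_apply {k : ℕ} (B : Matrix (Fin r ⊕ Fin r) (Fin k) K) (i j : Fin k) :
    (Bᵀ * Omega r K * B) i j = B.col i ⬝ᵥ Omega r K *ᵥ B.col j := by
  rw [Matrix.mul_assoc]
  rfl

/-- The conditions of being orthogonal to `m < r` vectors cut out a subspace of dimension greater
than `m`, so isotropic families extend up to `r` vectors. -/
theorem exists_isotropic_extension [CharZero K] {k : ℕ} (b : Fin k → Fin r ⊕ Fin r → K)
    (hb : LinearIndependent K b) (hiso : ∀ i j, b i ⬝ᵥ Omega r K *ᵥ b j = 0) {m : ℕ} (hkm : k ≤ m)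
    (hm : m ≤ r) : ∃ b' : Fin m → Fin r ⊕ Fin r → K, LinearIndependent K b' ∧
      (∀ i j, b' i ⬝ᵥ Omega r K *ᵥ b' j = 0) ∧ ∀ i, b' (Fin.castLE hkm i) = b i := by
  induction m, hkm using Nat.le_induction with
  | base => exact ⟨b, hb, hiso, fun i => rfl⟩
  | succ m hkm ih =>
    obtain ⟨c, hc, hciso, hcb⟩ := ih (by omega)
    let φ : (Fin r ⊕ Fin r → K) →ₗ[K] (Fin m → K) :=
      LinearMap.pi fun i => (dotProductBilin K K (c i)) ∘ₗ (Omega r K).mulVecLin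
    have hφ : ∀ v i, φ v i = c i ⬝ᵥ Omega r K *ᵥ v := fun v i => rfl
    obtain ⟨v, hv, hvs⟩ : ∃ v ∈ LinearMap.ker φ, v ∉ Submodule.span K (Set.range c) := by
      by_contra! hcon
      have h1 := Submodule.finrank_mono (show LinearMap.ker φ ≤ _ from hcon)
      have h2 := φ.finrank_range_add_finrank_ker
      have h3 : Module.finrank K (LinearMap.range φ) ≤ m := by
        simpa using Submodule.finrank_le (LinearMap.range φ)
      rw [finrank_span_eq_card hc] at h1
      simp at h1 h2
      omega
    have hv' : ∀ i, c i ⬝ᵥ Omega r K *ᵥ v = 0 := fun i => by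
      rw [← hφ, LinearMap.mem_ker.1 hv, Pi.zero_apply]
    refine ⟨Fin.snoc c v, linearIndependent_finSnoc.2 ⟨hc, hvs⟩, ?_, ?_⟩
    · intro i j
      induction i using Fin.lastCases with
      | last =>
        induction j using Fin.lastCases with
        | last => simp [omega_self]
        | cast j => simp [omega_skew v, hv']
      | cast i =>
        induction j using Fin.lastCases with
        | last => simp [hv']
        | cast j => simp [hciso]
    · intro i
      have : Fin.castLE (hkm.trans (Nat.le_succ m)) i = Fin.castSucc (Fin.castLE hkm i) := rfl
      rw [this, Fin.snoc_castSucc, hcb]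

theorem exists_mul_eq_one_of_linearIndependent_col {n m : Type*} [Fintype n] [Fintype m]
    [DecidableEq n] [DecidableEq m] {B : Matrix n m K} (hB : LinearIndependent K B.col) :
    ∃ L : Matrix m n K, L * B = 1 := by
  obtain ⟨g, hg⟩ := LinearMap.exists_leftInverse_of_injective B.mulVecLin
    (LinearMap.ker_eq_bot.2 (Matrix.mulVec_injective_iff.2 hB))
  refine ⟨LinearMap.toMatrix' g, ?_⟩
  rw [← LinearMap.toMatrix'_toLin' B, Matrix.toLin'_apply', ← LinearMap.toMatrix'_comp, hg,
    LinearMap.toMatrix'_id]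

/-- A basis of a Lagrangian subspace is the first half of a symplectic basis. -/
theorem exists_symplectic_of_lagrangian [CharZero K] (B : Matrix (Fin r ⊕ Fin r) (Fin r) K)
    (hB : LinearIndependent K B.col) (hiso : Bᵀ * Omega r K * B = 0) :
    ∃ M ∈ Matrix.symplecticGroup (Fin r) K, ∀ a i, M a (Sum.inl i) = B a i := by
  obtain ⟨L, hL⟩ := exists_mul_eq_one_of_linearIndependent_col hB
  -- a first approximation `C₀` to the dual half of the basis, corrected by a multiple of `B`
  let C₀ := -(Omega r K * Lᵀ)
  have h1 : Bᵀ * Omega r K * C₀ = 1 := by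
    rw [Matrix.mul_neg, Matrix.mul_assoc, ← Matrix.mul_assoc (Omega r K), omega_mul_omega,
      Matrix.neg_mul, Matrix.mul_neg, neg_neg, Matrix.one_mul, ← Matrix.transpose_mul, hL,
      Matrix.transpose_one]
  have h1' : C₀ᵀ * Omega r K * B = -1 := by
    have := congrArg Matrix.transpose h1
    rw [Matrix.transpose_mul, Matrix.transpose_mul, Matrix.transpose_transpose, omega_transpose,
      Matrix.transpose_one, Matrix.neg_mul, Matrix.mul_neg, ← Matrix.mul_assoc] at this
    rw [← this, neg_neg]
  set S := C₀ᵀ * Omega r K * C₀ with hS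
  have hSt : Sᵀ = -S := by
    rw [hS, Matrix.transpose_mul, Matrix.transpose_mul, Matrix.transpose_transpose, omega_transpose,
      Matrix.neg_mul, Matrix.mul_neg, ← Matrix.mul_assoc]
  let C := C₀ + B * ((2 : K)⁻¹ • S)
  have hC1 : Bᵀ * Omega r K * C = 1 := by
    rw [Matrix.mul_add, h1, ← Matrix.mul_assoc, hiso, Matrix.zero_mul, add_zero]
  have hC2 : Cᵀ * Omega r K * C = 0 := by
    have h2 : Cᵀ = C₀ᵀ + (-(2 : K)⁻¹ • S) * Bᵀ := by
      rw [Matrix.transpose_add, Matrix.transpose_mul, Matrix.transpose_smul, hSt, smul_neg, neg_smul]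
    have h3 : C₀ᵀ * Omega r K * C = (2 : K)⁻¹ • S := by
      rw [Matrix.mul_add, ← hS, ← Matrix.mul_assoc, h1', Matrix.neg_mul, Matrix.one_mul]
      have : S = (2 : K)⁻¹ • S + (2 : K)⁻¹ • S := by
        rw [← add_smul, ← two_mul, mul_inv_cancel₀ two_ne_zero, one_smul]
      nth_rewrite 1 [this]
      abel
    rw [h2, Matrix.add_mul, Matrix.add_mul, h3, Matrix.mul_assoc, Matrix.mul_assoc,
      ← Matrix.mul_assoc Bᵀ, hC1, Matrix.mul_one, neg_smul, add_neg_cancel]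
  have hC3 : Cᵀ * Omega r K * B = -1 := by
    have := congrArg Matrix.transpose hC1
    rw [Matrix.transpose_mul, Matrix.transpose_mul, Matrix.transpose_transpose, omega_transpose,
      Matrix.transpose_one, Matrix.neg_mul, Matrix.mul_neg, ← Matrix.mul_assoc] at this
    rw [← this, neg_neg]
  refine ⟨Matrix.fromCols B C, mem_symplecticGroup_iff.2 ?_, fun a i => rfl⟩
  rw [Matrix.transpose_fromCols, Matrix.fromRows_mul, Matrix.fromRows_mul_fromCols, hiso, hC1, hC2,
    hC3]
  rfl

/-- Independent vectors spanning an isotropic subspace are part of a symplectic basis. -/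
theorem exists_symplectic_of_isotropic [CharZero K] {k : ℕ} (hk : k ≤ r)
    (B : Matrix (Fin r ⊕ Fin r) (Fin k) K) (hB : LinearIndependent K B.col)
    (hiso : Bᵀ * Omega r K * B = 0) :
    ∃ M ∈ Matrix.symplecticGroup (Fin r) K, ∀ a i, M a (Sum.inl (Fin.castLE hk i)) = B a i := by
  obtain ⟨b, hb, hbiso, hbB⟩ := exists_isotropic_extension B.col hB (fun i j => by
    rw [← transpose_mul_omega_mul_apply, hiso, Matrix.zero_apply]) hk le_rfl
  obtain ⟨M, hM, hMb⟩ := exists_symplectic_of_lagrangian (Matrix.of b)ᵀ hb (by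
    ext i j
    rw [transpose_mul_omega_mul_apply]
    exact hbiso i j)
  refine ⟨M, hM, fun a i => ?_⟩
  rw [hMb, Matrix.transpose_apply, Matrix.of_apply, hbB]
  rfl

/-- A symmetric matrix of rank `k` over an algebraically closed field is a sum of `k` squares. -/
theorem exists_eq_mul_transpose [CharZero K] [IsAlgClosed K] {n : Type*} [Fintype n] [DecidableEq n]
    (Z : Matrix n n K) (hZ : Zᵀ = Z) {k : ℕ} (hk : Z.rank = k) :
    ∃ B : Matrix n (Fin k) K, LinearIndependent K B.col ∧ Z = B * Bᵀ := by
  classical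
  have : Invertible (2 : K) := invertibleOfNonzero two_ne_zero
  obtain ⟨v, hv⟩ := LinearMap.BilinForm.exists_orthogonal_basis (B := Matrix.toBilin' Z)
    ⟨fun x y => by
      rw [Matrix.toBilin'_apply', Matrix.toBilin'_apply', Matrix.dotProduct_mulVec,
        ← Matrix.mulVec_transpose, hZ, dotProduct_comm]
      rfl⟩
  let P : Matrix n (Fin (Module.finrank K (n → K))) K := (Pi.basisFun K n).toMatrix v
  let Q : Matrix (Fin (Module.finrank K (n → K))) n K := v.toMatrix (Pi.basisFun K n)
  have hPQ : P * Q = 1 := Module.Basis.toMatrix_mul_toMatrix_flip _ _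
  let d := fun i => v i ⬝ᵥ Z *ᵥ v i
  have hD : Pᵀ * Z * P = Matrix.diagonal d := by
    ext i j
    have h1 : (Pᵀ * Z * P) i j = v i ⬝ᵥ Z *ᵥ v j := by
      rw [Matrix.mul_assoc]
      rfl
    rw [h1]
    rcases eq_or_ne i j with rfl | hij
    · simp [d]
    · rw [Matrix.diagonal_apply_ne _ hij]
      simpa [Matrix.toBilin'_apply'] using hv hij
  have hZD : Z = Qᵀ * Matrix.diagonal d * Q := by
    have hQP : Qᵀ * Pᵀ = 1 := by rw [← Matrix.transpose_mul, hPQ, Matrix.transpose_one]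
    rw [← hD, Matrix.mul_assoc, Matrix.mul_assoc, hPQ, Matrix.mul_one, ← Matrix.mul_assoc, hQP,
      Matrix.one_mul]
  have hrk : Fintype.card {i // d i ≠ 0} = k := by
    rw [← Matrix.rank_diagonal, ← hk]
    refine le_antisymm ?_ ?_
    · rw [← hD]
      exact (Matrix.rank_mul_le_left _ _).trans (Matrix.rank_mul_le_right _ _)
    · rw [hZD]
      exact (Matrix.rank_mul_le_left _ _).trans (Matrix.rank_mul_le_right _ _)
  choose e he using fun i => IsAlgClosed.exists_eq_mul_self (d i)
  let ε : Fin k ≃ {i // d i ≠ 0} := (Fintype.equivFinOfCardEq hrk).symm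
  let B : Matrix n (Fin k) K := Matrix.of fun a i => Q (ε i) a * e (ε i)
  have hZB : Z = B * Bᵀ := by
    ext a b
    have h1 : Z a b = ∑ i, Q i a * d i * Q i b := by
      conv_lhs => rw [hZD, Matrix.mul_apply]
      simp [Matrix.mul_diagonal]
    rw [h1, Matrix.mul_apply]
    have h2 : ∑ i, B a i * Bᵀ i b = ∑ i : {i // d i ≠ 0}, Q i a * d i * Q i b := by
      rw [← ε.sum_comp]
      refine Finset.sum_congr rfl fun i _ => ?_
      simp only [B, Matrix.of_apply, Matrix.transpose_apply]
      rw [he (ε i)]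
      ring
    rw [h2, ← Finset.sum_subtype (Finset.univ.filter fun i => d i ≠ 0) (by simp)
      (fun i => Q i a * d i * Q i b), Finset.sum_filter_of_ne]
    intro i _ hi hi0
    exact hi (by rw [hi0, mul_zero, zero_mul])
  refine ⟨B, ?_, hZB⟩
  rw [linearIndependent_iff_card_eq_finrank_span, Set.finrank, ← Matrix.rank_eq_finrank_span_cols]
  refine le_antisymm ?_ ((Matrix.rank_le_card_width B).trans (by simp))
  have h1 := Matrix.rank_mul_le_left B Bᵀ
  rw [Fintype.card_fin]
  rwa [← hZB, hk] at h1

theorem sum_ite_lt_eq_sum_castLE {k : ℕ} (hk : k ≤ r) (f : Fin r → K) :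
    ∑ i : Fin r, (if (i : ℕ) < k then f i else 0) = ∑ i : Fin k, f (Fin.castLE hk i) := by
  obtain ⟨m, rfl⟩ := Nat.exists_eq_add_of_le hk
  rw [Fin.sum_univ_add]
  simp
  rfl

theorem mul_stdMat_mul_transpose_apply {k : ℕ} (hk : k ≤ r)
    (M : Matrix (Fin r ⊕ Fin r) (Fin r ⊕ Fin r) K) (a b : Fin r ⊕ Fin r) :
    (M * (stdMat r K k).1 * Mᵀ) a b =
      ∑ i : Fin k, M a (Sum.inl (Fin.castLE hk i)) * M b (Sum.inl (Fin.castLE hk i)) := by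
  have h1 : (M * (stdMat r K k).1 * Mᵀ) a b = ∑ c, if pos c < k then M a c * M b c else 0 := by
    rw [Matrix.mul_apply]
    refine Finset.sum_congr rfl fun c _ => ?_
    simp only [stdMat, Matrix.mul_diagonal, Matrix.transpose_apply, mul_ite, mul_one, mul_zero,
      ite_mul, zero_mul]
  rw [h1, Fintype.sum_sum_type]
  have h2 : ∀ i : Fin r, ¬ (r + (i : ℕ) < k) := fun i => by omega
  simp only [pos, Sum.elim_inl, Sum.elim_inr, h2, if_false, Finset.sum_const_zero, add_zero]
  exact sum_ite_lt_eq_sum_castLE hk fun i => M a (Sum.inl i) * M b (Sum.inl i)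

theorem rank_le_of_mul_omega_mul_eq_zero {Z : Matrix (Fin r ⊕ Fin r) (Fin r ⊕ Fin r) K}
    (h : Z * Omega r K * Z = 0) : Z.rank ≤ r := by
  have hu : IsUnit (Omega r K).det := by
    rw [← Matrix.isUnit_iff_isUnit_det]
    exact IsUnit.of_mul_eq_one (-Omega r K) (by rw [Matrix.mul_neg, omega_mul_omega, neg_neg])
  have h1 := Matrix.rank_add_rank_le_card_of_mul_eq_zero h
  rw [Matrix.rank_mul_eq_left_of_isUnit_det _ _ hu] at h1
  simp only [Fintype.card_sum, Fintype.card_fin] at h1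
  omega

/-- The columns of `B` are isotropic if `Z = B Bᵗ` satisfies `Z Ω Z = 0`. -/
theorem isotropic_of_mul_transpose {k : ℕ} {Z : Matrix (Fin r ⊕ Fin r) (Fin r ⊕ Fin r) K}
    (h : Z * Omega r K * Z = 0) {B : Matrix (Fin r ⊕ Fin r) (Fin k) K}
    (hB : LinearIndependent K B.col) (hZB : Z = B * Bᵀ) : Bᵀ * Omega r K * B = 0 := by
  obtain ⟨L, hL⟩ := exists_mul_eq_one_of_linearIndependent_col hB
  have hL' : Bᵀ * Lᵀ = 1 := by rw [← Matrix.transpose_mul, hL, Matrix.transpose_one]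
  calc Bᵀ * Omega r K * B = (L * B) * (Bᵀ * Omega r K * B) * (Bᵀ * Lᵀ) := by
        rw [hL, hL', Matrix.one_mul, Matrix.mul_one]
    _ = L * (Z * Omega r K * Z) * Lᵀ := by simp only [hZB, Matrix.mul_assoc]
    _ = 0 := by rw [h, Matrix.mul_zero, Matrix.zero_mul]

/-- A symmetric matrix of rank `k` with isotropic column space is symplectically equivalent
to `I_k`. -/
theorem exists_symplectic_eq_stdMat [CharZero K] [IsAlgClosed K]
    {Z : Matrix (Fin r ⊕ Fin r) (Fin r ⊕ Fin r) K} (hZ : Zᵀ = Z) (h : Z * Omega r K * Z = 0)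
    {k : ℕ} (hrk : Z.rank = k) :
    ∃ M ∈ Matrix.symplecticGroup (Fin r) K, Z = M * (stdMat r K k).1 * Mᵀ := by
  have hk : k ≤ r := hrk ▸ rank_le_of_mul_omega_mul_eq_zero h
  obtain ⟨B, hB, hZB⟩ := exists_eq_mul_transpose Z hZ hrk
  obtain ⟨M, hM, hMB⟩ := exists_symplectic_of_isotropic hk B hB
    (isotropic_of_mul_transpose h hB hZB)
  refine ⟨M, hM, Matrix.ext fun a b => ?_⟩
  rw [mul_stdMat_mul_transpose_apply hk]
  have h3 : Z a b = (B * Bᵀ) a b := congrFun (congrFun hZB a) b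
  rw [h3, Matrix.mul_apply]
  refine Finset.sum_congr rfl fun i _ => ?_
  rw [hMB, hMB, Matrix.transpose_apply]

theorem symplectic_mul_omega_mul_transpose {M : Matrix (Fin r ⊕ Fin r) (Fin r ⊕ Fin r) K}
    (hM : M ∈ Matrix.symplecticGroup (Fin r) K) : M * Omega r K * Mᵀ = Omega r K := by
  have := mem_symplecticGroup_iff.1 (SymplecticGroup.transpose_mem hM)
  rwa [Matrix.transpose_transpose] at this

theorem exists_symplectic_inverse {M : Matrix (Fin r ⊕ Fin r) (Fin r ⊕ Fin r) K}
    (hM : M ∈ Matrix.symplecticGroup (Fin r) K) :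
    ∃ N ∈ Matrix.symplecticGroup (Fin r) K, N * M = 1 ∧ M * N = 1 := by
  refine ⟨_, ((⟨M, hM⟩ : Matrix.symplecticGroup (Fin r) K)⁻¹).2, ?_, ?_⟩
  · exact congrArg Subtype.val (inv_mul_cancel (⟨M, hM⟩ : Matrix.symplecticGroup (Fin r) K))
  · exact congrArg Subtype.val (mul_inv_cancel (⟨M, hM⟩ : Matrix.symplecticGroup (Fin r) K))

/-- If `Z Ω Z = c Ω` with `c ≠ 0`, then `(Z Ω)² = -c`, so that `Z Ω` has an eigenspace of dimension
at least `r`, which is isotropic. In a symplectic basis that starts with eigenvectors the lower right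
block of `Z` is zero, and a shear makes `Z` a multiple of the block swap. -/
theorem exists_symplectic_eq_swap [CharZero K] [IsAlgClosed K]
    {Z : Matrix (Fin r ⊕ Fin r) (Fin r ⊕ Fin r) K} (hZ : Zᵀ = Z) {c : K} (hc : c ≠ 0)
    (h : Z * Omega r K * Z = c • Omega r K) :
    ∃ M ∈ Matrix.symplecticGroup (Fin r) K, ∃ ν : K, ν ≠ 0 ∧
      M * Z * Mᵀ = ν • Matrix.fromBlocks 0 1 1 0 := by
  obtain ⟨μ, hμ⟩ := IsAlgClosed.exists_eq_mul_self (-c)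
  set A := Z * Omega r K with hA
  have hAA : A * A = (-c) • 1 := by
    rw [hA, ← Matrix.mul_assoc, h, Matrix.smul_mul, omega_mul_omega, smul_neg, neg_smul]
  have hprod : (A - μ • 1) * (A + μ • 1) = 0 := by
    rw [Matrix.sub_mul, Matrix.mul_add, Matrix.mul_add, hAA, hμ]
    simp only [Matrix.smul_mul, Matrix.mul_smul, Matrix.mul_one, Matrix.one_mul, smul_smul]
    abel
  -- one of the eigenspaces of `A` has dimension at least `r`
  obtain ⟨ν, hν, hrank⟩ : ∃ ν : K, -c = ν * ν ∧ (A - ν • 1).rank ≤ r := by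
    have h1 := Matrix.rank_add_rank_le_card_of_mul_eq_zero hprod
    simp only [Fintype.card_sum, Fintype.card_fin] at h1
    by_cases h2 : (A - μ • 1).rank ≤ r
    · exact ⟨μ, hμ, h2⟩
    · refine ⟨-μ, by rw [neg_mul_neg, hμ], ?_⟩
      rw [neg_smul, sub_neg_eq_add]
      omega
  have hν0 : ν ≠ 0 := by
    rintro rfl
    exact hc (by simpa using hν)
  obtain ⟨f, hf⟩ : ∃ f : Fin r → LinearMap.ker (A - ν • 1).mulVecLin, LinearIndependent K f := by
    refine exists_linearIndependent_of_le_finrank ?_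
    have h1 := (A - ν • 1).mulVecLin.finrank_range_add_finrank_ker
    change (A - ν • 1).rank + _ = _ at h1
    simp only [Module.finrank_fintype_fun_eq_card, Fintype.card_sum, Fintype.card_fin] at h1
    omega
  let F : Matrix (Fin r ⊕ Fin r) (Fin r) K := Matrix.of fun a i => (f i).1 a
  have hF : LinearIndependent K F.col := hf.map' (Submodule.subtype _) (Submodule.ker_subtype _)
  have hAF : A * F = ν • F := by
    ext a i
    have h1 : (A - ν • 1) *ᵥ (f i).1 = 0 := (f i).2
    rw [Matrix.sub_mulVec, Matrix.smul_mulVec, Matrix.one_mulVec, sub_eq_zero] at h1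
    exact congrFun h1 a
  have hiso : Fᵀ * Omega r K * F = 0 := by
    have h1 : Fᵀ * Aᵀ = ν • Fᵀ := by rw [← Matrix.transpose_mul, hAF, Matrix.transpose_smul]
    have h2 : Aᵀ * Omega r K = -(Omega r K * A) := by
      rw [hA, Matrix.transpose_mul, hZ, omega_transpose, Matrix.neg_mul, Matrix.neg_mul,
        Matrix.mul_assoc]
    have h3 : ν • (Fᵀ * Omega r K * F) = -(ν • (Fᵀ * Omega r K * F)) := by
      conv_lhs => rw [← Matrix.smul_mul, ← Matrix.smul_mul, ← h1, Matrix.mul_assoc Fᵀ, h2,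
        Matrix.mul_neg, Matrix.neg_mul, ← Matrix.mul_assoc, Matrix.mul_assoc _ A, hAF,
        Matrix.mul_smul]
    have h4 : (2 * ν) • (Fᵀ * Omega r K * F) = 0 := by
      rw [two_mul, add_smul]
      nth_rewrite 1 [h3]
      rw [neg_add_cancel]
    exact (smul_eq_zero.1 h4).resolve_left (mul_ne_zero two_ne_zero hν0)
  obtain ⟨M, hM, hMF⟩ := exists_symplectic_of_lagrangian F hF hiso
  obtain ⟨N, hN, hNM, hMN⟩ := exists_symplectic_inverse hM
  set Z' := N * Z * Nᵀ with hZ'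
  have hZ't : Z'ᵀ = Z' := by
    rw [hZ', Matrix.transpose_mul, Matrix.transpose_mul, Matrix.transpose_transpose, hZ,
      Matrix.mul_assoc]
  have hZ'Ω : Z' * Omega r K = N * (A * M) := by
    have h1 : Nᵀ * Omega r K = Omega r K * M := by
      have := mem_symplecticGroup_iff.1 hN
      rw [← Matrix.mul_one (Nᵀ * Omega r K), ← hNM, ← Matrix.mul_assoc, this]
    rw [hZ', Matrix.mul_assoc, h1, hA]
    simp only [Matrix.mul_assoc]
  have hcol : ∀ a i, (Z' * Omega r K) a (Sum.inl i) = ν *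
      (1 : Matrix (Fin r ⊕ Fin r) (Fin r ⊕ Fin r) K) a (Sum.inl i) := by
    intro a i
    have h1 : ∀ b, (A * M) b (Sum.inl i) = ν * M b (Sum.inl i) := by
      intro b
      rw [hMF]
      have := congrFun (congrFun hAF b) i
      rw [Matrix.mul_apply] at this ⊢
      simp only [hMF]
      exact this
    rw [hZ'Ω, ← hNM, Matrix.mul_apply, Matrix.mul_apply, Finset.mul_sum]
    refine Finset.sum_congr rfl fun b _ => ?_
    rw [h1]
    ring
  -- the blocks of `Z'`
  have hblocks : ∃ X : Matrix (Fin r) (Fin r) K, Xᵀ = X ∧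
      Z' = Matrix.fromBlocks X (-ν • 1) (-ν • 1) 0 := by
    have hΩ : ∀ a i, (Z' * Omega r K) a (Sum.inl i) = -Z' a (Sum.inr i) := by
      intro a i
      rw [Matrix.mul_apply, Fintype.sum_sum_type]
      simp [Omega, Matrix.one_apply]
    have hs : ∀ a b, Z' a b = Z' b a := fun a b => congrFun (congrFun hZ't b) a
    have h1 : ∀ a i, Z' a (Sum.inr i) = -ν *
        (1 : Matrix (Fin r ⊕ Fin r) (Fin r ⊕ Fin r) K) a (Sum.inl i) := by
      intro a i
      rw [neg_mul, ← hcol, hΩ, neg_neg]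
    refine ⟨Z'.toBlocks₁₁, Matrix.ext fun i j => hs _ _, Matrix.ext fun a b => ?_⟩
    rcases a with a | a <;> rcases b with b | b
    · rfl
    · rw [h1]
      rcases eq_or_ne a b with rfl | hab <;> simp [*]
    · rw [hs, h1]
      rcases eq_or_ne b a with rfl | hab
      · simp
      · simp [hab, hab.symm]
    · rw [h1]
      simp
  obtain ⟨X, hX, hZX⟩ := hblocks
  have hT : ((2 * ν)⁻¹ • X)ᵀ = (2 * ν)⁻¹ • X := by rw [Matrix.transpose_smul, hX]
  refine ⟨_, mul_mem (upper_mem hT) hN, -ν, neg_ne_zero.2 hν0, ?_⟩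
  have h5 : ∀ U : Matrix (Fin r ⊕ Fin r) (Fin r ⊕ Fin r) K,
      U * N * Z * (U * N)ᵀ = U * Z' * Uᵀ := by
    intro U
    rw [hZ', Matrix.transpose_mul]
    simp only [Matrix.mul_assoc]
  have h6 : X - ν • ((2 * ν)⁻¹ • X) - ν • ((2 * ν)⁻¹ • X) = 0 := by
    rw [smul_smul, sub_sub, ← add_smul]
    have : ν * (2 * ν)⁻¹ + ν * (2 * ν)⁻¹ = 1 := by
      field_simp
      norm_num
    rw [this, one_smul, sub_self]
  rw [h5, hZX, Matrix.fromBlocks_transpose, Matrix.fromBlocks_multiply, Matrix.fromBlocks_multiply,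
    Matrix.fromBlocks_smul, hT]
  congr 1
  · refine Eq.trans ?_ (h6.trans (smul_zero _).symm)
    simp only [Matrix.one_mul, Matrix.mul_one, Matrix.mul_zero, Matrix.transpose_one,
      Matrix.smul_mul, Matrix.mul_smul, neg_smul, Matrix.mul_neg, Matrix.neg_mul, add_zero,
      smul_neg, sub_eq_add_neg]
    rw [smul_comm (2 * ν)⁻¹ ν X]
  · simp
  · simp
  · simp

/-- All symmetric matrices with `Z Ω Z` a nonzero multiple of `Ω` are symplectically equivalent to
multiples of the identity. -/
theorem exists_symplectic_eq_smul_one [CharZero K] [IsAlgClosed K]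
    {Z : Matrix (Fin r ⊕ Fin r) (Fin r ⊕ Fin r) K} (hZ : Zᵀ = Z) {c : K} (hc : c ≠ 0)
    (h : Z * Omega r K * Z = c • Omega r K) :
    ∃ M ∈ Matrix.symplecticGroup (Fin r) K, ∃ ν : K, ν ≠ 0 ∧ Z = ν • (M * Mᵀ) := by
  obtain ⟨M, hM, ν, hν, h1⟩ := exists_symplectic_eq_swap hZ hc h
  obtain ⟨M', hM', ν', hν', h1'⟩ := exists_symplectic_eq_swap (r := r) (K := K)
    Matrix.transpose_one one_ne_zero (by rw [Matrix.one_mul, Matrix.mul_one, one_smul])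
  obtain ⟨N, hN, hNM, hMN⟩ := exists_symplectic_inverse hM
  have hNt : Mᵀ * Nᵀ = 1 := by rw [← Matrix.transpose_mul, hNM, Matrix.transpose_one]
  refine ⟨N * M', mul_mem hN hM', ν * ν'⁻¹, mul_ne_zero hν (inv_ne_zero hν'), ?_⟩
  have h2 : Z = N * (M * Z * Mᵀ) * Nᵀ := by
    rw [Matrix.mul_assoc M, ← Matrix.mul_assoc, ← Matrix.mul_assoc, hNM, Matrix.one_mul,
      Matrix.mul_assoc, hNt, Matrix.mul_one]
  rw [Matrix.mul_one] at h1'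
  have h3 : Matrix.fromBlocks 0 1 1 0 = ν'⁻¹ • (M' * M'ᵀ) := by
    rw [h1', smul_smul, inv_mul_cancel₀ hν', one_smul]
  rw [h2, h1, h3, Matrix.transpose_mul, smul_smul, Matrix.mul_smul, Matrix.smul_mul]
  simp only [Matrix.mul_assoc]

end LinearAlgebra

/-! ### Equations of the orbits and of their closures -/

section Orbits

variable {r : ℕ} {K : Type*} [Field K]

theorem symMat_ne_zero {n : Type*} {Z : symMat n K} (h : Z.1 ≠ 0) : Z ≠ 0 := fun h0 => h (by
  rw [h0]
  rfl)

theorem eval_genMat (v : symMat (Fin r ⊕ Fin r) K) :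
    (eval (coord v)).mapMatrix (genMat r K) = v.1 := by
  ext a b
  simp [genMat, coord_mk]

theorem eval_C_mapMatrix {σ m n : Type*} (x : σ → K) (A : Matrix m n K) :
    (A.map (C : K →+* MvPolynomial σ K)).map (eval x) = A := by
  ext a b
  simp

/-- The rank does not increase under specialization. -/
theorem rank_le_of_mem_closure [Infinite K] {W : Set (PSym (Fin r ⊕ Fin r) K)} {k : ℕ}
    (hW : ∀ (w : symMat (Fin r ⊕ Fin r) K) (hw : w ≠ 0), Projectivization.mk K w hw ∈ W →
      w.1.rank ≤ k)
    {v : symMat (Fin r ⊕ Fin r) K} {hv : v ≠ 0} (h : Projectivization.mk K v hv ∈ closure W) :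
    v.1.rank ≤ k := by
  by_contra! hk
  obtain ⟨A, B, e, -, -, he⟩ := Matrix.exists_rank_normal_form v.1
  let ι : Fin v.1.rank → Fin r ⊕ Fin r := e.symm ∘ Sum.inl
  -- a minor of `A Z B` that is nonzero at `v` and vanishes on `W`
  let f : MvPolynomial (Sym2 (Fin r ⊕ Fin r)) K :=
    ((A.map C * genMat r K * B.map C).submatrix ι ι).det
  have hf : ∀ w : symMat (Fin r ⊕ Fin r) K,
      eval (coord w) f = ((A * w.1 * B).submatrix ι ι).det := by
    intro w
    rw [RingHom.map_det]
    congr 1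
    have h1 : (A.map C * genMat r K * B.map C).map (eval (coord w)) = A * w.1 * B := by
      rw [Matrix.map_mul, Matrix.map_mul, eval_C_mapMatrix, eval_C_mapMatrix]
      congr 2
      exact eval_genMat w
    rw [← h1]
    rfl
  have h0 := mk_mem_closure_iff.1 h f (fun w hw hm => by
    rw [hf]
    by_contra hne
    have h1 := Matrix.rank_of_det_ne_zero hne
    have h2 := Matrix.rank_submatrix_le (A * w.1 * B) ι ι
    have h3 := (Matrix.rank_mul_le_left (A * w.1) B).trans (Matrix.rank_mul_le_right A w.1)
    have h4 := hW w hw hm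
    simp only [Fintype.card_fin] at h1
    omega)
  rw [hf, he] at h0
  have h1 : ((Matrix.fromBlocks 1 0 0 0 : Matrix (Fin v.1.rank ⊕ _) (Fin v.1.rank ⊕ _) K).submatrix
      e e).submatrix ι ι = 1 := by
    ext i j
    simp [ι]
  rw [h1, Matrix.det_one] at h0
  exact one_ne_zero h0

theorem mk_mem_orbit_iff {v w : symMat (Fin r ⊕ Fin r) K} {hv : v ≠ 0} {hw : w ≠ 0} :
    Projectivization.mk K v hv ∈ MulAction.orbit (Matrix.symplecticGroup (Fin r) K)
      (Projectivization.mk K w hw) ↔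
    ∃ M ∈ Matrix.symplecticGroup (Fin r) K, ∃ c : K, c ≠ 0 ∧ v.1 = c • (M * w.1 * Mᵀ) := by
  constructor
  · rintro ⟨M, hM⟩
    have h1 : Projectivization.mk K v hv = Projectivization.mk K (M • w)
        ((smul_ne_zero_iff_ne M).2 hw) := hM.symm
    obtain ⟨c, hc⟩ := (Projectivization.mk_eq_mk_iff K _ _ _ _).1 h1
    refine ⟨M.1, M.2, c, c.ne_zero, ?_⟩
    rw [← hc]
    rfl
  · rintro ⟨M, hM, c, hc, h⟩
    refine ⟨⟨M, hM⟩, ?_⟩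
    have h1 : Projectivization.mk K v hv = Projectivization.mk K
        ((⟨M, hM⟩ : Matrix.symplecticGroup (Fin r) K) • w) ((smul_ne_zero_iff_ne _).2 hw) :=
      (Projectivization.mk_eq_mk_iff' K _ _ _ _).2 ⟨c, Subtype.ext h.symm⟩
    exact h1.symm

theorem stdMat_eq_diagonal (k : ℕ) : (stdMat r K k).1 = Matrix.diagonal (Sum.elim
    (fun i : Fin r => if (i : ℕ) < k then 1 else 0)
    (fun i : Fin r => if r + (i : ℕ) < k then 1 else 0)) := by
  refine congrArg Matrix.diagonal (funext fun a => ?_)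
  rcases a with i | i <;> rfl

theorem stdMat_ne_zero (hr : 1 ≤ r) {k : ℕ} (hk : 1 ≤ k) : stdMat r K k ≠ 0 := by
  refine symMat_ne_zero fun h => ?_
  rw [stdMat_eq_diagonal] at h
  have h1 := congrFun (congrFun h (Sum.inl ⟨0, hr⟩)) (Sum.inl ⟨0, hr⟩)
  simp at h1
  omega

theorem mk_mem_O_iff (hr : 1 ≤ r) {k : ℕ} (hk : 1 ≤ k) {v : symMat (Fin r ⊕ Fin r) K}
    {hv : v ≠ 0} : Projectivization.mk K v hv ∈ O r K k ↔
      ∃ M ∈ Matrix.symplecticGroup (Fin r) K, ∃ c : K, c ≠ 0 ∧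
        v.1 = c • (M * (stdMat r K k).1 * Mᵀ) := by
  rw [← mk_mem_orbit_iff (hv := hv) (hw := stdMat_ne_zero hr hk)]
  exact ⟨fun ⟨_, h⟩ => h, fun h => ⟨_, h⟩⟩

theorem idMat_eq_stdMat : idMat r K = stdMat r K (2 * r) := Subtype.ext (stdMat_two_mul r K).symm

theorem X_eq_Y : X r K = Y r K (2 * r) := by
  rw [X, Y, O, idMat_eq_stdMat]

theorem isUnit_det_of_mem_symplecticGroup {M : Matrix (Fin r ⊕ Fin r) (Fin r ⊕ Fin r) K}
    (hM : M ∈ Matrix.symplecticGroup (Fin r) K) : IsUnit M.det :=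
  SymplecticGroup.symplectic_det hM

theorem mul_mul_transpose_omega {M A : Matrix (Fin r ⊕ Fin r) (Fin r ⊕ Fin r) K}
    (hM : M ∈ Matrix.symplecticGroup (Fin r) K) :
    (M * A * Mᵀ) * Omega r K * (M * A * Mᵀ) = M * (A * Omega r K * A) * Mᵀ := by
  have h1 := mem_symplecticGroup_iff.1 hM
  calc (M * A * Mᵀ) * Omega r K * (M * A * Mᵀ)
      = M * A * (Mᵀ * Omega r K * M) * A * Mᵀ := by simp only [Matrix.mul_assoc]
    _ = _ := by rw [h1]; simp only [Matrix.mul_assoc]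

theorem smul_mul_omega (c : K) (A : Matrix (Fin r ⊕ Fin r) (Fin r ⊕ Fin r) K) :
    (c • A) * Omega r K * (c • A) = (c * c) • (A * Omega r K * A) := by
  rw [Matrix.smul_mul, Matrix.smul_mul, Matrix.mul_smul, smul_smul]

theorem rank_smul_symplectic {M A : Matrix (Fin r ⊕ Fin r) (Fin r ⊕ Fin r) K}
    (hM : M ∈ Matrix.symplecticGroup (Fin r) K) {c : K} (hc : c ≠ 0) :
    (c • (M * A * Mᵀ)).rank = A.rank := by
  have h1 := isUnit_det_of_mem_symplecticGroup hM
  rw [Matrix.rank_smul_of_mem_nonZeroDivisors _ (mem_nonZeroDivisors_of_ne_zero hc),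
    Matrix.rank_mul_eq_left_of_isUnit_det _ _ (by rwa [Matrix.det_transpose]),
    Matrix.rank_mul_eq_right_of_isUnit_det _ _ h1]

theorem diagonal_omega_diagonal (d : Fin r ⊕ Fin r → K) (c : K)
    (hd : ∀ i, d (Sum.inl i) * d (Sum.inr i) = c) :
    Matrix.diagonal d * Omega r K * Matrix.diagonal d = c • Omega r K := by
  ext a b
  rw [Matrix.mul_diagonal, Matrix.diagonal_mul, Matrix.smul_apply, smul_eq_mul]
  rcases a with i | i <;> rcases b with j | j
  · simp [Omega]
  · rcases eq_or_ne i j with rfl | hij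
    · rw [← hd i]
      simp [Omega]
    · simp [Omega, hij]
  · rcases eq_or_ne i j with rfl | hij
    · rw [← hd i]
      simp [Omega, mul_comm]
    · simp [Omega, hij]
  · simp [Omega]

theorem card_pos_lt {k : ℕ} (hk : k ≤ r) :
    Fintype.card {a : Fin r ⊕ Fin r // pos a < k} = k := by
  rw [Fintype.card_subtype, Finset.card_filter, Fintype.sum_sum_type]
  have h2 : ∀ i : Fin r, ¬ (r + (i : ℕ) < k) := fun i => by omega
  simp only [pos, Sum.elim_inl, Sum.elim_inr, h2, if_false, Finset.sum_const_zero, add_zero]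
  obtain ⟨m, rfl⟩ := Nat.exists_eq_add_of_le hk
  rw [Fin.sum_univ_add]
  simp

theorem rank_diagonal_of_support {k : ℕ} (hk : k ≤ r) {d : Fin r ⊕ Fin r → K}
    (hd : ∀ a, d a ≠ 0 ↔ pos a < k) : (Matrix.diagonal d).rank = k := by
  classical
  rw [Matrix.rank_diagonal, ← card_pos_lt hk]
  exact Fintype.card_congr (Equiv.subtypeEquivRight hd)

theorem diagonal_isotropic {k : ℕ} (hk : k ≤ r) {d : Fin r ⊕ Fin r → K}
    (hd : ∀ a, d a ≠ 0 → pos a < k) :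
    Matrix.diagonal d * Omega r K * Matrix.diagonal d = 0 := by
  rw [diagonal_omega_diagonal d 0, zero_smul]
  intro i
  by_contra h
  have := hd _ (right_ne_zero_of_mul h)
  simp only [pos, Sum.elim_inr] at this
  omega

/-- The small orbits are distinguished by the rank. -/
theorem mk_mem_O_iff_rank [CharZero K] [IsAlgClosed K] (hr : 1 ≤ r) {k : ℕ} (hk : 1 ≤ k)
    (hkr : k ≤ r) {v : symMat (Fin r ⊕ Fin r) K} {hv : v ≠ 0} :
    Projectivization.mk K v hv ∈ O r K k ↔ v.1 * Omega r K * v.1 = 0 ∧ v.1.rank = k := by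
  rw [mk_mem_O_iff hr hk]
  constructor
  · rintro ⟨M, hM, c, hc, h⟩
    rw [h]
    refine ⟨?_, ?_⟩
    · rw [smul_mul_omega, mul_mul_transpose_omega hM, stdMat,
        diagonal_isotropic hkr (fun a ha => by by_contra h'; simp [h'] at ha), Matrix.mul_zero,
        Matrix.zero_mul, smul_zero]
    · rw [rank_smul_symplectic hM hc]
      exact rank_diagonal_of_support hkr (fun a => by simp)
  · rintro ⟨h1, h2⟩
    obtain ⟨M, hM, h⟩ := exists_symplectic_eq_stdMat (mem_symMat.1 v.2) h1 h2
    exact ⟨M, hM, 1, one_ne_zero, by rw [one_smul, ← h]⟩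

/-- The orbit of the identity is distinguished by `Z Ω Z` being a nonzero multiple of `Ω`. -/
theorem mk_mem_O_two_mul_iff [CharZero K] [IsAlgClosed K] (hr : 1 ≤ r)
    {v : symMat (Fin r ⊕ Fin r) K} {hv : v ≠ 0} :
    Projectivization.mk K v hv ∈ O r K (2 * r) ↔
      ∃ c : K, c ≠ 0 ∧ v.1 * Omega r K * v.1 = c • Omega r K := by
  rw [mk_mem_O_iff hr (by omega), stdMat_two_mul]
  constructor
  · rintro ⟨M, hM, c, hc, h⟩
    refine ⟨c * c, mul_ne_zero hc hc, ?_⟩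
    rw [h, smul_mul_omega, mul_mul_transpose_omega hM, Matrix.one_mul, Matrix.mul_one,
      symplectic_mul_omega_mul_transpose hM]
  · rintro ⟨c, hc, h⟩
    obtain ⟨M, hM, ν, hν, h1⟩ := exists_symplectic_eq_smul_one (mem_symMat.1 v.2) hc h
    exact ⟨M, hM, ν, hν, by rw [Matrix.mul_one, h1]⟩

/-- The limit of a quadratic curve `A + t B + t² C`. -/
theorem mk_mem_closure_of_quadratic_curve [Infinite K] {n : Type*} {W : Set (PSym n K)}
    (A B C : symMat n K) (hA : A ≠ 0)
    (h : ∀ t : K, t ≠ 0 → ∃ h : A + t • B + (t * t) • C ≠ 0,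
      Projectivization.mk K (A + t • B + (t * t) • C) h ∈ W) :
    Projectivization.mk K A hA ∈ closure W := by
  have h0 : A + (0 : K) • B + ((0 : K) * 0) • C = A := by simp
  have key := mk_mem_closure_of_curve (W := W) (fun t : K => A + t • B + (t * t) • C)
    (fun s => Polynomial.C (coord A s) + Polynomial.X * Polynomial.C (coord B s) +
      Polynomial.X * Polynomial.X * Polynomial.C (coord C s))
    (fun t s => by
      induction s with
      | _ a b => simp [coord_mk, mul_comm t]) h (by rwa [h0])
  simpa only [h0] using key

theorem eval_N (v : symMat (Fin r ⊕ Fin r) K) (a b : Fin r ⊕ Fin r) :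
    eval (coord v) (N r K a b) = (v.1 * Omega r K * v.1) a b := by
  have h1 : (N r K).map (eval (coord v)) = v.1 * Omega r K * v.1 := by
    rw [N, Matrix.map_mul, Matrix.map_mul, Matrix.transpose_map]
    have h2 : (genMat r K).map (eval (coord v)) = v.1 := eval_genMat v
    have h3 : (Omega r (MvPolynomial (Sym2 (Fin r ⊕ Fin r)) K)).map (eval (coord v)) =
        Omega r K := by
      ext a b
      rcases a with i | i <;> rcases b with j | j <;>
        simp [Omega, Matrix.one_apply, apply_ite (eval (coord v))]
    rw [h2, h3, mem_symMat.1 v.2]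
  rw [← h1, Matrix.map_apply]

theorem mul_omega_mul_transpose {Z : Matrix (Fin r ⊕ Fin r) (Fin r ⊕ Fin r) K} (hZ : Zᵀ = Z) :
    (Z * Omega r K * Z)ᵀ = -(Z * Omega r K * Z) := by
  rw [Matrix.transpose_mul, Matrix.transpose_mul, hZ, omega_transpose, Matrix.neg_mul,
    Matrix.mul_neg, Matrix.mul_assoc]

/-- For `k ≤ r` the orbit closure `Y_k` consists of the isotropic matrices of rank at most `k`. -/
theorem mk_mem_Y_iff [CharZero K] [IsAlgClosed K] (hr : 1 ≤ r) {k : ℕ} (hk : 1 ≤ k)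
    (hkr : k ≤ r) {v : symMat (Fin r ⊕ Fin r) K} {hv : v ≠ 0} :
    Projectivization.mk K v hv ∈ Y r K k ↔ v.1 * Omega r K * v.1 = 0 ∧ v.1.rank ≤ k := by
  constructor
  · intro h
    refine ⟨Matrix.ext fun a b => ?_, rank_le_of_mem_closure (fun w hw hm =>
      ((mk_mem_O_iff_rank hr hk hkr).1 hm).2.le) h⟩
    rw [← eval_N]
    refine mk_mem_closure_iff.1 h _ fun w hw hm => ?_
    rw [eval_N, ((mk_mem_O_iff_rank hr hk hkr).1 hm).1, Matrix.zero_apply]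
  · rintro ⟨h1, h2⟩
    obtain ⟨M, hM, h⟩ := exists_symplectic_eq_stdMat (mem_symMat.1 v.2) h1 rfl
    set j := v.1.rank
    let d : Fin r ⊕ Fin r → K := fun a => if pos a < j then 0 else if pos a < k then 1 else 0
    let B : symMat (Fin r ⊕ Fin r) K := ⟨M * Matrix.diagonal d * Mᵀ, mem_symMat.2 (by
      rw [Matrix.transpose_mul, Matrix.transpose_mul, Matrix.transpose_transpose,
        Matrix.diagonal_transpose, Matrix.mul_assoc])⟩
    refine mk_mem_closure_of_quadratic_curve v B 0 hv fun t ht => ?_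
    let D : Fin r ⊕ Fin r → K := fun a => if pos a < j then 1 else if pos a < k then t else 0
    have hcurve : (v + t • B + (t * t) • (0 : symMat (Fin r ⊕ Fin r) K)).1 =
        M * Matrix.diagonal D * Mᵀ := by
      have hD : Matrix.diagonal D = (stdMat r K j).1 + t • Matrix.diagonal d := by
        rw [stdMat, ← Matrix.diagonal_smul, Matrix.diagonal_add]
        congr 1
        funext a
        simp only [D, d, Pi.smul_apply, smul_eq_mul]
        split_ifs <;> simp
      rw [hD, Matrix.mul_add, Matrix.add_mul, ← h, Matrix.mul_smul, Matrix.smul_mul]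
      simp [B]
    have hDk : ∀ a, D a ≠ 0 ↔ pos a < k := by
      intro a
      simp only [D]
      split_ifs with h3 h4
      · simp only [ne_eq, one_ne_zero, not_false_eq_true, true_iff]
        omega
      · simp [ht, h4]
      · simp [h4]
    have hrk : (v + t • B + (t * t) • (0 : symMat (Fin r ⊕ Fin r) K)).1.rank = k := by
      rw [hcurve, ← one_smul K (M * _ * _), rank_smul_symplectic hM one_ne_zero,
        rank_diagonal_of_support hkr hDk]
    have hne : v + t • B + (t * t) • (0 : symMat (Fin r ⊕ Fin r) K) ≠ 0 := by
      intro h0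
      rw [h0, Submodule.coe_zero, Matrix.rank_zero] at hrk
      omega
    refine ⟨hne, (mk_mem_O_iff_rank hr hk hkr).2 ⟨?_, hrk⟩⟩
    rw [hcurve, mul_mul_transpose_omega hM, diagonal_isotropic hkr fun a => (hDk a).1,
      Matrix.mul_zero, Matrix.zero_mul]

theorem pos_injective : Function.Injective (pos : Fin r ⊕ Fin r → ℕ) := by
  rintro (i | i) (j | j) h <;> simp only [pos, Sum.elim_inl, Sum.elim_inr] at h
  · rw [Fin.ext h]
  · omega
  · omega
  · rw [Fin.ext (by omega : (i : ℕ) = j)]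

theorem isHomogeneous_N (a b : Fin r ⊕ Fin r) : (N r K a b).IsHomogeneous 2 := by
  have h1 : N r K a b = ∑ c, (∑ d, genMat r K d a *
      Omega r (MvPolynomial (Sym2 (Fin r ⊕ Fin r)) K) d c) * genMat r K c b := rfl
  rw [h1]
  refine IsHomogeneous.sum _ _ _ fun c _ => ?_
  refine IsHomogeneous.mul (m := 1) (n := 1) (IsHomogeneous.sum _ _ _ fun d _ => ?_)
    (isHomogeneous_X _ _)
  refine IsHomogeneous.mul (m := 1) (n := 0) (isHomogeneous_X _ _) ?_
  rcases d with i | i <;> rcases c with j | j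
  · exact isHomogeneous_zero _ _ _
  · by_cases h : i = j
    · subst h
      simpa [Omega] using isHomogeneous_one _ _
    · simpa [Omega, h] using isHomogeneous_zero _ _ _
  · by_cases h : i = j
    · subst h
      simpa [Omega] using (isHomogeneous_one _ _).neg
    · simpa [Omega, h] using isHomogeneous_zero _ _ _
  · exact isHomogeneous_zero _ _ _

theorem isHomogeneous_of_mem_quadrics {f : MvPolynomial (Sym2 (Fin r ⊕ Fin r)) K}
    (hf : f ∈ quadrics r K) : f.IsHomogeneous 2 := by
  rcases hf with ⟨l, l', -, rfl⟩ | ⟨a, b, -, -, rfl⟩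
  · exact (isHomogeneous_N _ _).sub (isHomogeneous_N _ _)
  · exact isHomogeneous_N _ _

/-- The quadrics cut out the matrices with `Z Ω Z` proportional to `Ω`. -/
theorem mk_mem_zeroLocus_quadrics_iff [CharZero K] (hr : 1 ≤ r) {v : symMat (Fin r ⊕ Fin r) K}
    {hv : v ≠ 0} : Projectivization.mk K v hv ∈ zeroLocus (quadrics r K) ↔
      ∃ c : K, v.1 * Omega r K * v.1 = c • Omega r K := by
  rw [mk_mem_zeroLocus fun f hf => ⟨2, isHomogeneous_of_mem_quadrics hf⟩]
  constructor
  · intro h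
    set A := v.1 * Omega r K * v.1 with hA
    have hskew : ∀ a b, A a b = -A b a := fun a b =>
      congrFun (congrFun (mul_omega_mul_transpose (mem_symMat.1 v.2)) b) a
    have h0 : ∀ a b : Fin r ⊕ Fin r, pos a < pos b → pos b ≠ r + pos a → A a b = 0 := by
      intro a b h1 h2
      rw [hA, ← eval_N]
      exact h _ (Or.inr ⟨a, b, h1, h2, rfl⟩)
    have h0' : ∀ a b : Fin r ⊕ Fin r, pos a ≠ r + pos b → pos b ≠ r + pos a → A a b = 0 := by
      intro a b h1 h2
      rcases lt_trichotomy (pos a) (pos b) with h3 | h3 | h3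
      · exact h0 a b h3 h2
      · rw [pos_injective h3]
        exact self_eq_neg.1 (hskew b b)
      · rw [hskew, h0 b a h3 h1, neg_zero]
    have hstep : ∀ m (hm : m < r), A (Sum.inl ⟨m, hm⟩) (Sum.inr ⟨m, hm⟩) =
        A (Sum.inl ⟨0, hr⟩) (Sum.inr ⟨0, hr⟩) := by
      intro m
      induction m with
      | zero => intro _; rfl
      | succ m ih =>
        intro hm
        rw [← ih (by omega)]
        have := h _ (Or.inl ⟨⟨m, by omega⟩, ⟨m + 1, hm⟩, rfl, rfl⟩)
        rw [map_sub, eval_N, eval_N, sub_eq_zero] at this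
        exact this.symm
    refine ⟨A (Sum.inl ⟨0, hr⟩) (Sum.inr ⟨0, hr⟩), Matrix.ext fun a b => ?_⟩
    rw [Matrix.smul_apply, smul_eq_mul]
    rcases a with i | i <;> rcases b with j | j
    · rw [h0']
      · simp [Omega]
      · simp only [pos, Sum.elim_inl]; omega
      · simp only [pos, Sum.elim_inl]; omega
    · rcases eq_or_ne i j with rfl | hij
      · rw [hstep i i.2]
        simp [Omega]
      · have hij' : (i : ℕ) ≠ j := fun h => hij (Fin.ext h)
        rw [h0']
        · simp [Omega, hij]
        · simp only [pos, Sum.elim_inl, Sum.elim_inr]; omega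
        · simp only [pos, Sum.elim_inl, Sum.elim_inr]; omega
    · rcases eq_or_ne i j with rfl | hij
      · rw [hskew, hstep i i.2]
        simp [Omega]
      · have hij' : (i : ℕ) ≠ j := fun h => hij (Fin.ext h)
        rw [h0']
        · simp [Omega, hij]
        · simp only [pos, Sum.elim_inl, Sum.elim_inr]; omega
        · simp only [pos, Sum.elim_inl, Sum.elim_inr]; omega
    · rw [h0']
      · simp [Omega]
      · simp only [pos, Sum.elim_inr]; omega
      · simp only [pos, Sum.elim_inr]; omega
  · rintro ⟨c, hc⟩ f hf
    rcases hf with ⟨l, l', -, rfl⟩ | ⟨a, b, h1, h2, rfl⟩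
    · rw [map_sub, eval_N, eval_N, hc]
      simp [Omega]
    · rw [eval_N, hc, Matrix.smul_apply]
      rcases a with i | i <;> rcases b with j | j
      · simp [Omega]
      · have hij : i ≠ j := by
          rintro rfl
          simp [pos] at h2
        simp [Omega, hij]
      · simp only [pos, Sum.elim_inl, Sum.elim_inr] at h1
        omega
      · simp [Omega]

/-- Every isotropic symmetric matrix is a limit of multiples of symplectic ones, along the curve
`diag(1, …, 1, t, …, t; t², …, t², t, …, t)`. -/
theorem mem_X_of_isotropic [CharZero K] [IsAlgClosed K] (hr : 1 ≤ r)
    {v : symMat (Fin r ⊕ Fin r) K} {hv : v ≠ 0} (h1 : v.1 * Omega r K * v.1 = 0) :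
    Projectivization.mk K v hv ∈ Y r K (2 * r) := by
  obtain ⟨M, hM, h⟩ := exists_symplectic_eq_stdMat (mem_symMat.1 v.2) h1 rfl
  have hkr := rank_le_of_mul_omega_mul_eq_zero h1
  set k := v.1.rank
  let T : (Fin r ⊕ Fin r → K) → symMat (Fin r ⊕ Fin r) K := fun d =>
    ⟨M * Matrix.diagonal d * Mᵀ, mem_symMat.2 (by
      rw [Matrix.transpose_mul, Matrix.transpose_mul, Matrix.transpose_transpose,
        Matrix.diagonal_transpose, Matrix.mul_assoc])⟩
  let dB : Fin r ⊕ Fin r → K := Sum.elim (fun i => if (i : ℕ) < k then 0 else 1)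
    (fun i => if (i : ℕ) < k then 0 else 1)
  let dC : Fin r ⊕ Fin r → K := Sum.elim (fun i => 0) (fun i => if (i : ℕ) < k then 1 else 0)
  refine mk_mem_closure_of_quadratic_curve v (T dB) (T dC) hv fun t ht => ?_
  let D : Fin r ⊕ Fin r → K := Sum.elim (fun i => if (i : ℕ) < k then 1 else t)
    (fun i => if (i : ℕ) < k then t * t else t)
  have hcurve : (v + t • T dB + (t * t) • T dC).1 = M * Matrix.diagonal D * Mᵀ := by
    have hD : Matrix.diagonal D = (stdMat r K k).1 + t • Matrix.diagonal dB +
        (t * t) • Matrix.diagonal dC := by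
      rw [stdMat_eq_diagonal, ← Matrix.diagonal_smul, ← Matrix.diagonal_smul, Matrix.diagonal_add,
        Matrix.diagonal_add]
      congr 1
      funext a
      rcases a with i | i
      · simp only [D, dB, dC, Pi.smul_apply, smul_eq_mul, Sum.elim_inl]
        split_ifs <;> simp
      · have h2 : ¬ (r + (i : ℕ) < k) := by omega
        simp only [D, dB, dC, Pi.smul_apply, smul_eq_mul, Sum.elim_inr, if_neg h2]
        split_ifs <;> simp
    rw [hD, Matrix.mul_add, Matrix.add_mul, Matrix.mul_add, Matrix.add_mul, ← h, Matrix.mul_smul,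
      Matrix.smul_mul, Matrix.mul_smul, Matrix.smul_mul]
    rfl
  have hΩ : (v + t • T dB + (t * t) • T dC).1 * Omega r K * (v + t • T dB + (t * t) • T dC).1 =
      (t * t) • Omega r K := by
    rw [hcurve, mul_mul_transpose_omega hM, diagonal_omega_diagonal D (t * t), Matrix.mul_smul,
      Matrix.smul_mul, symplectic_mul_omega_mul_transpose hM]
    intro i
    simp only [D, Sum.elim_inl, Sum.elim_inr]
    split_ifs <;> ring
  have hne : v + t • T dB + (t * t) • T dC ≠ 0 := by
    intro h0
    rw [h0] at hΩ
    have h2 := congrFun (congrFun hΩ (Sum.inl ⟨0, hr⟩)) (Sum.inr ⟨0, hr⟩)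
    simp [Omega, ht] at h2
  exact ⟨hne, (mk_mem_O_two_mul_iff hr).2 ⟨t * t, mul_ne_zero ht ht, hΩ⟩⟩

theorem zeroLocus_quadrics_eq_X [CharZero K] [IsAlgClosed K] (hr : 1 ≤ r) :
    zeroLocus (quadrics r K) = X r K := by
  rw [X_eq_Y]
  refine Set.Subset.antisymm ?_ ?_
  · intro p hp
    induction p using Projectivization.ind with
    | h v hv =>
      obtain ⟨c, hc⟩ := (mk_mem_zeroLocus_quadrics_iff hr).1 hp
      rcases eq_or_ne c 0 with rfl | hc0
      · exact mem_X_of_isotropic hr (by rw [hc, zero_smul])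
      · exact subset_closure ((mk_mem_O_two_mul_iff hr).2 ⟨c, hc0, hc⟩)
  · refine closure_minimal ?_
      (isClosed_iff.2 ⟨_, fun f hf => ⟨2, isHomogeneous_of_mem_quadrics hf⟩, rfl⟩)
    intro p hp
    induction p using Projectivization.ind with
    | h v hv =>
      obtain ⟨c, -, hc⟩ := (mk_mem_O_two_mul_iff hr).1 hp
      exact (mk_mem_zeroLocus_quadrics_iff hr).2 ⟨c, hc⟩

theorem mk_mem_X_iff [CharZero K] [IsAlgClosed K] (hr : 1 ≤ r) {v : symMat (Fin r ⊕ Fin r) K}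
    {hv : v ≠ 0} : Projectivization.mk K v hv ∈ X r K ↔
      ∃ c : K, v.1 * Omega r K * v.1 = c • Omega r K := by
  rw [← zeroLocus_quadrics_eq_X hr, mk_mem_zeroLocus_quadrics_iff hr]

end Orbits

/-! ### Secant varieties of the Veronese variety and the stratification -/

section Secants

variable {n K : Type*} [Field K]

/-- The symmetric matrix `x xᵗ`. -/
def square (x : n → K) : symMat n K :=
  ⟨Matrix.vecMulVec x x, mem_symMat.2 (Matrix.transpose_vecMulVec x x)⟩

theorem square_ne_zero {x : n → K} (hx : x ≠ 0) : square x ≠ 0 := by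
  intro h
  apply hx
  funext i
  have h1 := congrFun (congrFun (congrArg Subtype.val h) i) i
  simpa [square, Matrix.vecMulVec_apply] using h1

theorem mem_veroneseVariety_iff {p : PSym n K} : p ∈ veroneseVariety n K ↔
    ∃ (x : n → K) (hx : x ≠ 0), Projectivization.mk K (square x) (square_ne_zero hx) = p := by
  constructor
  · rintro ⟨q, rfl⟩
    induction q using Projectivization.ind with
    | h x hx => exact ⟨x, hx, rfl⟩
  · rintro ⟨x, hx, rfl⟩
    exact ⟨Projectivization.mk K x hx, rfl⟩

theorem rank_le_of_mem_secant_plane [Fintype n] {h : ℕ} (x : Fin h → PSym n K)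
    (hx : ∀ i, x i ∈ veroneseVariety n K) {v : symMat n K}
    (hv : v ∈ ⨆ i, (x i).submodule) : v.1.rank ≤ h := by
  choose y hy hxy using fun i => mem_veroneseVariety_iff.1 (hx i)
  let W : Submodule K (n → K) := Submodule.span K (Set.range y)
  -- the matrices whose column space is contained in the span of the `y i`
  let S : Submodule K (symMat n K) :=
    { carrier := {Z | ∀ z, Z.1 *ᵥ z ∈ W}
      add_mem' := fun {A B} hA hB z => by
        rw [Submodule.coe_add, Matrix.add_mulVec]
        exact W.add_mem (hA z) (hB z)
      zero_mem' := fun z => by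
        rw [Submodule.coe_zero, Matrix.zero_mulVec]
        exact W.zero_mem
      smul_mem' := fun c A hA z => by
        rw [Submodule.coe_smul, Matrix.smul_mulVec]
        exact W.smul_mem c (hA z) }
  have hS : v ∈ S := by
    refine (iSup_le fun i => ?_ : ⨆ i, (x i).submodule ≤ S) hv
    rw [← hxy, Projectivization.submodule_mk, Submodule.span_singleton_le_iff_mem]
    intro z
    change Matrix.vecMulVec (y i) (y i) *ᵥ z ∈ W
    rw [Matrix.vecMulVec_mulVec, op_smul_eq_smul]
    exact W.smul_mem _ (Submodule.subset_span ⟨i, rfl⟩)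
  have h1 : LinearMap.range v.1.mulVecLin ≤ W := by
    rintro _ ⟨z, rfl⟩
    exact hS z
  calc v.1.rank ≤ Module.finrank K W := Submodule.finrank_mono h1
    _ ≤ Fintype.card (Fin h) := finrank_range_le_card y
    _ = h := Fintype.card_fin h

variable {r : ℕ}

theorem rank_le_of_mem_secantVariety [Infinite K] {h : ℕ} {v : symMat (Fin r ⊕ Fin r) K}
    {hv : v ≠ 0} (hm : Projectivization.mk K v hv ∈
      secantVariety h (veroneseVariety (Fin r ⊕ Fin r) K)) : v.1.rank ≤ h := by
  refine rank_le_of_mem_closure (fun w hw hm => ?_) hm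
  obtain ⟨x, hx, -, hw'⟩ := hm
  refine rank_le_of_mem_secant_plane x hx (hw' ?_)
  rw [Projectivization.submodule_mk]
  exact Submodule.mem_span_singleton_self w

/-- A matrix `c M I_k Mᵗ` is a combination of the squares of the first `k` columns of `M`. -/
theorem O_subset_secantVariety (hr : 1 ≤ r) {k : ℕ} (hk : 1 ≤ k) (hkr : k ≤ r) :
    O r K k ⊆ secantVariety k (veroneseVariety (Fin r ⊕ Fin r) K) := by
  intro p hp
  induction p using Projectivization.ind with
  | h v hv =>
    obtain ⟨M, hM, c, hc, h⟩ := (mk_mem_O_iff hr hk).1 hp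
    obtain ⟨L, -, hLM, -⟩ := exists_symplectic_inverse hM
    let y : Fin k → Fin r ⊕ Fin r → K := fun i => M.col (Sum.inl (Fin.castLE hkr i))
    have hL : ∀ i, L *ᵥ y i = Pi.single (Sum.inl (Fin.castLE hkr i)) 1 := by
      intro i
      funext a
      have h1 := congrFun (congrFun hLM a) (Sum.inl (Fin.castLE hkr i))
      rw [Matrix.one_apply] at h1
      rw [Pi.single_apply, ← h1]
      rfl
    have hy : ∀ i, y i ≠ 0 := by
      intro i h0
      have h1 := congrFun (hL i) (Sum.inl (Fin.castLE hkr i))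
      rw [h0, Matrix.mulVec_zero, Pi.zero_apply, Pi.single_eq_same] at h1
      exact one_ne_zero h1.symm
    have hli : LinearIndependent K fun i => square (y i) := by
      rw [Fintype.linearIndependent_iff]
      intro g hg i
      -- apply the quadratic form dual to the `i`-th vector
      have h1 := congrArg (fun Z : symMat (Fin r ⊕ Fin r) K =>
        (L * Z.1 * Lᵀ) (Sum.inl (Fin.castLE hkr i)) (Sum.inl (Fin.castLE hkr i))) hg
      have h2 : ∀ j, L * (square (y j)).1 * Lᵀ =
          Matrix.vecMulVec (Pi.single (Sum.inl (Fin.castLE hkr j)) 1)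
            (Pi.single (Sum.inl (Fin.castLE hkr j)) 1) := by
        intro j
        rw [square, Matrix.mul_vecMulVec, Matrix.vecMulVec_mul, Matrix.vecMul_transpose, hL]
      simp only [Submodule.coe_sum, Submodule.coe_smul, Submodule.coe_zero, Matrix.mul_zero,
        Matrix.zero_mul, Matrix.zero_apply, Matrix.mul_sum, Matrix.sum_mul, Matrix.sum_apply,
        Matrix.mul_smul, Matrix.smul_mul, Matrix.smul_apply, h2, Matrix.vecMulVec_apply,
        smul_eq_mul] at h1
      rw [Finset.sum_eq_single i] at h1
      · simpa using h1
      · intro j _ hji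
        rw [Pi.single_eq_of_ne, mul_zero, mul_zero]
        intro h3
        exact hji (Fin.castLE_injective hkr (Sum.inl_injective h3)).symm
      · intro h3
        exact absurd (Finset.mem_univ i) h3
    refine subset_closure ⟨fun i => Projectivization.mk K (square (y i)) (square_ne_zero (hy i)),
      fun i => mem_veroneseVariety_iff.2 ⟨y i, hy i, rfl⟩, .mk _ _ hli, ?_⟩
    have hsum : v = ∑ i, c • square (y i) := by
      refine Subtype.ext (Matrix.ext fun a b => ?_)
      rw [h, Matrix.smul_apply, mul_stdMat_mul_transpose_apply hkr, Submodule.coe_sum,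
        Matrix.sum_apply, Finset.smul_sum]
      rfl
    rw [Projectivization.submodule_mk, Submodule.span_singleton_le_iff_mem, hsum]
    refine Submodule.sum_mem _ fun i _ => Submodule.smul_mem _ c ?_
    refine Submodule.mem_iSup_of_mem i ?_
    rw [Projectivization.submodule_mk]
    exact Submodule.mem_span_singleton_self _

theorem rank_eq_of_mul_omega_mul {Z : Matrix (Fin r ⊕ Fin r) (Fin r ⊕ Fin r) K} {c : K}
    (hc : c ≠ 0) (h : Z * Omega r K * Z = c • Omega r K) : Z.rank = 2 * r := by
  have h1 : Z * (Omega r K * Z * (-(c⁻¹) • Omega r K)) = 1 := by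
    rw [Matrix.mul_smul, Matrix.mul_smul, ← Matrix.mul_assoc, ← Matrix.mul_assoc, h,
      Matrix.smul_mul, omega_mul_omega, smul_smul, neg_mul, inv_mul_cancel₀ hc, neg_smul,
      one_smul, neg_neg]
  rw [Matrix.rank_of_isUnit Z (IsUnit.of_mul_eq_one _ h1)]
  simp [two_mul]

theorem O_nonempty (hr : 1 ≤ r) {k : ℕ} (hk : 1 ≤ k) : (O r K k).Nonempty :=
  ⟨_, stdMat_ne_zero hr hk, MulAction.mem_orbit_self _⟩

end Secants

section Stratification

variable {r : ℕ} {K : Type*} [Field K] [CharZero K] [IsAlgClosed K]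

/-- For `k ≤ r` the bound on the rank excludes the points of `X_{2r}` with `Z Ω Z ≠ 0`, which have
rank `2r`. -/
theorem Y_eq_secantVariety_inter_X (hr : 1 ≤ r) {k : ℕ} (hk : 1 ≤ k) (hkr : k ≤ r) :
    Y r K k = secantVariety k (veroneseVariety (Fin r ⊕ Fin r) K) ∩ X r K := by
  refine Set.Subset.antisymm ?_ ?_
  · refine Set.subset_inter (closure_minimal (O_subset_secantVariety hr hk hkr) isClosed_closure) ?_
    intro p hp
    induction p using Projectivization.ind with
    | h v hv => exact (mk_mem_X_iff hr).2 ⟨0, by rw [zero_smul, ((mk_mem_Y_iff hr hk hkr).1 hp).1]⟩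
  · rintro p ⟨hp1, hp2⟩
    induction p using Projectivization.ind with
    | h v hv =>
      have h1 := rank_le_of_mem_secantVariety hp1
      obtain ⟨c, hc⟩ := (mk_mem_X_iff hr).1 hp2
      rcases eq_or_ne c 0 with rfl | hc0
      · exact (mk_mem_Y_iff hr hk hkr).2 ⟨by rw [hc, zero_smul], h1⟩
      · rw [rank_eq_of_mul_omega_mul hc0 hc] at h1
        omega

theorem Y_ssubset_Y_succ (hr : 1 ≤ r) {k : ℕ} (hk : 1 ≤ k) (hkr : k < r) :
    Y r K k ⊂ Y r K (k + 1) := by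
  refine Set.ssubset_iff_exists.2 ⟨?_, ?_⟩
  · intro p hp
    induction p using Projectivization.ind with
    | h v hv =>
      obtain ⟨h1, h2⟩ := (mk_mem_Y_iff hr hk hkr.le).1 hp
      exact (mk_mem_Y_iff hr (by omega) hkr).2 ⟨h1, by omega⟩
  · obtain ⟨p, hp⟩ := O_nonempty (K := K) hr (k := k + 1) (by omega)
    refine ⟨p, subset_closure hp, fun hp' => ?_⟩
    induction p using Projectivization.ind with
    | h v hv =>
      have h1 := ((mk_mem_O_iff_rank hr (by omega) hkr).1 hp).2
      have h2 := ((mk_mem_Y_iff hr hk hkr.le).1 hp').2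
      omega

theorem Y_sdiff_Y_pred (hr : 1 ≤ r) {k : ℕ} (hk : 1 ≤ k) (hkr : k ≤ r) :
    Y r K k \ Y r K (k - 1) = O r K k := by
  ext p
  induction p using Projectivization.ind with
  | h v hv =>
    rw [Set.mem_sdiff, mk_mem_Y_iff hr hk hkr, mk_mem_O_iff_rank hr hk hkr]
    obtain ⟨k, rfl⟩ : ∃ j, k = j + 1 := ⟨k - 1, by omega⟩
    rw [Nat.add_sub_cancel]
    rcases Nat.eq_zero_or_pos k with rfl | hk0
    · have h0 : Y r K 0 = ∅ := by
        have h1 : O r K 0 = ∅ := by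
          refine Set.eq_empty_of_forall_notMem fun p hp => ?_
          obtain ⟨h, -⟩ := hp
          refine h (Subtype.ext ?_)
          rw [stdMat_eq_diagonal]
          ext a b
          rcases a with i | i <;> rcases b with j | j <;> simp [Matrix.diagonal_apply]
        rw [Y, h1, closure_empty]
      have hpos : v.1.rank ≠ 0 := by
        intro h
        obtain ⟨B, -, hB⟩ := exists_eq_mul_transpose v.1 (mem_symMat.1 v.2) h
        refine hv (Subtype.ext (Matrix.ext fun a b => ?_))
        rw [hB, Matrix.mul_apply]
        simp
      rw [h0]
      simp only [Set.mem_empty_iff_false, not_false_eq_true, and_true]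
      refine and_congr_right fun _ => ?_
      omega
    · rw [mk_mem_Y_iff hr hk0 (by omega)]
      constructor
      · rintro ⟨⟨h1, h2⟩, h3⟩
        refine ⟨h1, ?_⟩
        by_contra h4
        exact h3 ⟨h1, by omega⟩
      · rintro ⟨h1, h2⟩
        exact ⟨⟨h1, h2.le⟩, fun h3 => by omega⟩

theorem Y_ssubset_X (hr : 1 ≤ r) : Y r K r ⊂ Y r K (2 * r) := by
  refine Set.ssubset_iff_exists.2 ⟨?_, ?_⟩
  · rw [← X_eq_Y, Y_eq_secantVariety_inter_X hr hr le_rfl]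
    exact Set.inter_subset_right
  · obtain ⟨p, hp⟩ := O_nonempty (K := K) hr (k := 2 * r) (by omega)
    refine ⟨p, subset_closure hp, fun hp' => ?_⟩
    induction p using Projectivization.ind with
    | h v hv =>
      obtain ⟨c, hc, h⟩ := (mk_mem_O_two_mul_iff hr).1 hp
      have h1 := rank_eq_of_mul_omega_mul hc h
      have h2 := ((mk_mem_Y_iff hr hr le_rfl).1 hp').2
      omega

theorem X_sdiff_Y (hr : 1 ≤ r) : X r K \ Y r K r = O r K (2 * r) := by
  ext p
  induction p using Projectivization.ind with
  | h v hv =>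
    rw [Set.mem_sdiff, mk_mem_X_iff hr, mk_mem_Y_iff hr hr le_rfl, mk_mem_O_two_mul_iff hr]
    constructor
    · rintro ⟨⟨c, hc⟩, h⟩
      refine ⟨c, ?_, hc⟩
      rintro rfl
      rw [zero_smul] at hc
      exact h ⟨hc, rank_le_of_mul_omega_mul_eq_zero hc⟩
    · rintro ⟨c, hc, h⟩
      refine ⟨⟨c, h⟩, fun h1 => ?_⟩
      have h2 := rank_eq_of_mul_omega_mul hc h
      omega

end Stratification

/-! ### Irreducibility of the orbits -/

section Irreducibility

variable {r : ℕ} {K : Type*} [Field K]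

/-- Every symplectic matrix is a product of shears and a Levi factor. The first shear makes the
upper left block invertible. -/
theorem exists_shear_factorization {M : Matrix (Fin r ⊕ Fin r) (Fin r ⊕ Fin r) K}
    (hM : M ∈ Matrix.symplecticGroup (Fin r) K) :
    ∃ H T U G : Matrix (Fin r) (Fin r) K, Hᵀ = H ∧ Tᵀ = T ∧ Uᵀ = U ∧ IsUnit G.det ∧
      M = Matrix.fromBlocks 1 H 0 1 * Matrix.fromBlocks 1 0 T 1 *
        Matrix.fromBlocks G 0 0 G⁻¹ᵀ * Matrix.fromBlocks 1 U 0 1 := by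
  obtain ⟨L, hL, hLM, -⟩ := exists_symplectic_inverse hM
  obtain ⟨A, B, C, D, rfl⟩ : ∃ A B C D, M = Matrix.fromBlocks A B C D :=
    ⟨_, _, _, _, (Matrix.fromBlocks_toBlocks M).symm⟩
  obtain ⟨H, hH, hG⟩ := exists_symm_add_mul_isUnit A C
    (SymplecticGroup.fromBlocks_mem_iff.1 hM).1 (by
      intro x h1 h2
      have h3 : Matrix.fromBlocks A B C D *ᵥ Sum.elim x 0 = 0 := by
        rw [Matrix.fromBlocks_mulVec]
        simp [h1, h2]
      have h4 : Sum.elim x (0 : Fin r → K) = 0 := by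
        rw [← Matrix.one_mulVec (Sum.elim x 0), ← hLM, ← Matrix.mulVec_mulVec, h3,
          Matrix.mulVec_zero]
      funext i
      exact congrFun h4 (Sum.inl i))
  set G := A + H * C
  have hGi : G⁻¹ * G = 1 := Matrix.nonsing_inv_mul G hG
  have hGi' : G * G⁻¹ = 1 := Matrix.mul_nonsing_inv G hG
  have hGt : G⁻¹ᵀ * Gᵀ = 1 := by rw [← Matrix.transpose_mul, hGi', Matrix.transpose_one]
  have h1 : Matrix.fromBlocks 1 H 0 1 * Matrix.fromBlocks A B C D =
      Matrix.fromBlocks G (B + H * D) C D := by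
    rw [Matrix.fromBlocks_multiply]
    simp [G]
  have hM1 := mul_mem (upper_mem hH) hM
  rw [h1] at hM1
  set T := C * G⁻¹ with hTdef
  have hT : Tᵀ = T := by
    have h2 := (SymplecticGroup.fromBlocks_mem_iff.1 hM1).1
    calc Tᵀ = G⁻¹ᵀ * (Cᵀ * G) * G⁻¹ := by
          rw [hTdef, Matrix.transpose_mul, Matrix.mul_assoc, Matrix.mul_assoc, hGi', Matrix.mul_one]
      _ = T := by rw [← h2, ← Matrix.mul_assoc, hGt, Matrix.one_mul]
  set B' := B + H * D
  set D' := D - T * B' with hD'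
  have h2 : Matrix.fromBlocks 1 0 (-T) 1 * Matrix.fromBlocks G B' C D =
      Matrix.fromBlocks G B' 0 D' := by
    rw [Matrix.fromBlocks_multiply]
    simp [hD', hTdef, Matrix.mul_assoc, hGi, sub_eq_neg_add]
  have hM2 := mul_mem (lower_mem (T := -T) (by rw [Matrix.transpose_neg, hT])) hM1
  rw [h2] at hM2
  obtain ⟨-, h3, h4⟩ := SymplecticGroup.fromBlocks_mem_iff.1 hM2
  rw [Matrix.transpose_zero, Matrix.zero_mul, sub_zero] at h4
  have hD : D' = G⁻¹ᵀ := by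
    rw [← Matrix.one_mul D', ← hGt, Matrix.mul_assoc, h4, Matrix.mul_one]
  have hU : (G⁻¹ * B')ᵀ = G⁻¹ * B' := by
    rw [Matrix.transpose_mul, ← hD, h3, hD, Matrix.transpose_transpose]
  refine ⟨-H, T, G⁻¹ * B', G, by rw [Matrix.transpose_neg, hH], hT, hU, hG, ?_⟩
  have h5 : Matrix.fromBlocks G 0 0 G⁻¹ᵀ * Matrix.fromBlocks 1 (G⁻¹ * B') 0 1 =
      Matrix.fromBlocks G B' 0 D' := by
    rw [Matrix.fromBlocks_multiply, ← Matrix.mul_assoc, hGi', hD]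
    simp
  have h6 : Matrix.fromBlocks 1 (-H) 0 1 * Matrix.fromBlocks 1 H 0 1 =
      (1 : Matrix (Fin r ⊕ Fin r) (Fin r ⊕ Fin r) K) := by
    rw [Matrix.fromBlocks_multiply, ← Matrix.fromBlocks_one]
    simp
  have h7 : Matrix.fromBlocks 1 0 T 1 * Matrix.fromBlocks 1 0 (-T) 1 =
      (1 : Matrix (Fin r ⊕ Fin r) (Fin r ⊕ Fin r) K) := by
    rw [Matrix.fromBlocks_multiply, ← Matrix.fromBlocks_one]
    simp
  rw [Matrix.mul_assoc, h5, ← h2, ← h1, Matrix.mul_assoc, ← Matrix.mul_assoc _ _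
    (Matrix.fromBlocks 1 H 0 1 * _), h7, Matrix.one_mul, ← Matrix.mul_assoc, h6, Matrix.one_mul]

/-- The symmetric matrix with given entries. -/
def symmOf {ι R : Type*} (t : Sym2 ι → R) : Matrix ι ι R := Matrix.of fun i j => t s(i, j)

theorem symmOf_transpose {ι R : Type*} (t : Sym2 ι → R) : (symmOf t)ᵀ = symmOf t := by
  ext i j
  simp [symmOf, Sym2.eq_swap]

theorem symmOf_map {ι R S : Type*} (f : R → S) (t : Sym2 ι → R) :
    (symmOf t).map f = symmOf (f ∘ t) := rfl

theorem exists_symmOf_eq {ι R : Type*} {A : Matrix ι ι R} (hA : Aᵀ = A) : ∃ t, symmOf t = A :=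
  ⟨Sym2.lift ⟨A, fun i j => congrFun (congrFun hA j) i⟩, by
    ext i j
    simp [symmOf]⟩

/-- The parameters of the symplectic group: three symmetric matrices, for the shears, and an
invertible one, for the Levi factor. -/
abbrev SympParam (r : ℕ) : Type :=
  (Sym2 (Fin r) ⊕ Sym2 (Fin r) ⊕ Sym2 (Fin r)) ⊕ (Fin r × Fin r)

/-- The square matrix among the parameters. -/
def leviPart {R : Type*} (t : SympParam r → R) : Matrix (Fin r) (Fin r) R :=
  Matrix.of fun i j => t (.inr (i, j))

/-- The parametrization of the symplectic group by shears and Levi factors, cleared of the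
denominator `det G`. -/
def sympOf {R : Type*} [CommRing R] (t : SympParam r → R) :
    Matrix (Fin r ⊕ Fin r) (Fin r ⊕ Fin r) R :=
  Matrix.fromBlocks 1 (symmOf fun s => t (.inl (.inl s))) 0 1 *
    Matrix.fromBlocks 1 0 (symmOf fun s => t (.inl (.inr (.inl s)))) 1 *
    Matrix.fromBlocks ((leviPart t).det • leviPart t) 0 0 (leviPart t).adjugateᵀ *
    Matrix.fromBlocks 1 (symmOf fun s => t (.inl (.inr (.inr s)))) 0 1

theorem leviPart_map {R S : Type*} [CommRing R] [CommRing S] (f : R →+* S) (t : SympParam r → R) :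
    (leviPart t).map f = leviPart (f ∘ t) := rfl

theorem sympOf_map {R S : Type*} [CommRing R] [CommRing S] (f : R →+* S) (t : SympParam r → R) :
    (sympOf t).map f = sympOf (f ∘ t) := by
  have h1 : ((leviPart t).det • leviPart t).map f =
      (leviPart (f ∘ t)).det • leviPart (f ∘ t) := by
    rw [← leviPart_map, ← RingHom.mapMatrix_apply f (leviPart t), ← RingHom.map_det]
    ext i j
    simp
  have h2 : (leviPart t).adjugateᵀ.map f = (leviPart (f ∘ t)).adjugateᵀ := by
    rw [← leviPart_map, ← RingHom.mapMatrix_apply f (leviPart t), ← RingHom.map_adjugate]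
    rfl
  have hz : (0 : Matrix (Fin r) (Fin r) R).map f = 0 := Matrix.map_zero f (map_zero f)
  have ho : (1 : Matrix (Fin r) (Fin r) R).map f = 1 :=
    Matrix.map_one f (map_zero f) (map_one f)
  rw [sympOf, Matrix.map_mul, Matrix.map_mul, Matrix.map_mul, Matrix.fromBlocks_map,
    Matrix.fromBlocks_map, Matrix.fromBlocks_map, Matrix.fromBlocks_map, symmOf_map, symmOf_map,
    symmOf_map, h1, h2, hz, ho]
  rfl

theorem sympOf_eq_smul {t : SympParam r → K} (ht : IsUnit (leviPart t).det) :
    sympOf t = (leviPart t).det • (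
      Matrix.fromBlocks 1 (symmOf fun s => t (.inl (.inl s))) 0 1 *
      Matrix.fromBlocks 1 0 (symmOf fun s => t (.inl (.inr (.inl s)))) 1 *
      Matrix.fromBlocks (leviPart t) 0 0 (leviPart t)⁻¹ᵀ *
      Matrix.fromBlocks 1 (symmOf fun s => t (.inl (.inr (.inr s)))) 0 1) := by
  have h1 : (leviPart t).adjugateᵀ = (leviPart t).det • (leviPart t)⁻¹ᵀ := by
    rw [Matrix.inv_def, Matrix.transpose_smul, smul_smul, Ring.mul_inverse_cancel _ ht, one_smul]
  rw [sympOf, h1, ← Matrix.smul_mul, ← Matrix.mul_smul, Matrix.fromBlocks_smul, smul_zero]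

theorem levi_mem {G : Matrix (Fin r) (Fin r) K} (hG : IsUnit G.det) :
    Matrix.fromBlocks G 0 0 G⁻¹ᵀ ∈ Matrix.symplecticGroup (Fin r) K :=
  symplectic_of_fromBlocks (by simp) (by simp) (by
    rw [← Matrix.transpose_mul, Matrix.nonsing_inv_mul G hG]
    simp)

/-- A polynomial family of symmetric matrices has polynomial coordinates. An unordered pair of
indices is evaluated at a representative, because `P` is not assumed to be symmetric. -/
theorem coord_eq_eval {n σ : Type*} (ψ : (σ → K) → symMat n K) (P : Matrix n n (MvPolynomial σ K))
    (h : ∀ t, (ψ t).1 = P.map (eval t)) (t : σ → K) :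
    coord (ψ t) = fun s => eval t (P (Quot.out s).1 (Quot.out s).2) := by
  funext s
  have h1 : s = s((Quot.out s).1, (Quot.out s).2) := (Quot.out_eq s).symm
  conv_lhs => rw [h1]
  rw [coord_mk, h, Matrix.map_apply]

/-- The orbit is the image of an open subset of an affine space under `t ↦ M(t) x M(t)ᵗ`, up to
scalars, where `M(t)` is the parametrization of the symplectic group with cleared denominators. -/
theorem isIrreducible_orbit [Infinite K] (x : symMat (Fin r ⊕ Fin r) K) (hx : x ≠ 0) :
    IsIrreducible (MulAction.orbit (Matrix.symplecticGroup (Fin r) K)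
      (Projectivization.mk K x hx)) := by
  let ψ : (SympParam r → K) → symMat (Fin r ⊕ Fin r) K := fun t =>
    ⟨sympOf t * x.1 * (sympOf t)ᵀ, mem_symMat.2 (by
      rw [Matrix.transpose_mul, Matrix.transpose_mul, Matrix.transpose_transpose,
        mem_symMat.1 x.2, Matrix.mul_assoc])⟩
  let M₀ : Matrix (Fin r ⊕ Fin r) (Fin r ⊕ Fin r) (MvPolynomial (SympParam r) K) :=
    sympOf MvPolynomial.X
  have hM₀ : ∀ t : SympParam r → K, M₀.map (eval t) = sympOf t := by
    intro t
    rw [sympOf_map]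
    congr 1
    funext s
    simp
  have hP : ∀ t, (ψ t).1 = (M₀ * x.1.map C * M₀ᵀ).map (eval t) := by
    intro t
    rw [Matrix.map_mul, Matrix.map_mul, Matrix.transpose_map, hM₀, eval_C_mapMatrix]
  let h : MvPolynomial (SympParam r) K := (leviPart MvPolynomial.X).det
  have hh : ∀ t, eval t h = (leviPart t).det := by
    intro t
    rw [RingHom.map_det, RingHom.mapMatrix_apply, leviPart_map]
    congr 2
    funext s
    simp
  refine isIrreducible_of_parametrization ⟨_, MulAction.mem_orbit_self _⟩ ψ _
    (coord_eq_eval ψ _ hP) h ?_ ?_ ?_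
  · intro h0
    have h1 := hh (Sum.elim 0 fun p => (1 : Matrix (Fin r) (Fin r) K) p.1 p.2)
    have h2 : leviPart (Sum.elim 0 fun p => (1 : Matrix (Fin r) (Fin r) K) p.1 p.2) = 1 := rfl
    rw [h0, map_zero, h2, Matrix.det_one] at h1
    exact zero_ne_one h1
  · intro p hp
    induction p using Projectivization.ind with
    | h v hv =>
      obtain ⟨M, hM, c, hc, hvM⟩ := mk_mem_orbit_iff.1 hp
      obtain ⟨H, T, U, G, hH, hT, hU, hG, hMf⟩ := exists_shear_factorization hM
      obtain ⟨h', rfl⟩ := exists_symmOf_eq hH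
      obtain ⟨t', rfl⟩ := exists_symmOf_eq hT
      obtain ⟨u', rfl⟩ := exists_symmOf_eq hU
      let t : SympParam r → K := Sum.elim (Sum.elim h' (Sum.elim t' u')) fun p => G p.1 p.2
      have ht : sympOf t = G.det • M := by
        rw [sympOf_eq_smul (show IsUnit (leviPart t).det from hG), hMf]
        rfl
      have hψ : v = (c * (G.det * G.det)⁻¹) • ψ t := by
        refine Subtype.ext ?_
        have h1 : (ψ t).1 = (G.det * G.det) • (M * x.1 * Mᵀ) := by
          change sympOf t * x.1 * (sympOf t)ᵀ = _
          rw [ht, Matrix.transpose_smul, Matrix.smul_mul, Matrix.smul_mul, Matrix.mul_smul,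
            smul_smul]
        rw [Submodule.coe_smul, h1, smul_smul, mul_assoc, inv_mul_cancel₀
          (mul_ne_zero hG.ne_zero hG.ne_zero), mul_one, hvM]
      have hψ0 : ψ t ≠ 0 := by
        intro h0
        rw [h0, smul_zero] at hψ
        exact hv hψ
      exact ⟨t, hψ0, ((Projectivization.mk_eq_mk_iff' K _ _ _ _).2 ⟨_, hψ.symm⟩).symm⟩
  · intro t ht
    rw [hh] at ht
    have hG : IsUnit (leviPart t).det := isUnit_iff_ne_zero.2 ht
    have hM := mul_mem (mul_mem (mul_mem (upper_mem (symmOf_transpose fun s => t (.inl (.inl s))))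
      (lower_mem (symmOf_transpose fun s => t (.inl (.inr (.inl s)))))) (levi_mem hG))
      (upper_mem (symmOf_transpose fun s => t (.inl (.inr (.inr s)))))
    obtain ⟨M, hM, hMt⟩ : ∃ M ∈ Matrix.symplecticGroup (Fin r) K,
        sympOf t = (leviPart t).det • M := ⟨_, hM, sympOf_eq_smul hG⟩
    have hψ : (ψ t).1 = ((leviPart t).det * (leviPart t).det) • (M * x.1 * Mᵀ) := by
      change sympOf t * x.1 * (sympOf t)ᵀ = _
      rw [hMt, Matrix.transpose_smul, Matrix.smul_mul, Matrix.smul_mul,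
        Matrix.mul_smul, smul_smul]
    have hψ0 : ψ t ≠ 0 := by
      have h1 : ψ t = ((leviPart t).det * (leviPart t).det) •
          ((⟨M, hM⟩ : Matrix.symplecticGroup (Fin r) K) • x) := Subtype.ext hψ
      rw [h1]
      exact smul_ne_zero (mul_ne_zero ht ht) ((smul_ne_zero_iff_ne _).2 hx)
    exact ⟨hψ0, mk_mem_orbit_iff.2 ⟨M, hM, _, mul_ne_zero ht ht, hψ⟩⟩

theorem isIrreducible_O [Infinite K] (hr : 1 ≤ r) {k : ℕ} (hk : 1 ≤ k) :
    IsIrreducible (O r K k) := by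
  have h1 : O r K k = MulAction.orbit (Matrix.symplecticGroup (Fin r) K)
      (Projectivization.mk K (stdMat r K k) (stdMat_ne_zero hr hk)) :=
    Set.ext fun p => ⟨fun ⟨_, h⟩ => h, fun h => ⟨_, h⟩⟩
  rw [h1]
  exact isIrreducible_orbit _ _

/-- The orbit closure `Y_k` as an irreducible closed set. -/
def irreducibleY [Infinite K] (hr : 1 ≤ r) {k : ℕ} (hk : 1 ≤ k) :
    TopologicalSpace.IrreducibleCloseds (PSym (Fin r ⊕ Fin r) K) :=
  ⟨Y r K k, (isIrreducible_O hr hk).closure, isClosed_closure⟩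

end Irreducibility

/-! ### Charts of the small orbits -/

section IsotropicChart

theorem fromRows_omega_fromRows {r : ℕ} {ι K : Type*} [Field K] (V W : Matrix (Fin r) ι K) :
    (Matrix.fromRows V W)ᵀ * Omega r K * Matrix.fromRows V W = Vᵀ * W - Wᵀ * V := by
  rw [Matrix.transpose_fromRows, Omega, Matrix.fromCols_mul_fromBlocks,
    Matrix.fromCols_mul_fromRows]
  simp
  abel

variable {r : ℕ} {K : Type*} [Field K] {ι κ : Type*} [DecidableEq ι] [Fintype κ]

/-- A frame of an isotropic subspace in the chart in which its first `ι` coordinates are a basis;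
the coordinates are split by `e : Fin r ≃ ι ⊕ κ`. The frame is isotropic if `T` is symmetric. -/
def isoFrame {R : Type*} [CommRing R] (e : Fin r ≃ ι ⊕ κ) (C E : Matrix κ ι R)
    (T : Matrix ι ι R) : Matrix (Fin r ⊕ Fin r) ι R :=
  Matrix.fromRows ((Matrix.fromRows 1 C).submatrix e id)
    ((Matrix.fromRows (T + Eᵀ * C) E).submatrix e id)

/-- The parameters of isotropic symmetric matrices: two symmetric matrices, the Gram matrix `S` and
the part `T` of the frame, and two rectangular ones, the parts `C` and `E` of the frame. -/
abbrev IsoParam (ι κ : Type*) : Type _ := (Sym2 ι ⊕ Sym2 ι) ⊕ (κ × ι ⊕ κ × ι)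

/-- The frame with the given parameters. -/
def frameOf {R : Type*} [CommRing R] (e : Fin r ≃ ι ⊕ κ) (t : IsoParam ι κ → R) :
    Matrix (Fin r ⊕ Fin r) ι R :=
  isoFrame e (Matrix.of fun c a => t (.inr (.inl (c, a))))
    (Matrix.of fun c a => t (.inr (.inr (c, a)))) (symmOf fun s => t (.inl (.inr s)))

theorem frameOf_map {R S : Type*} [CommRing R] [CommRing S] (f : R →+* S) (e : Fin r ≃ ι ⊕ κ)
    (t : IsoParam ι κ → R) : (frameOf e t).map f = frameOf e (f ∘ t) := by
  ext a i
  rcases a with a | a <;> rcases h : e a with b | b <;>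
    simp [frameOf, isoFrame, h, Matrix.mul_apply, symmOf, Matrix.one_apply, apply_ite f]

theorem frameOf_inl_inl {R : Type*} [CommRing R] (e : Fin r ≃ ι ⊕ κ) (t : IsoParam ι κ → R)
    (a b : ι) : frameOf e t (Sum.inl (e.symm (Sum.inl a))) b = (1 : Matrix ι ι R) a b := by
  simp [frameOf, isoFrame]

variable [Fintype ι]

/-- The chart `B S Bᵗ` of the isotropic symmetric matrices of rank at most `#ι`. -/
def isoChart {R : Type*} [CommRing R] (e : Fin r ≃ ι ⊕ κ) (t : IsoParam ι κ → R) :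
    Matrix (Fin r ⊕ Fin r) (Fin r ⊕ Fin r) R :=
  frameOf e t * symmOf (fun s => t (.inl (.inl s))) * (frameOf e t)ᵀ

theorem isoChart_map {R S : Type*} [CommRing R] [CommRing S] (f : R →+* S) (e : Fin r ≃ ι ⊕ κ)
    (t : IsoParam ι κ → R) : (isoChart e t).map f = isoChart e (f ∘ t) := by
  rw [isoChart, Matrix.map_mul, Matrix.map_mul, Matrix.transpose_map, frameOf_map, symmOf_map]
  rfl

theorem isoChart_transpose {R : Type*} [CommRing R] (e : Fin r ≃ ι ⊕ κ) (t : IsoParam ι κ → R) :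
    (isoChart e t)ᵀ = isoChart e t := by
  rw [isoChart, Matrix.transpose_mul, Matrix.transpose_mul, Matrix.transpose_transpose,
    symmOf_transpose, Matrix.mul_assoc]

theorem isoFrame_isotropic_iff (e : Fin r ≃ ι ⊕ κ) (C E : Matrix κ ι K) (T : Matrix ι ι K) :
    (isoFrame e C E T)ᵀ * Omega r K * isoFrame e C E T = 0 ↔ Tᵀ = T := by
  have h1 : ∀ A B : Matrix (ι ⊕ κ) ι K,
      (A.submatrix e id)ᵀ * B.submatrix e id = Aᵀ * B := by
    intro A B
    rw [Matrix.transpose_submatrix, Matrix.submatrix_mul_equiv]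
    rfl
  rw [isoFrame, fromRows_omega_fromRows, h1, h1, Matrix.transpose_fromRows,
    Matrix.transpose_fromRows, Matrix.fromCols_mul_fromRows, Matrix.fromCols_mul_fromRows]
  simp only [Matrix.transpose_one, Matrix.one_mul, Matrix.mul_one, Matrix.transpose_add,
    Matrix.transpose_mul, Matrix.transpose_transpose]
  rw [sub_eq_zero]
  constructor
  · intro h
    have h2 : T + (Eᵀ * C + Cᵀ * E) = Tᵀ + (Eᵀ * C + Cᵀ * E) := by
      rw [← add_assoc, h]
      abel
    exact (add_right_cancel h2).symm
  · intro h
    rw [h]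
    abel

theorem isoChart_isotropic (e : Fin r ≃ ι ⊕ κ) (t : IsoParam ι κ → K) :
    isoChart e t * Omega r K * isoChart e t = 0 := by
  have h1 : (frameOf e t)ᵀ * Omega r K * frameOf e t = 0 :=
    (isoFrame_isotropic_iff e _ _ _).2 (symmOf_transpose _)
  set S := symmOf fun s => t (.inl (.inl s)) with hS
  calc isoChart e t * Omega r K * isoChart e t
      = frameOf e t * S * ((frameOf e t)ᵀ * Omega r K * frameOf e t) * S * (frameOf e t)ᵀ := by
        simp only [isoChart, ← hS, Matrix.mul_assoc]
    _ = 0 := by rw [h1]; simp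

theorem rank_isoChart_le (e : Fin r ≃ ι ⊕ κ) (t : IsoParam ι κ → K) :
    (isoChart e t).rank ≤ Fintype.card ι :=
  ((Matrix.rank_mul_le_left _ _).trans (Matrix.rank_mul_le_left _ _)).trans
    (Matrix.rank_le_card_width _)

theorem isoChart_apply_inl {R : Type*} [CommRing R] (e : Fin r ≃ ι ⊕ κ) (t : IsoParam ι κ → R)
    (x : Fin r ⊕ Fin r) (b : ι) : isoChart e t x (Sum.inl (e.symm (Sum.inl b))) =
      (frameOf e t * symmOf (fun s => t (.inl (.inl s)))) x b := by
  rw [isoChart, Matrix.mul_apply]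
  simp [frameOf_inl_inl, Matrix.one_apply]

theorem isoChart_inl_inl {R : Type*} [CommRing R] (e : Fin r ≃ ι ⊕ κ) (t : IsoParam ι κ → R)
    (a b : ι) : isoChart e t (Sum.inl (e.symm (Sum.inl a))) (Sum.inl (e.symm (Sum.inl b))) =
      t (.inl (.inl s(a, b))) := by
  rw [isoChart_apply_inl, Matrix.mul_apply]
  simp [frameOf_inl_inl, Matrix.one_apply, symmOf]

/-- The chart contains all isotropic matrices of rank `k` whose `ι`-block is invertible. -/
theorem exists_isoChart_eq [CharZero K] [IsAlgClosed K] {k : ℕ} {κ : Type*} [Fintype κ]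
    (e : Fin r ≃ Fin k ⊕ κ)
    {Z : Matrix (Fin r ⊕ Fin r) (Fin r ⊕ Fin r) K} (hZ : Zᵀ = Z) (h : Z * Omega r K * Z = 0)
    (hrk : Z.rank = k)
    (hdet : (Z.submatrix (fun a : Fin k => Sum.inl (e.symm (Sum.inl a)))
      (fun a : Fin k => Sum.inl (e.symm (Sum.inl a)))).det ≠ 0) :
    ∃ t, isoChart e t = Z := by
  obtain ⟨B, hB, hZB⟩ := exists_eq_mul_transpose Z hZ hrk
  have hiso := isotropic_of_mul_transpose h hB hZB
  let B₁ : Matrix (Fin k) (Fin k) K := B.submatrix (fun a => Sum.inl (e.symm (Sum.inl a))) id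
  have hB₁ : IsUnit B₁.det := by
    refine isUnit_iff_ne_zero.2 fun h0 => hdet ?_
    have h1 : Z.submatrix (fun a : Fin k => Sum.inl (e.symm (Sum.inl a)))
        (fun a : Fin k => Sum.inl (e.symm (Sum.inl a))) = B₁ * B₁ᵀ := by
      rw [hZB]
      rfl
    rw [h1, Matrix.det_mul, h0, zero_mul]
  -- the frame of the column space that restricts to the identity on the `ι`-block
  let F := B * B₁⁻¹
  have hF1 : ∀ a b, F (Sum.inl (e.symm (Sum.inl a))) b = (1 : Matrix (Fin k) (Fin k) K) a b := by
    intro a b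
    rw [← Matrix.mul_nonsing_inv B₁ hB₁]
    rfl
  have hFiso : Fᵀ * Omega r K * F = 0 := by
    calc Fᵀ * Omega r K * F = B₁⁻¹ᵀ * (Bᵀ * Omega r K * B) * B₁⁻¹ := by
          simp only [F, Matrix.transpose_mul, Matrix.mul_assoc]
      _ = 0 := by rw [hiso]; simp
  let C : Matrix κ (Fin k) K := F.submatrix (fun c => Sum.inl (e.symm (Sum.inr c))) id
  let D : Matrix (Fin k) (Fin k) K := F.submatrix (fun c => Sum.inr (e.symm (Sum.inl c))) id
  let E : Matrix κ (Fin k) K := F.submatrix (fun c => Sum.inr (e.symm (Sum.inr c))) id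
  have hF : isoFrame e C E (D - Eᵀ * C) = F := by
    ext x b
    rcases x with x | x <;> obtain ⟨y, rfl⟩ := e.symm.surjective x <;> rcases y with y | y
    · rw [hF1]
      simp [isoFrame]
    · simp [isoFrame, C]
    · simp [isoFrame, D]
    · simp [isoFrame, E]
  rw [← hF, isoFrame_isotropic_iff] at hFiso
  obtain ⟨τ, hτ⟩ := exists_symmOf_eq hFiso
  obtain ⟨s, hs⟩ := exists_symmOf_eq (A := B₁ * B₁ᵀ)
    (by rw [Matrix.transpose_mul, Matrix.transpose_transpose])
  refine ⟨Sum.elim (Sum.elim s τ) (Sum.elim (fun p => C p.1 p.2) fun p => E p.1 p.2), ?_⟩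
  have h1 : isoChart e (Sum.elim (Sum.elim s τ) (Sum.elim (fun p => C p.1 p.2) fun p => E p.1 p.2))
      = isoFrame e C E (symmOf τ) * symmOf s * (isoFrame e C E (symmOf τ))ᵀ := rfl
  have h2 : B₁⁻¹ * B₁ = 1 := Matrix.nonsing_inv_mul B₁ hB₁
  have h3 : B₁ᵀ * B₁⁻¹ᵀ = 1 := by rw [← Matrix.transpose_mul, h2, Matrix.transpose_one]
  rw [h1, hτ, hF, hs, hZB]
  calc F * (B₁ * B₁ᵀ) * Fᵀ = B * (B₁⁻¹ * B₁) * (B₁ᵀ * B₁⁻¹ᵀ) * Bᵀ := by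
        simp only [F, Matrix.transpose_mul, Matrix.mul_assoc]
    _ = B * Bᵀ := by rw [h2, h3, Matrix.mul_one, Matrix.mul_one]

end IsotropicChart

/-! ### Upper bounds for the dimensions -/

section Heights

/-- To show that a polynomial vanishes on `Y_k`, it is enough to consider the nonempty open subset
of the orbit on which some polynomial `h` does not vanish. -/
theorem mem_vanishingIdeal_Y_of_open {r : ℕ} {K : Type*} [Field K] [Infinite K] (hr : 1 ≤ r) {k : ℕ} (hk : 1 ≤ k)
    {f h : MvPolynomial (Sym2 (Fin r ⊕ Fin r)) K} (hh : h ∉ vanishingIdeal (O r K k))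
    (hf : ∀ (v : symMat (Fin r ⊕ Fin r) K) (hv : v ≠ 0), Projectivization.mk K v hv ∈ O r K k →
      eval (coord v) h ≠ 0 → eval (coord v) f = 0) :
    f ∈ vanishingIdeal (Y r K k) := by
  rw [Y, vanishingIdeal_closure]
  have := isPrime_vanishingIdeal (isIrreducible_O (K := K) hr hk)
  refine (this.mem_or_mem (show f * h ∈ _ from fun v hv hm => ?_)).resolve_right hh
  rw [map_mul]
  by_cases h0 : eval (coord v) h = 0
  · rw [h0, mul_zero]
  · rw [hf v hv hm h0, zero_mul]

variable {r : ℕ} {K : Type*} [Field K] [CharZero K] [IsAlgClosed K]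

/-- The chart is dense in `Y_k`, so its number of parameters bounds the dimension of the cone. -/
theorem height_Y_add_one_le (hr : 1 ≤ r) {k m : ℕ} (hk : 1 ≤ k) (e : Fin r ≃ Fin k ⊕ Fin m) :
    Order.height (irreducibleY (K := K) hr hk) + 1 ≤ (Nat.card (IsoParam (Fin k) (Fin m)) : ℕ∞) := by
  have hkr : k ≤ r := by
    have := Fintype.card_congr e
    simp at this
    omega
  let ψ : (IsoParam (Fin k) (Fin m) → K) → symMat (Fin r ⊕ Fin r) K := fun t =>
    ⟨isoChart e t, mem_symMat.2 (isoChart_transpose e t)⟩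
  have hψ := coord_eq_eval ψ (isoChart e MvPolynomial.X) (fun t => by
    rw [isoChart_map]
    change isoChart e t = _
    congr 1
    funext s
    simp)
  let j : Fin k → Fin r ⊕ Fin r := fun a => Sum.inl (e.symm (Sum.inl a))
  let h : MvPolynomial (Sym2 (Fin r ⊕ Fin r)) K := ((genMat r K).submatrix j j).det
  have hh : ∀ v, eval (coord v) h = (v.1.submatrix j j).det := by
    intro v
    rw [RingHom.map_det, ← eval_genMat v]
    rfl
  refine height_add_one_le (fun s => isoChart e MvPolynomial.X (Quot.out s).1 (Quot.out s).2) _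
    fun f hf => ?_
  refine mem_vanishingIdeal_Y_of_open (h := h) hr hk (fun hmem => ?_) fun v hv hm h0 => ?_
  -- the minor `h` is nonzero at the point with `S = 1` and all other parameters zero
  · obtain ⟨s, hs⟩ := exists_symmOf_eq (A := (1 : Matrix (Fin k) (Fin k) K)) Matrix.transpose_one
    let t : IsoParam (Fin k) (Fin m) → K := Sum.elim (Sum.elim s 0) 0
    have h1 : (ψ t).1.submatrix j j = 1 := by
      rw [← hs]
      ext a b
      exact isoChart_inl_inl e t a b
    have h2 : ((ψ t).1.submatrix j j).det ≠ 0 := by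
      rw [h1, Matrix.det_one]
      exact one_ne_zero
    have h3 := Matrix.rank_of_det_ne_zero h2
    have h4 := Matrix.rank_submatrix_le (ψ t).1 j j
    have h5 := rank_isoChart_le e t
    rw [Fintype.card_fin] at h3 h5
    have h6 : (ψ t).1.rank = k := le_antisymm h5 (by omega)
    have h7 : ψ t ≠ 0 := by
      intro h0
      rw [h0, Submodule.coe_zero, Matrix.rank_zero] at h6
      omega
    exact h2 (hh _ ▸ hmem (ψ t) h7 ((mk_mem_O_iff_rank hr hk hkr).2 ⟨isoChart_isotropic e t, h6⟩))
  · rw [hh] at h0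
    obtain ⟨h1, h2⟩ := (mk_mem_O_iff_rank hr hk hkr).1 hm
    obtain ⟨t, ht⟩ := exists_isoChart_eq e (mem_symMat.1 v.2) h1 h2 h0
    obtain rfl : ψ t = v := Subtype.ext ht
    rw [hψ, ← eval_aeval, hf, map_zero]

end Heights

/-! ### Lower bounds for the dimensions -/

section LowerBound

variable {r : ℕ} {ι κ : Type*} [DecidableEq ι]

/-- The parameters of the affine space of isotropic matrices in the chart whose first diagonal
entry, at the position `z`, is one. -/
abbrev NormalizedParam (κ : Type*) {ι : Type*} (z : ι) : Type _ :=
  {s : Sym2 ι // s ≠ s(z, z)} ⊕ (Sym2 ι ⊕ (κ × ι ⊕ κ × ι))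

/-- The Gram matrix is `1 + s`, where `s` has a zero at `(z, z)`. -/
def normalize {R : Type*} [CommRing R] {z : ι} (t : NormalizedParam κ z → R) : IsoParam ι κ → R :=
  Sum.elim (Sum.elim
    (fun s => (if s.IsDiag then 1 else 0) + if h : s ≠ s(z, z) then t (.inl ⟨s, h⟩) else 0)
    fun s => t (.inr (.inl s))) fun p => t (.inr (.inr p))

theorem normalize_map {R S : Type*} [CommRing R] [CommRing S] (f : R →+* S) {z : ι}
    (t : NormalizedParam κ z → R) : f ∘ normalize t = normalize (f ∘ t) := by
  funext s
  rcases s with (s | s) | s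
  · simp only [normalize, Function.comp_apply, Sum.elim_inl, map_add]
    split_ifs <;> simp
  · rfl
  · rfl

/-- The order of the parameters: `T` comes before `C` and `E`, which come before the Gram matrix. -/
def level {z : ι} : NormalizedParam κ z → ℕ := Sum.elim 2 (Sum.elim 0 1)

/-- A linear form that reads off a parameter, provided that the parameters of higher level
vanish. -/
def readOff {K : Type*} [Field K] (e : Fin r ≃ ι ⊕ κ) {z : ι} :
    NormalizedParam κ z → MvPolynomial (Sym2 (Fin r ⊕ Fin r)) K
  | .inl s => MvPolynomial.X (s.1.map fun a => Sum.inl (e.symm (Sum.inl a))) -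
      if s.1.IsDiag then
        MvPolynomial.X s(Sum.inl (e.symm (Sum.inl z)), Sum.inl (e.symm (Sum.inl z))) else 0
  | .inr (.inl s) => MvPolynomial.X s(Sum.inr (e.symm (Sum.inl (Quot.out s).1)),
      Sum.inl (e.symm (Sum.inl (Quot.out s).2)))
  | .inr (.inr (.inl p)) =>
      MvPolynomial.X s(Sum.inl (e.symm (Sum.inr p.1)), Sum.inl (e.symm (Sum.inl p.2)))
  | .inr (.inr (.inr p)) =>
      MvPolynomial.X s(Sum.inr (e.symm (Sum.inr p.1)), Sum.inl (e.symm (Sum.inl p.2)))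

variable {K : Type*} [Field K]

theorem isHomogeneous_readOff (e : Fin r ≃ ι ⊕ κ) {z : ι} (j : NormalizedParam κ z) :
    (readOff (K := K) e j).IsHomogeneous 1 := by
  rcases j with s | s | p | p
  · simp only [readOff]
    refine (isHomogeneous_X _ _).sub ?_
    split_ifs
    · exact isHomogeneous_X _ _
    · exact isHomogeneous_zero _ _ _
  all_goals exact isHomogeneous_X _ _

variable [Fintype ι] [Fintype κ]

/-- If the Gram matrix is the identity, the frame can be read off the first columns. -/
theorem isoChart_normalize_apply_inl (e : Fin r ≃ ι ⊕ κ) {z : ι} (t : NormalizedParam κ z → K)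
    (ht : ∀ s, t (.inl s) = 0) (x : Fin r ⊕ Fin r) (b : ι) :
    isoChart e (normalize t) x (Sum.inl (e.symm (Sum.inl b))) = frameOf e (normalize t) x b := by
  have h1 : symmOf (fun s => normalize t (.inl (.inl s))) = 1 := by
    ext a b
    simp [symmOf, normalize, ht, Matrix.one_apply]
  rw [isoChart_apply_inl, h1, Matrix.mul_one]

theorem eval_readOff (e : Fin r ≃ ι ⊕ κ) {z : ι} (j : NormalizedParam κ z)
    (t : NormalizedParam κ z → K) (ht : ∀ k, level j < level k → t k = 0)
    (v : symMat (Fin r ⊕ Fin r) K) (hv : v.1 = isoChart e (normalize t)) :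
    eval (coord v) (readOff e j) = t j := by
  rcases j with ⟨s, hs⟩ | s | p | p
  · induction s with
    | _ a b =>
      simp only [readOff, map_sub, eval_X, Sym2.map_mk, coord_mk, hv, isoChart_inl_inl]
      by_cases hab : a = b
      · subst hab
        simp [normalize, coord_mk, hv, isoChart_inl_inl, hs]
      · have hs' : ¬(a = z ∧ b = z) := fun h => hs (by rw [h.1, h.2])
        simp [normalize, hab, hs']
  · have h1 : ∀ k, t (.inl k) = 0 := fun k => ht _ (by simp [level])
    have h2 : ∀ k, t (.inr (.inr k)) = 0 := fun k => ht _ (by simp [level])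
    have h3 : s((Quot.out s).1, (Quot.out s).2) = s := Quot.out_eq s
    simp only [readOff, eval_X, coord_mk, hv, isoChart_normalize_apply_inl e t h1]
    simp [frameOf, isoFrame, symmOf, normalize, h2, h3, Matrix.mul_apply]
  · have h1 : ∀ k, t (.inl k) = 0 := fun k => ht _ (by simp [level])
    simp only [readOff, eval_X, coord_mk, hv, isoChart_normalize_apply_inl e t h1]
    simp [frameOf, isoFrame, normalize]
  · have h1 : ∀ k, t (.inl k) = 0 := fun k => ht _ (by simp [level])
    simp only [readOff, eval_X, coord_mk, hv, isoChart_normalize_apply_inl e t h1]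
    simp [frameOf, isoFrame, normalize]

/-- Switching on the parameters of the normalized chart in the order of their levels gives a chain
of irreducible closed subsets of `Y_k`. -/
theorem card_le_height_Y [CharZero K] [IsAlgClosed K] (hr : 1 ≤ r) {k m : ℕ} (hk : 1 ≤ k)
    (e : Fin r ≃ Fin k ⊕ Fin m) (z : Fin k) :
    (Nat.card (NormalizedParam (Fin m) z) : ℕ∞) ≤ Order.height (irreducibleY (K := K) hr hk) := by
  classical
  have hkr : k ≤ r := by
    have := Fintype.card_congr e
    simp at this
    omega
  let ψ : (NormalizedParam (Fin m) z → K) → symMat (Fin r ⊕ Fin r) K := fun t =>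
    ⟨isoChart e (normalize t), mem_symMat.2 (isoChart_transpose e _)⟩
  have hψ := coord_eq_eval ψ (isoChart e (normalize MvPolynomial.X)) (fun t => by
    rw [isoChart_map, normalize_map]
    change isoChart e (normalize t) = _
    congr 2
    funext s
    simp)
  have hne : ∀ t, ψ t ≠ 0 := by
    intro t h0
    have h1 := isoChart_inl_inl e (normalize t) z z
    rw [show isoChart e (normalize t) = (ψ t).1 from rfl, h0] at h1
    simp [normalize] at h1
  refine card_le_height _ ψ _ hψ hne (fun t => ?_) level (readOff e) (isHomogeneous_readOff e)
    (fun j t h0 h1 => ?_) fun j => ⟨Pi.single j 1, fun k hk => Pi.single_eq_of_ne hk _, ?_⟩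
  · refine (mk_mem_Y_iff hr hk hkr).2 ⟨isoChart_isotropic e _, ?_⟩
    simpa using rank_isoChart_le e (normalize t)
  · rw [eval_readOff e j t h1 (ψ t) rfl, h0]
  · rw [eval_readOff e j _ (fun k hk => Pi.single_eq_of_ne (by rintro rfl; exact hk.false) _) _ rfl,
      Pi.single_eq_same]
    exact one_ne_zero

theorem two_mul_card_sym2 (k : ℕ) : 2 * Fintype.card (Sym2 (Fin k)) = k * (k + 1) := by
  rw [Sym2.card, Fintype.card_fin, Nat.choose_two_right,
    Nat.mul_div_cancel' (Nat.even_mul_pred_self _).two_dvd]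
  simp [mul_comm]

theorem height_irreducibleY [CharZero K] [IsAlgClosed K] (hr : 1 ≤ r) {k : ℕ} (hk : 1 ≤ k)
    (hkr : k ≤ r) : Order.height (irreducibleY (K := K) hr hk) =
      ((2 * r * k + k - k ^ 2 - 1 : ℕ) : ℕ∞) := by
  obtain ⟨m, rfl⟩ := Nat.exists_eq_add_of_le hkr
  have h1 := height_Y_add_one_le (K := K) hr hk finSumFinEquiv.symm
  have h2 := card_le_height_Y (K := K) hr hk finSumFinEquiv.symm ⟨0, hk⟩
  have hS := two_mul_card_sym2 k
  have hS' : 1 ≤ Fintype.card (Sym2 (Fin k)) := Fintype.card_pos_iff.2 ⟨s(⟨0, hk⟩, ⟨0, hk⟩)⟩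
  have hd : 2 * (k + m) * k + k - k ^ 2 - 1 + 1 = k * (k + 1) + 2 * (m * k) := by
    have h3 : 2 * (k + m) * k + k = k ^ 2 + (k * (k + 1) + 2 * (m * k)) := by ring
    rw [h3, Nat.add_sub_cancel_left]
    have : 1 ≤ k * (k + 1) := Nat.mul_pos hk (by omega)
    omega
  have hc1 : Nat.card (IsoParam (Fin k) (Fin m)) = 2 * (k + m) * k + k - k ^ 2 - 1 + 1 := by
    rw [hd, ← hS]
    simp only [Nat.card_eq_fintype_card, Fintype.card_sum, Fintype.card_prod, Fintype.card_fin]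
    ring
  have hc2 : Nat.card (NormalizedParam (Fin m) (⟨0, hk⟩ : Fin k)) =
      2 * (k + m) * k + k - k ^ 2 - 1 := by
    have h4 : Fintype.card {s : Sym2 (Fin k) // s ≠ s(⟨0, hk⟩, ⟨0, hk⟩)} =
        Fintype.card (Sym2 (Fin k)) - 1 := by
      rw [Fintype.card_subtype_compl, Fintype.card_subtype_eq]
    have h5 : 2 * (k + m) * k + k - k ^ 2 - 1 + 1 = 2 * Fintype.card (Sym2 (Fin k)) + 2 * (m * k) := by
      rw [hd, hS]
    simp only [Nat.card_eq_fintype_card, Fintype.card_sum, Fintype.card_prod, Fintype.card_fin, h4]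
    omega
  rw [hc1] at h1
  rw [hc2] at h2
  refine le_antisymm ?_ h2
  push_cast at h1
  exact (ENat.add_le_add_iff_right ENat.one_ne_top).1 h1

theorem topologicalKrullDim_secantVariety_inter_X [CharZero K] [IsAlgClosed K] (hr : 1 ≤ r) {k : ℕ}
    (hk : 1 ≤ k) (hkr : k ≤ r) :
    topologicalKrullDim ↥(secantVariety k (veroneseVariety (Fin r ⊕ Fin r) K) ∩ X r K) =
      ((2 * r * k + k - k ^ 2 - 1 : ℕ) : WithBot ℕ∞) := by
  rw [← Y_eq_secantVariety_inter_X hr hk hkr]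
  refine (topologicalKrullDim_coe (irreducibleY (K := K) hr hk)).trans ?_
  rw [height_irreducibleY hr hk hkr]
  rfl

end LowerBound

/-! ### The codimension of `Y_r` in `X_{2r}` -/

section Divisor

variable {r : ℕ} {K : Type*} [Field K]

/-- The chart of the matrices with `Z Ω Z` proportional to `Ω`: the parameters are two symmetric
matrices, the upper left block `P` and the shear `T`, and a scalar. -/
def lagrangianChart {R : Type*} [CommRing R] (t : (Sym2 (Fin r) ⊕ Sym2 (Fin r)) ⊕ Unit → R) :
    Matrix (Fin r ⊕ Fin r) (Fin r ⊕ Fin r) R :=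
  let P := symmOf fun s => t (.inl (.inl s))
  let T := symmOf fun s => t (.inl (.inr s))
  Matrix.fromBlocks P (P * T) (T * P) (T * P * T + t (.inr ()) • P.adjugate)

theorem lagrangianChart_map {R S : Type*} [CommRing R] [CommRing S] (f : R →+* S)
    (t : (Sym2 (Fin r) ⊕ Sym2 (Fin r)) ⊕ Unit → R) :
    (lagrangianChart t).map f = lagrangianChart (f ∘ t) := by
  have h1 : ((symmOf fun s => t (.inl (.inl s))).adjugate).map f =
      (symmOf fun s => f (t (.inl (.inl s)))).adjugate :=
    RingHom.map_adjugate f _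
  have h2 : (t (.inr ()) • (symmOf fun s => t (.inl (.inl s))).adjugate).map f =
      f (t (.inr ())) • (symmOf fun s => f (t (.inl (.inl s)))).adjugate := by
    rw [← h1]
    ext i j
    simp
  simp only [lagrangianChart, Matrix.fromBlocks_map, Matrix.map_mul, symmOf_map,
    Matrix.map_add f (map_add f), h2]
  rfl

theorem lagrangianChart_transpose {R : Type*} [CommRing R]
    (t : (Sym2 (Fin r) ⊕ Sym2 (Fin r)) ⊕ Unit → R) :
    (lagrangianChart t)ᵀ = lagrangianChart t := by
  simp only [lagrangianChart, Matrix.fromBlocks_transpose, Matrix.transpose_mul,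
    Matrix.transpose_add, Matrix.transpose_smul, Matrix.adjugate_transpose, symmOf_transpose,
    Matrix.mul_assoc]

/-- The chart contains the matrices whose upper left block `P` is invertible: the shear is
`T = P⁻¹ Q`, where `Q` is the upper right block, and `Z Ω Z = c Ω` determines the lower right block
as `T P T + c P⁻¹`. -/
theorem exists_lagrangianChart_eq {Z : Matrix (Fin r ⊕ Fin r) (Fin r ⊕ Fin r) K} (hZ : Zᵀ = Z)
    {c : K} (h : Z * Omega r K * Z = c • Omega r K) (hdet : Z.toBlocks₁₁.det ≠ 0) :
    ∃ t, lagrangianChart t = Z := by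
  obtain ⟨P, Q, Q', W, rfl⟩ : ∃ A B C D, Z = Matrix.fromBlocks A B C D :=
    ⟨_, _, _, _, (Matrix.fromBlocks_toBlocks Z).symm⟩
  rw [Matrix.fromBlocks_transpose, Matrix.fromBlocks_inj] at hZ
  obtain ⟨hP, rfl, -, -⟩ := hZ
  rw [Matrix.toBlocks_fromBlocks₁₁] at hdet
  have hPu : IsUnit P.det := isUnit_iff_ne_zero.2 hdet
  have hPi : P⁻¹ * P = 1 := Matrix.nonsing_inv_mul P hPu
  have hPi' : P * P⁻¹ = 1 := Matrix.mul_nonsing_inv P hPu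
  have hPt : P⁻¹ᵀ = P⁻¹ := by rw [Matrix.transpose_nonsing_inv, hP]
  obtain ⟨Q, rfl⟩ : ∃ B : Matrix (Fin r) (Fin r) K, Bᵀ = Q' := ⟨_, Matrix.transpose_transpose _⟩
  simp only [Omega, Matrix.fromBlocks_multiply, Matrix.fromBlocks_smul, Matrix.fromBlocks_inj] at h
  obtain ⟨h1, h2, -, -⟩ := h
  simp only [Matrix.transpose_transpose, Matrix.mul_zero, Matrix.mul_one, Matrix.mul_neg,
    zero_add, add_zero, smul_zero, Matrix.neg_mul] at h1 h2
  have h3 : P * Qᵀ = Q * P := (neg_add_eq_zero.1 h1).symm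
  have hT : (P⁻¹ * Q)ᵀ = P⁻¹ * Q := by
    calc (P⁻¹ * Q)ᵀ = P⁻¹ * (P * Qᵀ) * P⁻¹ := by
          rw [Matrix.transpose_mul, hPt, ← Matrix.mul_assoc, hPi, Matrix.one_mul]
      _ = P⁻¹ * Q * (P * P⁻¹) := by rw [h3]; simp only [Matrix.mul_assoc]
      _ = P⁻¹ * Q := by rw [hPi', Matrix.mul_one]
  have hQ : P * (P⁻¹ * Q) = Q := by rw [← Matrix.mul_assoc, hPi', Matrix.one_mul]
  have hQt : P⁻¹ * Q * P = Qᵀ := by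
    rw [Matrix.mul_assoc, ← h3, ← Matrix.mul_assoc, hPi, Matrix.one_mul]
  have hW : P⁻¹ * Q * P * (P⁻¹ * Q) + (c * P.det⁻¹) • P.adjugate = W := by
    have h4 : (c * P.det⁻¹) • P.adjugate = c • P⁻¹ := by
      rw [Matrix.inv_def, Ring.inverse_eq_inv', smul_smul]
    have h5 : P * W = Q * Q + c • 1 := by
      rw [← h2]
      abel
    rw [h4, Matrix.mul_assoc _ P, hQ, Matrix.mul_assoc]
    calc P⁻¹ * (Q * Q) + c • P⁻¹ = P⁻¹ * (P * W) := by
          rw [h5, Matrix.mul_add, Matrix.mul_smul, Matrix.mul_one]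
      _ = W := by rw [← Matrix.mul_assoc, hPi, Matrix.one_mul]
  obtain ⟨p, hp⟩ := exists_symmOf_eq hP
  obtain ⟨τ, hτ⟩ := exists_symmOf_eq hT
  refine ⟨Sum.elim (Sum.elim p τ) fun _ => c * P.det⁻¹, ?_⟩
  have h6 : lagrangianChart (Sum.elim (Sum.elim p τ) fun _ => c * P.det⁻¹) =
      Matrix.fromBlocks (symmOf p) (symmOf p * symmOf τ) (symmOf τ * symmOf p)
        (symmOf τ * symmOf p * symmOf τ + (c * P.det⁻¹) • (symmOf p).adjugate) := rfl
  rw [h6, hp, hτ, hQ, hW, hQt, Matrix.transpose_transpose]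

variable [CharZero K] [IsAlgClosed K]

theorem height_X_add_one_le (hr : 1 ≤ r) (h2r : 1 ≤ 2 * r) :
    Order.height (irreducibleY (K := K) hr h2r) + 1 ≤ ((r * (r + 1) + 1 : ℕ) : ℕ∞) := by
  let ψ : ((Sym2 (Fin r) ⊕ Sym2 (Fin r)) ⊕ Unit → K) → symMat (Fin r ⊕ Fin r) K := fun t =>
    ⟨lagrangianChart t, mem_symMat.2 (lagrangianChart_transpose t)⟩
  have hψ := coord_eq_eval ψ (lagrangianChart MvPolynomial.X) (fun t => by
    rw [lagrangianChart_map]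
    change lagrangianChart t = _
    congr 1
    funext s
    simp)
  let h : MvPolynomial (Sym2 (Fin r ⊕ Fin r)) K := (genMat r K).toBlocks₁₁.det
  have hh : ∀ v, eval (coord v) h = v.1.toBlocks₁₁.det := by
    intro v
    rw [RingHom.map_det, ← eval_genMat v]
    rfl
  have hcard : Nat.card ((Sym2 (Fin r) ⊕ Sym2 (Fin r)) ⊕ Unit) = r * (r + 1) + 1 := by
    simp only [Nat.card_eq_fintype_card, Fintype.card_sum, Fintype.card_unit]
    have := two_mul_card_sym2 r
    omega
  rw [← hcard]
  refine height_add_one_le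
    (fun s => lagrangianChart MvPolynomial.X (Quot.out s).1 (Quot.out s).2) _ fun f hf => ?_
  refine mem_vanishingIdeal_Y_of_open (h := h) hr h2r (fun hmem => ?_) fun v hv hm h0 => ?_
  · have h1 : idMat r K ≠ 0 := idMat_eq_stdMat (r := r) (K := K) ▸ stdMat_ne_zero hr h2r
    have h2 := hmem (idMat r K) h1 ((mk_mem_O_two_mul_iff hr).2 ⟨1, one_ne_zero, by
      rw [idMat, Matrix.one_mul, Matrix.mul_one, one_smul]⟩)
    have h3 : (idMat r K).1.toBlocks₁₁ = 1 := by
      ext i j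
      simp [idMat, Matrix.toBlocks₁₁, Matrix.one_apply]
    rw [hh, h3, Matrix.det_one] at h2
    exact one_ne_zero h2
  · rw [hh] at h0
    obtain ⟨c, -, hc⟩ := (mk_mem_O_two_mul_iff hr).1 hm
    obtain ⟨t, ht⟩ := exists_lagrangianChart_eq (mem_symMat.1 v.2) hc h0
    obtain rfl : ψ t = v := Subtype.ext ht
    rw [hψ, ← eval_aeval, hf, map_zero]

/-- The cone over `Y_r` has dimension `r² + r` and the cone over `X_{2r}` has dimension at most
`r² + r + 1`. -/
theorem isPrimeDivisor_Y (hr : 1 ≤ r) : IsPrimeDivisor (Y r K r) (X r K) := by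
  have h2r : 1 ≤ 2 * r := by omega
  rw [X_eq_Y]
  refine ⟨isClosed_closure, (isIrreducible_O hr h2r).closure, isClosed_closure,
    (isIrreducible_O hr hr).closure, Y_ssubset_X hr, fun W hWc hWi h1 h2 => ?_⟩
  by_contra! hne
  let W' : IrreducibleCloseds (PSym (Fin r ⊕ Fin r) K) := ⟨W, hWi, hWc⟩
  have hlt1 : irreducibleY (K := K) hr hr < W' :=
    SetLike.coe_ssubset_coe.1 (h1.ssubset_of_ne hne.1.symm)
  have hlt2 : W' < irreducibleY (K := K) hr h2r :=
    SetLike.coe_ssubset_coe.1 (h2.ssubset_of_ne hne.2)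
  have h3 : Order.height (irreducibleY (K := K) hr hr) + 1 + 1 + 1 ≤
      ((r * (r + 1) + 1 : ℕ) : ℕ∞) :=
    (add_le_add_left ((add_le_add_left (Order.height_add_one_le hlt1) 1).trans
      (Order.height_add_one_le hlt2)) 1).trans (height_X_add_one_le hr h2r)
  rw [height_irreducibleY hr hr le_rfl] at h3
  have h4 : 2 * r * r + r - r ^ 2 - 1 + 1 + 1 + 1 ≤ r * (r + 1) + 1 := by exact_mod_cast h3
  have h5 : 2 * r * r + r = r ^ 2 + r * (r + 1) := by ring
  rw [h5, Nat.add_sub_cancel_left] at h4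
  have : 1 ≤ r * (r + 1) := Nat.mul_pos hr (by omega)
  omega

end Divisor

/-! ### The number of quadrics -/

section Quadrics

variable {r : ℕ} {K : Type*} [Field K]

theorem omega_apply_of_ne {a b : Fin r ⊕ Fin r} (h : b ≠ a.swap) : Omega r K a b = 0 := by
  rcases a with i | i <;> rcases b with j | j
  · rfl
  · have : i ≠ j := by
      rintro rfl
      exact h rfl
    simp [Omega, this]
  · have : i ≠ j := by
      rintro rfl
      exact h rfl
    simp [Omega, this]
  · rfl

theorem omega_swap_ne_zero (a : Fin r ⊕ Fin r) : Omega r K a a.swap ≠ 0 := by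
  rcases a with i | i <;> simp [Omega]

theorem omega_apply_swap (a b : Fin r ⊕ Fin r) : Omega r K b a = -Omega r K a b :=
  congrFun (congrFun (omega_transpose (r := r) (K := K)) a) b

theorem swap_ne_self (a : Fin r ⊕ Fin r) : a.swap ≠ a := by
  rcases a with i | i <;> simp

/-- Every elementary skew matrix is, up to a scalar, of the form `Z Ω Z` with `Z` symmetric. If `a'`
is the index paired with `a` by `Ω`, one can take `Z = E_{aa} + E_{a'b} + E_{ba'}` for `b ≠ a'`, and
`Z = E_{aa} + E_{bb}` for `b = a'`. -/
theorem exists_mul_omega_mul_eq_single {a b : Fin r ⊕ Fin r} (hab : a ≠ b) :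
    ∃ (v : symMat (Fin r ⊕ Fin r) K) (u : K), u ≠ 0 ∧
      v.1 * Omega r K * v.1 = Matrix.single a b u - Matrix.single b a u := by
  have h0 : ∀ c, Omega r K c c = 0 := fun c => omega_apply_of_ne (swap_ne_self c).symm
  by_cases h : b = a.swap
  · subst h
    refine ⟨⟨Matrix.single a a 1 + Matrix.single a.swap a.swap 1, mem_symMat.2 (by
      simp [Matrix.transpose_add])⟩, Omega r K a a.swap, omega_swap_ne_zero a, ?_⟩
    simp only [Matrix.add_mul, Matrix.mul_add, Matrix.single_mul_mul_single, h0,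
      omega_apply_swap a a.swap, one_mul, mul_one, Matrix.single_zero]
    rw [← Matrix.single_neg]
    abel
  · have h1 : Omega r K a b = 0 := omega_apply_of_ne h
    have h2 : Omega r K b a = 0 := by rw [omega_apply_swap, h1, neg_zero]
    have h3 : Omega r K b a.swap = 0 := omega_apply_of_ne fun h3 => hab (by
      simpa using congrArg Sum.swap h3)
    have h4 : Omega r K a.swap b = 0 := by rw [omega_apply_swap, h3, neg_zero]
    refine ⟨⟨Matrix.single a a 1 + (Matrix.single a.swap b 1 + Matrix.single b a.swap 1),
      mem_symMat.2 (by
        simp only [Matrix.transpose_add, Matrix.transpose_single]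
        abel)⟩, Omega r K a a.swap, omega_swap_ne_zero a, ?_⟩
    simp only [Matrix.add_mul, Matrix.mul_add, Matrix.single_mul_mul_single, h0, h1, h2, h3, h4,
      omega_apply_swap a a.swap, one_mul, mul_one, Matrix.single_zero]
    rw [← Matrix.single_neg]
    abel

/-- The entries of `N` above the diagonal can be prescribed independently. -/
theorem exists_eval_N {a b : Fin r ⊕ Fin r} (hab : pos a < pos b) :
    ∃ (x : Sym2 (Fin r ⊕ Fin r) → K) (u : K), u ≠ 0 ∧ ∀ c d, pos c < pos d →
      eval x (N r K c d) = if c = a ∧ d = b then u else 0 := by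
  obtain ⟨v, u, hu, h⟩ := exists_mul_omega_mul_eq_single (K := K)
    (show a ≠ b by rintro rfl; exact hab.false)
  refine ⟨coord v, u, hu, fun c d hcd => ?_⟩
  rw [eval_N, h, Matrix.sub_apply, Matrix.single_apply, Matrix.single_apply,
    if_neg (c := b = c ∧ a = d) (by rintro ⟨rfl, rfl⟩; omega), sub_zero]
  simp only [eq_comm]

theorem pos_inl_lt_pos_inr (i j : Fin r) : pos (Sum.inl i : Fin r ⊕ Fin r) <
    pos (Sum.inr j : Fin r ⊕ Fin r) := by
  have := i.2
  simp only [pos, Sum.elim_inl, Sum.elim_inr]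
  omega

/-- The positions above the diagonal at which `Ω` vanishes. -/
def offPairs (r : ℕ) : Finset ((Fin r ⊕ Fin r) × (Fin r ⊕ Fin r)) :=
  {p | pos p.1 < pos p.2 ∧ pos p.2 ≠ r + pos p.1}

/-- Half of the off-diagonal positions lie above the diagonal, and `Ω` is nonzero at `r` of these. -/
theorem card_offPairs (r : ℕ) : (offPairs r).card = 2 * r * (r - 1) := by
  classical
  let A : Finset ((Fin r ⊕ Fin r) × (Fin r ⊕ Fin r)) := {p | pos p.1 < pos p.2}
  let V : Finset ((Fin r ⊕ Fin r) × (Fin r ⊕ Fin r)) :=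
    Finset.univ.image fun i : Fin r => (Sum.inl i, Sum.inr i)
  have hV : V.card = r := by
    rw [Finset.card_image_of_injective _ fun i j h => by simpa using h, Finset.card_univ,
      Fintype.card_fin]
  have hVA : V ⊆ A := by
    intro p hp
    obtain ⟨i, -, rfl⟩ := Finset.mem_image.1 hp
    exact Finset.mem_filter.2 ⟨Finset.mem_univ _, pos_inl_lt_pos_inr i i⟩
  have hA : 2 * A.card = 2 * r * (2 * r) - 2 * r := by
    have h1 : A ∪ A.image Prod.swap = (Finset.univ : Finset (Fin r ⊕ Fin r)).offDiag := by
      ext ⟨a, b⟩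
      simp only [A, Finset.mem_union, Finset.mem_image, Finset.mem_filter, Finset.mem_univ,
        true_and, Finset.mem_offDiag, Prod.exists, Prod.swap_prod_mk, Prod.mk.injEq]
      constructor
      · rintro (h | ⟨c, d, h, rfl, rfl⟩) rfl <;> exact h.false
      · intro h
        rcases lt_or_gt_of_ne (pos_injective.ne h) with h | h
        · exact Or.inl h
        · exact Or.inr ⟨b, a, h, rfl, rfl⟩
    have h2 : Disjoint A (A.image Prod.swap) := by
      refine Finset.disjoint_left.2 fun p hp hp' => ?_
      obtain ⟨q, hq, rfl⟩ := Finset.mem_image.1 hp'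
      simp only [A, Finset.mem_filter, Finset.mem_univ, true_and, Prod.fst_swap,
        Prod.snd_swap] at hp hq
      omega
    have h3 := congrArg Finset.card h1
    rw [Finset.card_union_of_disjoint h2, Finset.card_image_of_injective _ Prod.swap_injective,
      Finset.offDiag_card] at h3
    simp only [Finset.card_univ, Fintype.card_sum, Fintype.card_fin, ← two_mul] at h3
    exact h3
  have hP : offPairs r = A \ V := by
    ext ⟨a, b⟩
    simp only [offPairs, A, V, Finset.mem_filter, Finset.mem_univ, true_and, Finset.mem_sdiff,
      Finset.mem_image, Prod.mk.injEq, not_exists, not_and]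
    refine and_congr_right fun h => ⟨?_, fun h1 h2 => ?_⟩
    · rintro h1 i rfl rfl
      exact h1 rfl
    · rcases a with i | i <;> rcases b with j | j <;>
        simp only [pos, Sum.elim_inl, Sum.elim_inr] at h2
      · omega
      · exact h1 i rfl (by rw [Fin.ext (show (i : ℕ) = j by omega)])
      · omega
      · omega
  rw [hP, Finset.card_sdiff_of_subset hVA, hV]
  rcases r with _ | r
  · have : A.card = 0 := by omega
    omega
  · have h4 : 2 * (r + 1) * (2 * (r + 1)) = 2 * (2 * (r + 1) * r + (r + 1)) + 2 * (r + 1) := by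
      ring
    rw [Nat.add_sub_cancel]
    omega

/-- The quadrics, enumerated by the positions in `offPairs` and by the pairs of successive indices
in `Fin r`. -/
def quadric (r : ℕ) (K : Type*) [Field K] :
    offPairs r ⊕ {p : Fin r × Fin r // (p.2 : ℕ) = p.1 + 1} →
      MvPolynomial (Sym2 (Fin r ⊕ Fin r)) K
  | .inl p => N r K p.1.1 p.1.2
  | .inr l => N r K (.inl l.1.1) (.inr l.1.1) - N r K (.inl l.1.2) (.inr l.1.2)

theorem range_quadric : Set.range (quadric r K) = quadrics r K := by
  ext f
  constructor
  · rintro ⟨⟨p, hp⟩ | ⟨l, hl⟩, rfl⟩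
    · have := (Finset.mem_filter.1 hp).2
      exact Or.inr ⟨_, _, this.1, this.2, rfl⟩
    · exact Or.inl ⟨_, _, hl, rfl⟩
  · rintro (⟨l, l', hl, rfl⟩ | ⟨a, b, h1, h2, rfl⟩)
    · exact ⟨.inr ⟨(l, l'), hl⟩, rfl⟩
    · exact ⟨.inl ⟨(a, b), Finset.mem_filter.2 ⟨Finset.mem_univ _, h1, h2⟩⟩, rfl⟩

/-- Each quadric takes at some point a nonzero value that no other quadric takes there. -/
theorem exists_eval_quadric_ne [CharZero K] (s) :
    ∃ x : Sym2 (Fin r ⊕ Fin r) → K, eval x (quadric r K s) ≠ 0 ∧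
      ∀ s', eval x (quadric r K s') = eval x (quadric r K s) → s' = s := by
  rcases s with ⟨⟨a, b⟩, hp⟩ | ⟨⟨l, l'⟩, hl⟩
  · obtain ⟨-, hab, hne⟩ := Finset.mem_filter.1 hp
    obtain ⟨x, u, hu, hx⟩ := exists_eval_N (K := K) hab
    have h1 : eval x (N r K a b) = u := by rw [hx a b hab, if_pos ⟨rfl, rfl⟩]
    refine ⟨x, by simpa only [quadric, h1] using hu, ?_⟩
    have h2 : ∀ i : Fin r, eval x (N r K (.inl i) (.inr i)) = 0 := by
      intro i
      rw [hx _ _ (pos_inl_lt_pos_inr i i), if_neg]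
      rintro ⟨rfl, rfl⟩
      exact hne rfl
    rintro (⟨⟨c, d⟩, hq⟩ | l) h
    · simp only [quadric, h1, hx c d (Finset.mem_filter.1 hq).2.1] at h
      by_cases hc : c = a ∧ d = b
      · obtain ⟨rfl, rfl⟩ := hc
        rfl
      · rw [if_neg hc] at h
        exact absurd h.symm hu
    · simp only [quadric, h1, map_sub, h2, sub_zero] at h
      exact absurd h.symm hu
  · obtain ⟨x, u, hu, hx⟩ := exists_eval_N (K := K) (pos_inl_lt_pos_inr l l)
    have h1 : ∀ i : Fin r, eval x (N r K (.inl i) (.inr i)) = if i = l then u else 0 := by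
      intro i
      simp [hx _ _ (pos_inl_lt_pos_inr i i)]
    have hl' : l' ≠ l := by
      rintro rfl
      simp at hl
    have h2 : eval x (quadric r K (.inr ⟨(l, l'), hl⟩)) = u := by
      simp only [quadric, map_sub, h1]
      rw [if_true, if_neg hl', sub_zero]
    refine ⟨x, by rwa [h2], ?_⟩
    rintro (⟨⟨c, d⟩, hq⟩ | ⟨⟨m, m'⟩, hm⟩) h
    · obtain ⟨-, hcd, hne⟩ := Finset.mem_filter.1 hq
      rw [h2] at h
      simp only [quadric, hx c d hcd] at h
      rw [if_neg] at h
      · exact absurd h.symm hu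
      · rintro ⟨rfl, rfl⟩
        exact hne rfl
    · rw [h2] at h
      simp only [quadric, map_sub, h1] at h
      by_cases hml : m = l
      · subst hml
        have : m' = l' := Fin.ext (hm.trans hl.symm)
        subst this
        rfl
      · rw [if_neg hml, zero_sub] at h
        split_ifs at h with h3
        · exact absurd (self_eq_neg.1 h.symm) hu
        · rw [neg_zero] at h
          exact absurd h.symm hu

theorem ne_zero_of_mem_quadrics [CharZero K] {f : MvPolynomial (Sym2 (Fin r ⊕ Fin r)) K}
    (hf : f ∈ quadrics r K) : f ≠ 0 := by
  rw [← range_quadric] at hf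
  obtain ⟨s, rfl⟩ := hf
  obtain ⟨x, hx, -⟩ := exists_eval_quadric_ne (K := K) s
  intro h
  exact hx (by rw [h, map_zero])

theorem quadric_injective [CharZero K] : Function.Injective (quadric r K) := by
  intro s' s h
  obtain ⟨x, -, hx⟩ := exists_eval_quadric_ne (K := K) s
  exact hx s' (by rw [h])

theorem encard_quadrics [CharZero K] :
    (quadrics r K).encard = (((2 * r + 1) * (r - 1) : ℕ) : ℕ∞) := by
  let e : {p : Fin r × Fin r // (p.2 : ℕ) = p.1 + 1} ≃ Fin (r - 1) :=
    { toFun := fun p => ⟨p.1.1, by have := p.1.2.2; have := p.2; omega⟩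
      invFun := fun i => ⟨(⟨i, by omega⟩, ⟨i + 1, by omega⟩), rfl⟩
      left_inv := by
        rintro ⟨⟨a, b⟩, h⟩
        exact Subtype.ext (Prod.ext rfl (Fin.ext h.symm))
      right_inv := fun i => rfl }
  rw [← range_quadric, ← Set.image_univ, quadric_injective.encard_image, Set.encard_univ, ENat.card_eq_coe_natCard, Nat.card_sum,
    Nat.card_congr e, Nat.card_fin, Nat.card_eq_fintype_card, Fintype.card_coe, card_offPairs,
    add_mul, one_mul]

end Quadrics

end SympQuad

end

theorem proposition3p9 (K : Type*) [Field K] [IsAlgClosed K] [CharZero K] (r : ℕ) (hr : 1 ≤ r) :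
    -- there are `(2r + 1)(r - 1)` quadrics and they cut out `X_{2r}` set-theoretically
    (∀ f ∈ SympQuad.quadrics r K, f ≠ 0 ∧ f.IsHomogeneous 2) ∧
    (SympQuad.quadrics r K).encard = (((2 * r + 1) * (r - 1) : ℕ) : ℕ∞) ∧
    SympQuad.zeroLocus (SympQuad.quadrics r K) = SympQuad.X r K ∧
    -- `Y_i = sec_i ∩ X_{2r}`
    (∀ i : ℕ, 1 ≤ i → i ≤ r →
      SympQuad.Y r K i =
        SympQuad.secantVariety i (SympQuad.veroneseVariety (Fin r ⊕ Fin r) K) ∩ SympQuad.X r K) ∧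
    -- the stratification `Y_1 ⊂ ⋯ ⊂ Y_r ⊂ Y_{2r} = X_{2r}`, whose strata are the orbits
    -- (`Y_0` is empty)
    (∀ i : ℕ, 1 ≤ i → i < r → SympQuad.Y r K i ⊂ SympQuad.Y r K (i + 1)) ∧
    SympQuad.Y r K r ⊂ SympQuad.Y r K (2 * r) ∧
    SympQuad.Y r K (2 * r) = SympQuad.X r K ∧
    (∀ i : ℕ, 1 ≤ i → i ≤ r →
      SympQuad.Y r K i \ SympQuad.Y r K (i - 1) = SympQuad.O r K i) ∧
    SympQuad.X r K \ SympQuad.Y r K r = SympQuad.O r K (2 * r) ∧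
    -- dimensions (no truncation occurs in the subtraction, because `1 ≤ i ≤ r`)
    (∀ i : ℕ, 1 ≤ i → i ≤ r →
      topologicalKrullDim
        ↥(SympQuad.secantVariety i (SympQuad.veroneseVariety (Fin r ⊕ Fin r) K) ∩ SympQuad.X r K) =
          ((2 * r * i + i - i ^ 2 - 1 : ℕ) : WithBot ℕ∞)) ∧
    SympQuad.IsPrimeDivisor (SympQuad.Y r K r) (SympQuad.X r K) :=
  ⟨fun _ hf => ⟨SympQuad.ne_zero_of_mem_quadrics hf, SympQuad.isHomogeneous_of_mem_quadrics hf⟩,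
    SympQuad.encard_quadrics, SympQuad.zeroLocus_quadrics_eq_X hr,
    fun _ h1 h2 => SympQuad.Y_eq_secantVariety_inter_X hr h1 h2,
    fun _ h1 h2 => SympQuad.Y_ssubset_Y_succ hr h1 h2, SympQuad.Y_ssubset_X hr,
    SympQuad.X_eq_Y.symm, fun _ h1 h2 => SympQuad.Y_sdiff_Y_pred hr h1 h2,
    SympQuad.X_sdiff_Y hr,
    fun _ h1 h2 => SympQuad.topologicalKrullDim_secantVariety_inter_X hr h1 h2,
    SympQuad.isPrimeDivisor_Y hr⟩
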